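/- **Problem.** On a connected graph with $n$ agents, minimize $f=\frac1n\sum_{i=1}^n f_i$ over $\mathbb R^d$, where $f_i(x)=\mathbb E_{\xi\sim\mathcal D_i}[F_i(x,\xi)]$, each $F_i(\cdot,\xi)$ is differentiable, each $f_i$ is differentiable with $L$-Lipschitz gradient ($L>0$), and $f^*=\inf f>-\infty$. **Algorithm (DAMSCo).** Parameters $\alpha,\delta>0$, $\beta_1,\beta_2\in(0,1)$, $\gamma\in(0,1]$. Set $x_i^0,\underline x_i^0,m_i^{-1},\hat u_i^{-1},u_i^{-1}$ to $0$. For $t=0,\dots,T-1$ and every agent $i$ (all operations on vectors componentwise): $$g_i^t=\nabla F_i(x_i^t,\xi_i^t),\quad m_i^t=\beta_1m_i^{t-1}+(1-\beta_1)g_i^t,\quad \hat u_i^t=\beta_2\hat u_i^{t-1}+(1-\beta_2)\,g_i^t\circ g_i^t,\quad u_i^t=\max\{u_i^{t-1},\hat u_i^t\},$$ $$x_i^{t+1/2}=x_i^t-\alpha\,\frac{m_i^t}{\sqrt{u_i^t+\delta}},\quad \underline x_i^{t+1}=\underline x_i^t+\mathcal Q[x_i^{t+1/2}-\underline x_i^t],\quad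 x_i^{t+1}=x_i^{t+1/2}+\gamma\Big(\sum_jW_{ji}\underline x_j^{t+1}-\underline x_i^{t+1}\Big).$$ Write $\bar x^t=\frac1n\sum_ix_i^t$, $\|X_\perp^t\|^2=\sum_i\|x_i^t-\bar x^t\|^2$, $J=\frac1n\mathbf 1\mathbf 1^\top$, and $$\mathcal E_T=\frac1T\sum_{t=0}^{T-1}\mathbb E\Big[\|\nabla f(\bar x^t)\|^2+\tfrac1n\|X_\perp^t\|^2\Big].$$ **Assumptions.** $W$ is doubly stochastic, $W_{ij}=0$ if $i\ne j$ are not neighbors, $\mathrm{Null}(W-I)=\mathrm{span}\{\mathbf 1\}$, $\|W-J\|_2<1$. The random compressor satisfies $\mathbb E_{\mathcal Q}\|x-\mathcal Q[x]\|^2\le\eta^2\|x\|^2$ for all $x$, with some $\eta\in[0,1)$. The samples $\xi_i^t\sim\mathcal D_i$ are independent of each other and of the randomness of the compressor, which is fresh at every iteration. For $0\le t<T$ and all $i$: $\mathbb E_t[g_i^t]=\nabla f_i(x_i^t)$, where $\mathbb E_t$ is the expectation over $\xi_i^t$ given the iterate, and almost surely $\|g_i^t\|\le B$, $\|g_i^t\|_\infty\le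 B_\infty$; also $\|\nabla f_i(x)\|\le B$ and $\|\nabla f_i(x)\|_\infty\le B_\infty$ for all $x$ and $i$. With $\hat\rho=\|\gamma W+(1-\gamma)I-J\|_2$, $$\alpha\le\min\Big\{\frac{\delta}{24L\sqrt{B_\infty^2+\delta}},\frac{(1-\eta^2)^2}{32}\Big\},\qquad \gamma\le\min\Big\{\frac{1-\hat\rho^2}{60\eta},\frac{1-\eta^2}{25},\frac{\alpha}{\eta}\Big\}$$ (bounds with $\eta$ in the denominator are void if $\eta=0$). Finally $n\le T$ and $\alpha=\frac{4\theta\sqrt{n(B_\infty^2+\delta)}}{\sqrt T}$ with a constant $\theta\in(\frac n{Le},\frac nL)$. Put $$C=\frac{12}{1-\hat\rho^2}\Big(\frac{4nB^2\hat\rho^2}{\delta(1-\hat\rho^2)}+\frac{nB^2}{45\delta}\Big)+\frac{320\,\alpha nB^2}{\delta(1-\eta^2)^2}.$$ **Theorem.** In both cases below all the expectations in $\mathcal E_T$ are finite. (i) Let $\delta=\omega^2B_\infty^2\frac{\sqrt T}{\sqrt n}$ with a constant $\omega>0$, and $\beta_2\in\big[\frac T{T+1},(\frac{\theta L}n)^{1/T}\big]$.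 Then $$\mathcal E_T=O\bigg(\frac1{\sqrt{nT}}\Big(f(0)-f^*+LB^2+dB_\infty^2(1+L)+C(1+L^2)B_\infty^2\Big)+\frac{C(1+L^2)B_\infty^2}{T}+\frac{nL^2B^2}{T}\bigg),$$ where the hidden constant depends only on $\theta,\omega,\beta_1$. (ii) Let $\delta>0$ be a constant and $\beta_2\in\big[\frac{pT}{pT+1},1\big)$ with $p=\sqrt{nT}$. Then, with $M=\max\{1,B_\infty\}$, $$\mathcal E_T=O\bigg(\frac1{\sqrt{nT}}\Big(f(0)-f^*+dM^3+LB^2M^2+dM^2L+dM^5\Big)+\frac{CM^2}{T}(1+L^2M^2)+\frac{L^2B^2M^4}{T}\bigg),$$ where the hidden constant depends only on $\theta,\delta,\beta_1$. Consequently, if the hidden constants may also depend on $L,B,B_\infty,d$ and an upper bound of $f(0)-f^*$, but not on $n,T,W,\gamma,\eta$ or the graph: * $\mathcal E_T=O\big(\frac1{\sqrt{nT}}+\frac{n+C}T\big)$ in case (ii), and also in case (i) when $C=O(1)$ (the hidden constant then depending on the bound of $C$); * if $T=\Omega\Big(\max\Big\{\frac{n^3}{(1-\hat\rho^2)^4},\frac{n^{7/3}}{(1-\eta^2)^{8/3}}\Big\}\Big)$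 in case (i), then $C=O(1)$ and $\mathcal E_T=O\big(\frac1{\sqrt{nT}}\big)$; * if $T=\Omega\Big(\max\Big\{\frac{n^3}{(1-\hat\rho^2)^4},\frac{n^2}{(1-\eta^2)^2}\Big\}\Big)$ in case (ii), then $\mathcal E_T=O\big(\frac1{\sqrt{nT}}\big)$ (here the hidden constants depend also on the constant in $\Omega$). In both cases $\alpha$ and $\delta$ do not depend on the graph or on $W$. -/

import Mathlib

open MeasureTheory ProbabilityTheory

universe u

noncomputable section

namespace DAMSCo

/-- `ℝ^d` with the Euclidean norm. -/
abbrev Vec (d : ℕ) : Type := EuclideanSpace ℝ (Fin d)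

/-- The data of the decentralized stochastic problem on `n` agents in dimension `d`. -/
structure Setting (n d : ℕ) : Type (u + 1) where
  /-- sample space of agent `i` -/
  Ξ : Fin n → Type u
  [mΞ : ∀ i, MeasurableSpace (Ξ i)]
  /-- data distribution of agent `i` -/
  D : ∀ i, Measure (Ξ i)
  /-- sample loss `F_i(x, ξ)` of agent `i` -/
  F : ∀ i, Vec d → Ξ i → ℝ
  /-- communication graph -/
  G : SimpleGraph (Fin n)
  /-- mixing matrix -/
  W : Matrix (Fin n) (Fin n) ℝ
  /-- space of the internal random seeds of the compressor -/
  S : Type u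
  [mS : MeasurableSpace S]
  /-- law of a seed -/
  ν : Measure S
  /-- the random compression operator, as a function of the seed and of the vector -/
  Q : S → Vec d → Vec d
  /-- the probability space on which the algorithm runs -/
  Ω : Type u
  [mΩ : MeasurableSpace Ω]
  P : Measure Ω
  /-- `ξ i t` is the random sample drawn by agent `i` at iteration `t` -/
  ξ : ∀ i : Fin n, ℕ → Ω → Ξ i
  /-- `ζ i t` is the seed used by the compressor of agent `i` at iteration `t` -/
  ζ : Fin n → ℕ → Ω → S

attribute [instance] Setting.mΞ Setting.mS Setting.mΩ

/-- The parameters of the algorithm. -/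
structure Params where
  α : ℝ
  β₁ : ℝ
  β₂ : ℝ
  δ : ℝ
  γ : ℝ

/-- The variables that the algorithm carries. In the state reached after `t` iterations, these are
`x^t`, `x̲^t`, `m^{t-1}`, `û^{t-1}` and `u^{t-1}`, for every agent. -/
structure State (n d : ℕ) where
  x : Fin n → Vec d
  xu : Fin n → Vec d
  m : Fin n → Vec d
  uhat : Fin n → Vec d
  u : Fin n → Vec d

/-- Everything is initialized at `0`. -/
def State.init (n d : ℕ) : State n d := ⟨0, 0, 0, 0, 0⟩

/-- The average `n⁻¹ ∑ i, x_i`. -/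
def mean {n d : ℕ} (x : Fin n → Vec d) : Vec d := (n : ℝ)⁻¹ • ∑ i, x i

/-- The averaging matrix `J = 1 1ᵀ / n`. -/
def avgMatrix (n : ℕ) : Matrix (Fin n) (Fin n) ℝ := Matrix.of fun _ _ => (n : ℝ)⁻¹

/-- The spectral norm of a square matrix. -/
def specNorm {n : ℕ} (A : Matrix (Fin n) (Fin n) ℝ) : ℝ :=
  ‖Matrix.toEuclideanCLM (n := Fin n) (𝕜 := ℝ) A‖

namespace Setting

variable {n d : ℕ} (s : Setting.{u} n d)

/-- `f_i(x) = E_{ξ ∼ D_i} F_i(x, ξ)`. -/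
def locObj (i : Fin n) (x : Vec d) : ℝ := ∫ z, s.F i x z ∂(s.D i)

/-- `f = n⁻¹ ∑ i, f_i`. -/
def obj (x : Vec d) : ℝ := (n : ℝ)⁻¹ * ∑ i, s.locObj i x

/-- `f^* = inf f`. -/
def optVal : ℝ := ⨅ x, s.obj x

/-- The stochastic gradient `∇F_i(x, z)`, the gradient being taken in `x`. -/
def sgrad (i : Fin n) (x : Vec d) (z : s.Ξ i) : Vec d := gradient (fun y => s.F i y z) x

/-- One iteration of DAMSCo, with samples `z` and compressor seeds `c`. -/
def step (a : Params) (z : ∀ i, s.Ξ i) (c : Fin n → s.S) (st : State n d) : State n d :=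
  let g : Fin n → Vec d := fun i => s.sgrad i (st.x i) (z i)
  let m : Fin n → Vec d := fun i => a.β₁ • st.m i + (1 - a.β₁) • g i
  let uhat : Fin n → Vec d := fun i =>
    WithLp.toLp 2 fun k => a.β₂ * st.uhat i k + (1 - a.β₂) * (g i k * g i k)
  let u : Fin n → Vec d := fun i => WithLp.toLp 2 fun k => max (st.u i k) (uhat i k)
  let xhalf : Fin n → Vec d := fun i =>
    WithLp.toLp 2 fun k => st.x i k - a.α * (m i k / √(u i k + a.δ))
  let xu : Fin n → Vec d := fun i => st.xu i + s.Q (c i) (xhalf i - st.xu i)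
  { x := fun i => xhalf i + a.γ • ((∑ j, s.W j i • xu j) - xu i)
    xu := xu
    m := m
    uhat := uhat
    u := u }

/-- The (random) state after `t` iterations of DAMSCo. -/
def iter (a : Params) : ℕ → s.Ω → State n d
  | 0, _ => State.init n d
  | t + 1, ω => s.step a (fun i => s.ξ i t ω) (fun i => s.ζ i t ω) (iter a t ω)

/-- The stochastic gradient `g_i^t`. -/
def g (a : Params) (i : Fin n) (t : ℕ) (ω : s.Ω) : Vec d :=
  s.sgrad i ((s.iter a t ω).x i) (s.ξ i t ω)

/-- `‖∇f(x̄^t)‖² + ‖X_⊥^t‖² / n`, where `X_⊥^t` has the columns `x_i^t - x̄^t` and its norm is the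
Frobenius norm. -/
def err (a : Params) (t : ℕ) (ω : s.Ω) : ℝ :=
  ‖gradient s.obj (mean (s.iter a t ω).x)‖ ^ 2
    + (n : ℝ)⁻¹ * ∑ i, ‖(s.iter a t ω).x i - mean (s.iter a t ω).x‖ ^ 2

/-- `T⁻¹ ∑_{t < T} E[‖∇f(x̄^t)‖² + ‖X_⊥^t‖² / n] ≤ r`, all these expectations being finite. -/
def AvgErrLE (a : Params) (T : ℕ) (r : ℝ) : Prop :=
  (∀ t < T, Integrable (s.err a t) s.P) ∧
    (T : ℝ)⁻¹ * ∑ t ∈ Finset.range T, ∫ ω, s.err a t ω ∂s.P ≤ r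

/-- `ρ̂ = ‖γ W + (1 - γ) I - J‖₂`. -/
def rhoHat (γ : ℝ) : ℝ := specNorm (γ • s.W + (1 - γ) • (1 : Matrix (Fin n) (Fin n) ℝ) - avgMatrix n)

/-- The constant `C` of the consensus error bound. -/
def C (a : Params) (B η : ℝ) : ℝ :=
  12 / (1 - s.rhoHat a.γ ^ 2) *
      (4 * n * B ^ 2 * s.rhoHat a.γ ^ 2 / (a.δ * (1 - s.rhoHat a.γ ^ 2)) + n * B ^ 2 / (45 * a.δ))
    + 320 * a.α * n * B ^ 2 / (a.δ * (1 - η ^ 2) ^ 2)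

/-- The sample losses are differentiable in `x`, measurable and integrable; every `f_i` is
`L`-smooth; `f` is bounded below. -/
structure Smooth (L : ℝ) : Prop where
  prob : ∀ i, IsProbabilityMeasure (s.D i)
  meas : ∀ i, Measurable fun p : Vec d × s.Ξ i => s.F i p.1 p.2
  integrable : ∀ i x, Integrable (s.F i x) (s.D i)
  differentiable : ∀ i z, Differentiable ℝ fun x => s.F i x z
  L_pos : 0 < L
  locObj_differentiable : ∀ i, Differentiable ℝ (s.locObj i)
  lipschitz : ∀ i x y,
    ‖gradient (s.locObj i) x - gradient (s.locObj i) y‖ ≤ L * ‖x - y‖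
  bddBelow : BddBelow (Set.range s.obj)

/-- The mixing matrix is doubly stochastic, is supported on the edges of the connected
communication graph (and on the diagonal), and has a spectral gap. -/
structure Mixing : Prop where
  connected : s.G.Connected
  nonneg : ∀ i j, 0 ≤ s.W i j
  row_sum : ∀ i, ∑ j, s.W i j = 1
  col_sum : ∀ j, ∑ i, s.W i j = 1
  support : ∀ i j, i ≠ j → ¬ s.G.Adj i j → s.W i j = 0
  null : LinearMap.ker (Matrix.toLin' (s.W - 1)) = Submodule.span ℝ {fun _ => (1 : ℝ)}
  rho_lt_one : specNorm (s.W - avgMatrix n) < 1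

/-- `E_Q ‖x - Q[x]‖² ≤ η² ‖x‖²` for all `x`, with `η ∈ [0, 1)`. -/
structure Compression (η : ℝ) : Prop where
  prob : IsProbabilityMeasure s.ν
  meas : Measurable fun p : s.S × Vec d => s.Q p.1 p.2
  eta_nonneg : 0 ≤ η
  eta_lt_one : η < 1
  integrable : ∀ x, Integrable (fun c => ‖x - s.Q c x‖ ^ 2) s.ν
  bound : ∀ x, ∫ c, ‖x - s.Q c x‖ ^ 2 ∂s.ν ≤ η ^ 2 * ‖x‖ ^ 2

/-- The samples follow the data distributions, the seeds follow the law `ν`, and all samples are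
independent of each other and of the seeds. The seeds of different iterations are independent; those
of different agents at the same iteration may be dependent (for instance shared). -/
structure Sampling : Prop where
  prob : IsProbabilityMeasure s.P
  sample_meas : ∀ i t, Measurable (s.ξ i t)
  sample_law : ∀ i t, s.P.map (s.ξ i t) = s.D i
  seed_meas : ∀ i t, Measurable (s.ζ i t)
  seed_law : ∀ i t, s.P.map (s.ζ i t) = s.ν
  indep : iIndep
    (Sum.elim
      (fun p : Fin n × ℕ => MeasurableSpace.comap (s.ξ p.1 p.2) inferInstance)
      (fun t : ℕ => MeasurableSpace.comap (fun ω (i : Fin n) => s.ζ i t ω) inferInstance)) s.P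

/-- The stochastic gradients used by the algorithm are unbiased and, like the gradients of the
`f_i`, bounded by `B` in the Euclidean norm and by `Binf` in the maximum norm. The expectation over
the fresh sample `ξ_i^t`, given the iterate, is the integral against `D_i` with the iterate frozen. -/
structure BoundedGrad (a : Params) (T : ℕ) (B Binf : ℝ) : Prop where
  B_nonneg : 0 ≤ B
  Binf_nonneg : 0 ≤ Binf
  unbiased : ∀ t < T, ∀ i, ∀ᵐ ω ∂s.P,
    ∫ z, s.sgrad i ((s.iter a t ω).x i) z ∂(s.D i)
      = gradient (s.locObj i) ((s.iter a t ω).x i)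
  sgrad_bound : ∀ t < T, ∀ i, ∀ᵐ ω ∂s.P, ‖s.g a i t ω‖ ≤ B
  sgrad_bound_inf : ∀ t < T, ∀ i, ∀ᵐ ω ∂s.P, ‖WithLp.ofLp (s.g a i t ω)‖ ≤ Binf
  grad_bound : ∀ i x, ‖gradient (s.locObj i) x‖ ≤ B
  grad_bound_inf : ∀ i x, ‖WithLp.ofLp (gradient (s.locObj i) x)‖ ≤ Binf

/-- The standing assumptions on the problem, the ranges of the parameters of the algorithm, the
conditions on `α` and `γ` (those with `η` in the denominator are multiplied out, so that they are
void for `η = 0`), and the choice of `α`. -/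
structure Admissible (a : Params) (T : ℕ) (L B Binf η θ : ℝ) : Prop where
  smooth : s.Smooth L
  mixing : s.Mixing
  compression : s.Compression η
  sampling : s.Sampling
  boundedGrad : s.BoundedGrad a T B Binf
  n_le_T : n ≤ T
  β₁_mem : a.β₁ ∈ Set.Ioo (0 : ℝ) 1
  β₂_mem : a.β₂ ∈ Set.Ioo (0 : ℝ) 1
  δ_pos : 0 < a.δ
  γ_pos : 0 < a.γ
  γ_le_one : a.γ ≤ 1
  θ_mem : θ ∈ Set.Ioo (n / (L * Real.exp 1)) (n / L)
  α_eq : a.α = 4 * θ * √(n * (Binf ^ 2 + a.δ)) / √T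
  α_le : a.α ≤ a.δ / (24 * L * √(Binf ^ 2 + a.δ))
  α_le' : a.α ≤ (1 - η ^ 2) ^ 2 / 32
  γ_le : a.γ * (60 * η) ≤ 1 - s.rhoHat a.γ ^ 2
  γ_le' : a.γ ≤ (1 - η ^ 2) / 25
  γ_le'' : a.γ * η ≤ a.α

end Setting

/-- Case (i): `δ = ω² B_∞² √T / √n` and `β₂ ∈ [T/(T+1), (θL/n)^{1/T}]`. -/
def CaseI (a : Params) (n T : ℕ) (L Binf θ ω : ℝ) : Prop :=
  a.δ = ω ^ 2 * Binf ^ 2 * (√T / √n) ∧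
    a.β₂ ∈ Set.Icc ((T : ℝ) / (T + 1)) ((θ * L / n) ^ ((1 : ℝ) / T))

/-- Case (ii): `δ = δ₀` and `β₂ ∈ [pT/(pT+1), 1)` with `p = √(nT)`. -/
def CaseII (a : Params) (n T : ℕ) (δ₀ : ℝ) : Prop :=
  a.δ = δ₀ ∧ a.β₂ ∈ Set.Ico (√(n * T) * T / (√(n * T) * T + 1)) (1 : ℝ)

end DAMSCo

end

/-! ### Frobenius norms, averages, mixing matrices and the descent lemma -/

namespace DAMSCo

/-! Write `λ = α / √δ`, `q = 1 - ρ̂²` and `h = 1 - η²`. The proof is a descent argument for `f`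
along a virtual sequence, `virt`, which is the averaged iterate minus a fixed multiple of the
averaged momentum. The multiple is chosen so that the momentum cancels in the increment
(`virt_succ_sub`): `virt` moves by `-λ` times the averaged stochastic gradient, plus an error `pert`
due to the adaptive denominators. Gossip does not appear, because double stochasticity preserves
averages.

Three errors have to be controlled. The noise has mean zero given the past, and the noises of
different agents are orthogonal, so the squared averaged noise costs only `4B²/n`; this yields the
linear speedup. The denominators are harmless because `û` can grow by at most `(1 - β₂) B_∞²` per
step. Hence `u ≤ T (1 - β₂) B_∞²`, and `1/√(u + δ)` differs from `1/√δ` by a relative error at most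
`U/(U + δ)` for any `U` above that bound. In case (i) this is small because `δ` is large, in case
(ii) because `1 - β₂` is small.

The third error is the disagreement of the agents. It is coupled with the vector to be compressed:
mixing contracts the first up to compression error, and compression contracts the second up to
disagreement. Both are driven by `S = α² n B²/δ`, an almost sure bound on the squared local moves. A
joint induction (`consensus_and_gap`) gives expected disagreement at most `10 S/q²`; the smallness
of `γ` absorbs the `1/h²` part of the compression error.

Summing the descent inequality gives `avgErrLE_basic`. The consensus and momentum terms are then
expressed through `C`, which is comparable to `n B²/(δ q²)` from both sides (`le_C`, `C_le`), and
the choices of `α`, `δ` and `β₂` turn the result into the rates. -/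

/-- Convexity of the square with weights `1 - τ` and `τ`; the defect is an exact square. In the
contraction estimates `τ` is a quarter of a gap, so the factor `1/(1 - τ)` costs only part of the
contraction. -/
theorem add_sq_le_div {x y τ : ℝ} (h0 : 0 < τ) (h1 : τ < 1) :
    (x + y) ^ 2 ≤ x ^ 2 / (1 - τ) + y ^ 2 / τ := by
  have h2 : 0 < 1 - τ := by linarith
  have : x ^ 2 / (1 - τ) + y ^ 2 / τ - (x + y) ^ 2
      = (τ * x - (1 - τ) * y) ^ 2 / (τ * (1 - τ)) := by field_simp; ring
  have h3 : 0 ≤ (τ * x - (1 - τ) * y) ^ 2 / (τ * (1 - τ)) := by positivity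
  linarith

/-- The squared Frobenius norm of a family of vectors. -/
noncomputable def fro {n d : ℕ} (x : Fin n → Vec d) : ℝ := ∑ i, ‖x i‖ ^ 2

theorem fro_nonneg {n d : ℕ} (x : Fin n → Vec d) : 0 ≤ fro x :=
  Finset.sum_nonneg fun _ _ => by positivity

theorem fro_add_le {n d : ℕ} (x y : Fin n → Vec d) {τ : ℝ} (h0 : 0 < τ) (h1 : τ < 1) :
    fro (fun i => x i + y i) ≤ fro x / (1 - τ) + fro y / τ := by
  unfold fro
  rw [Finset.sum_div, Finset.sum_div, ← Finset.sum_add_distrib]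
  refine Finset.sum_le_sum fun i _ => le_trans ?_ (add_sq_le_div h0 h1)
  gcongr
  exact norm_add_le _ _

theorem fro_smul {n d : ℕ} (c : ℝ) (x : Fin n → Vec d) :
    fro (fun i => c • x i) = c ^ 2 * fro x := by
  unfold fro
  rw [Finset.mul_sum]
  refine Finset.sum_congr rfl fun i _ => ?_
  rw [norm_smul, mul_pow, Real.norm_eq_abs, sq_abs]

theorem fro_add_le_two {n d : ℕ} (x y : Fin n → Vec d) :
    fro (fun i => x i + y i) ≤ 2 * fro x + 2 * fro y := by
  have := fro_add_le x y (τ := 1 / 2) (by norm_num) (by norm_num)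
  refine this.trans (le_of_eq ?_)
  ring

theorem fro_sub_le_two {n d : ℕ} (x y : Fin n → Vec d) :
    fro (fun i => x i - y i) ≤ 2 * fro x + 2 * fro y := by
  have h := fro_add_le_two x (fun i => (-1 : ℝ) • y i)
  rw [fro_smul] at h
  simpa [sub_eq_add_neg] using h

theorem fro_sub_mean_le {n d : ℕ} (x : Fin n → Vec d) :
    fro (fun i => x i - mean x) ≤ fro x := by
  rcases Nat.eq_zero_or_pos n with rfl | hn
  · simp [fro]
  have hn' : (n : ℝ) ≠ 0 := by positivity
  have key : ∑ i, inner ℝ (x i) (mean x) = n * ‖mean x‖ ^ 2 := by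
    rw [← sum_inner, ← real_inner_self_eq_norm_sq]
    have : ∑ i, x i = (n : ℝ) • mean x := by
      rw [mean, smul_smul, mul_inv_cancel₀ hn', one_smul]
    rw [this, real_inner_smul_left]
  have : fro (fun i => x i - mean x) = fro x - n * ‖mean x‖ ^ 2 := by
    unfold fro
    simp_rw [norm_sub_sq_real]
    rw [Finset.sum_add_distrib, Finset.sum_sub_distrib, ← Finset.mul_sum, key]
    simp
    ring
  rw [this]
  have : 0 ≤ (n : ℝ) * ‖mean x‖ ^ 2 := by positivity
  linarith

theorem sum_sub_mean {n d : ℕ} (hn : 0 < n) (x : Fin n → Vec d) : ∑ i, (x i - mean x) = 0 := by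
  have hn' : (n : ℝ) ≠ 0 := by positivity
  rw [Finset.sum_sub_distrib, Finset.sum_const, Finset.card_univ, Fintype.card_fin, mean,
    ← Nat.cast_smul_eq_nsmul ℝ, smul_smul, mul_inv_cancel₀ hn', one_smul, sub_self]

theorem norm_mean_sq_le {n d : ℕ} (x : Fin n → Vec d) :
    ‖mean x‖ ^ 2 ≤ (n : ℝ)⁻¹ * fro x := by
  rcases Nat.eq_zero_or_pos n with rfl | hn
  · simp [fro, mean]
  have h1 : ‖∑ i, x i‖ ^ 2 ≤ n * fro x := by
    calc ‖∑ i, x i‖ ^ 2 ≤ (∑ i, ‖x i‖) ^ 2 := by gcongr; exact norm_sum_le _ _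
      _ ≤ n * fro x := by
        have := sq_sum_le_card_mul_sum_sq (s := (Finset.univ : Finset (Fin n))) (f := fun i => ‖x i‖)
        simpa [fro] using this
  rw [mean, norm_smul, mul_pow, Real.norm_eq_abs, sq_abs]
  calc ((n : ℝ)⁻¹) ^ 2 * ‖∑ i, x i‖ ^ 2 ≤ ((n : ℝ)⁻¹) ^ 2 * (n * fro x) := by gcongr
    _ = (n : ℝ)⁻¹ * fro x := by
      have hn' : (n : ℝ) ≠ 0 := by positivity
      field_simp

theorem norm_mean_le {n d : ℕ} {x : Fin n → Vec d} {b : ℝ} (hb : 0 ≤ b) (h : ∀ i, ‖x i‖ ≤ b) :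
    ‖mean x‖ ≤ b := by
  rcases Nat.eq_zero_or_pos n with rfl | hn
  · simpa [mean] using hb
  rw [mean, norm_smul, norm_inv, Real.norm_natCast, inv_mul_le_iff₀ (by positivity)]
  calc ‖∑ i, x i‖ ≤ ∑ i, ‖x i‖ := norm_sum_le _ _
    _ ≤ ∑ _i : Fin n, b := Finset.sum_le_sum fun i _ => h i
    _ = n * b := by simp

theorem mean_add {n d : ℕ} (x y : Fin n → Vec d) :
    mean (fun i => x i + y i) = mean x + mean y := by
  simp [mean, Finset.sum_add_distrib, smul_add]

theorem mean_sub {n d : ℕ} (x y : Fin n → Vec d) :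
    mean (fun i => x i - y i) = mean x - mean y := by
  simp [mean, Finset.sum_sub_distrib, smul_sub]

theorem mean_smul {n d : ℕ} (c : ℝ) (x : Fin n → Vec d) :
    mean (fun i => c • x i) = c • mean x := by
  simp [mean, ← Finset.smul_sum, smul_comm c]

theorem specNorm_nonneg {n : ℕ} (A : Matrix (Fin n) (Fin n) ℝ) : 0 ≤ specNorm A := norm_nonneg _

theorem specNorm_transpose {n : ℕ} (A : Matrix (Fin n) (Fin n) ℝ) :
    specNorm A.transpose = specNorm A := by
  have : A.transpose = star A := by
    ext i j; simp [Matrix.star_apply]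
  rw [specNorm, this, map_star, ContinuousLinearMap.star_eq_adjoint, LinearIsometryEquiv.norm_map,
    specNorm]

theorem specNorm_mulVec_le {n : ℕ} (A : Matrix (Fin n) (Fin n) ℝ) (v : Fin n → ℝ) :
    ∑ i, (∑ j, A i j * v j) ^ 2 ≤ specNorm A ^ 2 * ∑ j, v j ^ 2 := by
  have h := (Matrix.toEuclideanCLM (n := Fin n) (𝕜 := ℝ) A).le_opNorm (WithLp.toLp 2 v)
  have h2 : ‖(Matrix.toEuclideanCLM (n := Fin n) (𝕜 := ℝ) A) (WithLp.toLp 2 v)‖ ^ 2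
      ≤ (specNorm A * ‖(WithLp.toLp 2 v : EuclideanSpace ℝ (Fin n))‖) ^ 2 := by
    gcongr
    exact h
  rw [mul_pow, EuclideanSpace.norm_sq_eq, EuclideanSpace.norm_sq_eq] at h2
  simpa [Matrix.toEuclideanCLM_toLp, Matrix.mulVec, dotProduct] using h2

/-- The spectral bound is applied to each coordinate separately. Agents mix along columns of `A`,
hence the transpose. -/
theorem fro_mix_le {n d : ℕ} (A : Matrix (Fin n) (Fin n) ℝ) (x : Fin n → Vec d) :
    fro (fun i => ∑ j, A j i • x j) ≤ specNorm A ^ 2 * fro x := by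
  unfold fro
  simp_rw [EuclideanSpace.norm_sq_eq]
  rw [Finset.sum_comm (s := Finset.univ (α := Fin n)), Finset.sum_comm (s := Finset.univ (α := Fin n)),
    Finset.mul_sum]
  refine Finset.sum_le_sum fun k _ => ?_
  have := specNorm_mulVec_le A.transpose (fun j => x j k)
  rw [specNorm_transpose] at this
  simpa [Matrix.transpose_apply] using this

/-- Jensen for each agent, with the column of `A` as weights; exchanging the sums then brings in the
row sums. -/
theorem fro_stochastic_le {n d : ℕ} (A : Matrix (Fin n) (Fin n) ℝ) (h0 : ∀ i j, 0 ≤ A i j)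
    (hr : ∀ i, ∑ j, A i j = 1) (hc : ∀ j, ∑ i, A i j = 1) (x : Fin n → Vec d) :
    fro (fun i => ∑ j, A j i • x j) ≤ fro x := by
  have h1 : ∀ i, ‖∑ j, A j i • x j‖ ^ 2 ≤ ∑ j, A j i * ‖x j‖ ^ 2 := by
    intro i
    have := ((convexOn_norm (convex_univ (E := Vec d) (𝕜 := ℝ))).pow
      (fun _ _ => norm_nonneg _) 2).map_sum_le (t := Finset.univ) (w := fun j => A j i) (p := x)
      (fun j _ => h0 j i) (hc i) (fun _ _ => Set.mem_univ _)
    simpa using this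
  calc fro (fun i => ∑ j, A j i • x j) ≤ ∑ i, ∑ j, A j i * ‖x j‖ ^ 2 :=
        Finset.sum_le_sum fun i _ => h1 i
    _ = fro x := by
      rw [Finset.sum_comm]
      simp_rw [← Finset.sum_mul, hr, one_mul]
      rfl

/-- The mean value theorem gives the quadratic term with `L` in place of the sharp `L/2`; this is
enough below. -/
theorem le_add_of_lipschitz_gradient {d : ℕ} {f : Vec d → ℝ} {L : ℝ} (hf : Differentiable ℝ f)
    (hL : 0 ≤ L) (h : ∀ x y, ‖gradient f x - gradient f y‖ ≤ L * ‖x - y‖) (x y : Vec d) :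
    f y ≤ f x + inner ℝ (gradient f x) (y - x) + L * ‖y - x‖ ^ 2 := by
  obtain ⟨z, hz, he⟩ := domain_mvt (f := f) (s := Set.univ) (x := x) (y := y)
    (fun w _ => (hf w).hasFDerivAt.hasFDerivWithinAt) convex_univ (Set.mem_univ _) (Set.mem_univ _)
  have h1 : fderiv ℝ f z (y - x) = inner ℝ (gradient f z) (y - x) := by
    rw [inner_gradient_left]
  have h2 : inner ℝ (gradient f z) (y - x) = inner ℝ (gradient f x) (y - x)
      + inner ℝ (gradient f z - gradient f x) (y - x) := by
    rw [inner_sub_left]; ring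
  have h3 : inner ℝ (gradient f z - gradient f x) (y - x) ≤ L * ‖y - x‖ * ‖y - x‖ := by
    refine (real_inner_le_norm _ _).trans ?_
    gcongr
    refine (h z x).trans ?_
    gcongr
    exact norm_sub_le_of_mem_segment hz
  nlinarith

end DAMSCo

/-! ### One-step identities of the algorithm -/

namespace DAMSCo
namespace Setting

variable {n d : ℕ} (s : Setting.{u} n d) (a : Params)

/-- The preconditioned momentum `m_i^t / √(u_i^t + δ)`. -/
noncomputable def dir (t : ℕ) (ω : s.Ω) (i : Fin n) : Vec d :=
  WithLp.toLp 2 fun k => (s.iter a (t + 1) ω).m i k / √((s.iter a (t + 1) ω).u i k + a.δ)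

/-- The local half step `x_i^{t+1/2}`. -/
noncomputable def half (t : ℕ) (ω : s.Ω) (i : Fin n) : Vec d :=
  (s.iter a t ω).x i - a.α • s.dir a t ω i

/-- The vector `x_i^{t+1/2} - x̲_i^t` that is compressed. -/
noncomputable def gap (t : ℕ) (ω : s.Ω) (i : Fin n) : Vec d :=
  s.half a t ω i - (s.iter a t ω).xu i

/-- The compression error `x_i^{t+1/2} - x̲_i^{t+1}`. -/
noncomputable def cerr (t : ℕ) (ω : s.Ω) (i : Fin n) : Vec d :=
  s.gap a t ω i - s.Q (s.ζ i t ω) (s.gap a t ω i)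

/-- The consensus deviation `x_i^t - x̄^t`. -/
noncomputable def dev (t : ℕ) (ω : s.Ω) (i : Fin n) : Vec d :=
  (s.iter a t ω).x i - mean (s.iter a t ω).x

theorem iter_succ_m (t : ℕ) (ω : s.Ω) (i : Fin n) :
    (s.iter a (t + 1) ω).m i = a.β₁ • (s.iter a t ω).m i + (1 - a.β₁) • s.g a i t ω := rfl

theorem iter_succ_uhat (t : ℕ) (ω : s.Ω) (i : Fin n) (k : Fin d) :
    (s.iter a (t + 1) ω).uhat i k
      = a.β₂ * (s.iter a t ω).uhat i k + (1 - a.β₂) * (s.g a i t ω k * s.g a i t ω k) := rfl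

theorem iter_succ_u (t : ℕ) (ω : s.Ω) (i : Fin n) (k : Fin d) :
    (s.iter a (t + 1) ω).u i k
      = max ((s.iter a t ω).u i k) ((s.iter a (t + 1) ω).uhat i k) := rfl

theorem iter_succ_xu (t : ℕ) (ω : s.Ω) (i : Fin n) :
    (s.iter a (t + 1) ω).xu i
      = (s.iter a t ω).xu i + s.Q (s.ζ i t ω) (s.gap a t ω i) := rfl

/-- Replacing the tracked copies by half steps minus compression errors is what turns one iteration
into exact gossip plus a perturbation. -/
theorem iter_succ_xu_eq (t : ℕ) (ω : s.Ω) (i : Fin n) :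
    (s.iter a (t + 1) ω).xu i = s.half a t ω i - s.cerr a t ω i := by
  rw [iter_succ_xu, cerr, gap]; abel

theorem iter_succ_x (t : ℕ) (ω : s.Ω) (i : Fin n) :
    (s.iter a (t + 1) ω).x i = s.half a t ω i
      + a.γ • ((∑ j, s.W j i • (s.iter a (t + 1) ω).xu j) - (s.iter a (t + 1) ω).xu i) := rfl

variable {s a}

theorem Mixing.mean_mix (hW : s.Mixing) (x : Fin n → Vec d) :
    mean (fun i => ∑ j, s.W j i • x j) = mean x := by
  unfold mean
  rw [Finset.sum_comm]
  simp_rw [← Finset.sum_smul, hW.row_sum, one_smul]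

/-- The gossip correction has zero average since each agent distributes total weight one, so
compression never enters the averaged iterate directly. -/
theorem Mixing.mean_iter_succ (hW : s.Mixing) (t : ℕ) (ω : s.Ω) :
    mean (s.iter a (t + 1) ω).x = mean (s.iter a t ω).x - a.α • mean (s.dir a t ω) := by
  have h : (s.iter a (t + 1) ω).x = fun i => s.half a t ω i
      + a.γ • ((∑ j, s.W j i • (s.iter a (t + 1) ω).xu j) - (s.iter a (t + 1) ω).xu i) :=
    funext fun i => s.iter_succ_x a t ω i
  rw [h, mean_add, mean_smul, mean_sub, hW.mean_mix, sub_self, smul_zero, add_zero]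
  unfold half
  rw [mean_sub, mean_smul]

/-- The stochastic gradients obey their almost sure bounds along the path `ω`. -/
def Good (s : Setting.{u} n d) (a : Params) (T : ℕ) (B Binf : ℝ) (ω : s.Ω) : Prop :=
  ∀ t < T, ∀ i, ‖s.g a i t ω‖ ≤ B ∧ ∀ k, |s.g a i t ω k| ≤ Binf

theorem BoundedGrad.ae_good {T : ℕ} {B Binf : ℝ} (h : s.BoundedGrad a T B Binf) :
    ∀ᵐ ω ∂s.P, s.Good a T B Binf ω := by
  have h1 : ∀ t, ∀ i, t < T → ∀ᵐ ω ∂s.P, ‖s.g a i t ω‖ ≤ B ∧ ∀ k, |s.g a i t ω k| ≤ Binf := by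
    intro t i ht
    filter_upwards [h.sgrad_bound t ht i, h.sgrad_bound_inf t ht i] with ω h1 h2
    exact ⟨h1, fun k => (norm_le_pi_norm (WithLp.ofLp (s.g a i t ω)) k).trans h2⟩
  have h2 : ∀ᵐ ω ∂s.P, ∀ t, ∀ i, t < T → ‖s.g a i t ω‖ ≤ B ∧ ∀ k, |s.g a i t ω k| ≤ Binf := by
    rw [ae_all_iff]; intro t
    rw [ae_all_iff]; intro i
    by_cases ht : t < T
    · filter_upwards [h1 t i ht] with ω h _ using h
    · exact Filter.Eventually.of_forall fun ω h => absurd h ht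
  filter_upwards [h2] with ω h t ht i using h t i ht

/-! ### Almost sure bounds along a path -/

section Bounds

variable {T : ℕ} {B Binf : ℝ} {ω : s.Ω}

theorem Good.norm_m_le (h : s.Good a T B Binf ω) (hB : 0 ≤ B) (hβ : a.β₁ ∈ Set.Ioo (0 : ℝ) 1)
    {t : ℕ} (ht : t ≤ T) (i : Fin n) : ‖(s.iter a t ω).m i‖ ≤ B := by
  induction t with
  | zero => simpa [iter, State.init] using hB
  | succ t ih =>
    have h1 := ih (by omega)
    have h2 := (h t (by omega) i).1
    have h3 : 0 < 1 - a.β₁ := by linarith [hβ.2]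
    rw [iter_succ_m]
    refine (norm_add_le _ _).trans ?_
    rw [norm_smul, norm_smul, Real.norm_of_nonneg hβ.1.le, Real.norm_of_nonneg h3.le]
    nlinarith [hβ.1]

theorem Good.abs_m_le (h : s.Good a T B Binf ω) (hB : 0 ≤ Binf) (hβ : a.β₁ ∈ Set.Ioo (0 : ℝ) 1)
    {t : ℕ} (ht : t ≤ T) (i : Fin n) (k : Fin d) : |(s.iter a t ω).m i k| ≤ Binf := by
  induction t with
  | zero => simpa [iter, State.init] using hB
  | succ t ih =>
    have h1 := ih (by omega)
    have h2 := (h t (by omega) i).2 k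
    have h3 : 0 < 1 - a.β₁ := by linarith [hβ.2]
    rw [iter_succ_m]
    simp only [PiLp.add_apply, PiLp.smul_apply, smul_eq_mul]
    refine (abs_add_le _ _).trans ?_
    rw [abs_mul, abs_mul, abs_of_nonneg hβ.1.le, abs_of_nonneg h3.le]
    nlinarith [hβ.1]

/-- The decay factor `β₂` is bounded by one, and only the increments are counted. The result is
small when `T (1 - β₂)` is, unlike the usual bound `B_∞²`. -/
theorem Good.uhat_mem (h : s.Good a T B Binf ω) (hβ : a.β₂ ∈ Set.Ioo (0 : ℝ) 1)
    {t : ℕ} (ht : t ≤ T) (i : Fin n) (k : Fin d) :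
    (s.iter a t ω).uhat i k ∈ Set.Icc 0 (t * (1 - a.β₂) * Binf ^ 2) := by
  induction t with
  | zero => simp [iter, State.init]
  | succ t ih =>
    have h1 := ih (by omega)
    have h2 := (h t (by omega) i).2 k
    have h3 : 0 < 1 - a.β₂ := by linarith [hβ.2]
    have h4 : s.g a i t ω k * s.g a i t ω k ≤ Binf ^ 2 := by
      have := abs_le.1 h2
      nlinarith
    have h5 : 0 ≤ s.g a i t ω k * s.g a i t ω k := mul_self_nonneg _
    have h6 := mul_le_mul_of_nonneg_left h4 h3.le
    have h7 := mul_le_mul_of_nonneg_right hβ.2.le h1.1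
    rw [iter_succ_uhat]
    refine ⟨add_nonneg (mul_nonneg hβ.1.le h1.1) (mul_nonneg h3.le h5), ?_⟩
    have h8 := h1.2
    push_cast
    linarith

theorem Good.u_mem (h : s.Good a T B Binf ω) (hβ : a.β₂ ∈ Set.Ioo (0 : ℝ) 1)
    {t : ℕ} (ht : t ≤ T) (i : Fin n) (k : Fin d) :
    (s.iter a t ω).u i k ∈ Set.Icc 0 (t * (1 - a.β₂) * Binf ^ 2) := by
  induction t with
  | zero => simp [iter, State.init]
  | succ t ih =>
    have h1 := ih (by omega)
    have h2 := h.uhat_mem hβ ht i k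
    have h3 : 0 < 1 - a.β₂ := by linarith [hβ.2]
    rw [iter_succ_u]
    refine ⟨h1.1.trans (le_max_left _ _), max_le (h1.2.trans ?_) h2.2⟩
    gcongr
    simp

theorem Good.norm_dir_sq_le (h : s.Good a T B Binf ω) (hB : 0 ≤ B)
    (hβ : a.β₁ ∈ Set.Ioo (0 : ℝ) 1) (hβ₂ : a.β₂ ∈ Set.Ioo (0 : ℝ) 1) (hδ : 0 < a.δ)
    {t : ℕ} (ht : t < T) (i : Fin n) : ‖s.dir a t ω i‖ ^ 2 ≤ B ^ 2 / a.δ := by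
  have h1 : ‖s.dir a t ω i‖ ^ 2 ≤ ‖(s.iter a (t + 1) ω).m i‖ ^ 2 / a.δ := by
    rw [EuclideanSpace.norm_sq_eq, EuclideanSpace.norm_sq_eq, Finset.sum_div]
    refine Finset.sum_le_sum fun k _ => ?_
    have hu := (h.u_mem hβ₂ (show t + 1 ≤ T from ht) i k).1
    simp only [dir, norm_div, div_pow]
    rw [Real.norm_of_nonneg (Real.sqrt_nonneg _), Real.sq_sqrt (by linarith)]
    gcongr
    linarith
  refine h1.trans ?_
  gcongr
  exact h.norm_m_le hB hβ (show t + 1 ≤ T from ht) i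

theorem Good.fro_dir_le (h : s.Good a T B Binf ω) (hB : 0 ≤ B)
    (hβ : a.β₁ ∈ Set.Ioo (0 : ℝ) 1) (hβ₂ : a.β₂ ∈ Set.Ioo (0 : ℝ) 1) (hδ : 0 < a.δ)
    {t : ℕ} (ht : t < T) : fro (s.dir a t ω) ≤ n * (B ^ 2 / a.δ) := by
  calc fro (s.dir a t ω) ≤ ∑ _i : Fin n, B ^ 2 / a.δ :=
        Finset.sum_le_sum fun i _ => h.norm_dir_sq_le hB hβ hβ₂ hδ ht i
    _ = n * (B ^ 2 / a.δ) := by simp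

variable (s a) in
/-- The effect of the adaptive scaling on the averaged direction. -/
noncomputable def pert (t : ℕ) (ω : s.Ω) : Vec d :=
  mean (s.dir a t ω) - (√a.δ)⁻¹ • mean (s.iter a (t + 1) ω).m

/-- The ratio `r = √δ / √(u + δ)` is at most one, so `r ≥ r² = δ/(u + δ) ≥ δ/(U + δ)`. -/
theorem inv_sqrt_sub_le {u U δ : ℝ} (hδ : 0 < δ) (hu : 0 ≤ u) (hU : u ≤ U) :
    |1 / √(u + δ) - (√δ)⁻¹| ≤ (√δ)⁻¹ * (U / (U + δ)) := by
  have h1 : 0 < √δ := Real.sqrt_pos.2 hδ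
  have h2 : √δ ≤ √(u + δ) := Real.sqrt_le_sqrt (by linarith)
  have h3 : 0 < √(u + δ) := h1.trans_le h2
  have h4 : √(u + δ) ^ 2 = u + δ := Real.sq_sqrt (by linarith)
  have h5 : √δ ^ 2 = δ := Real.sq_sqrt hδ.le
  have h6 : 1 / √(u + δ) ≤ (√δ)⁻¹ := by
    rw [one_div]; gcongr
  rw [abs_sub_comm, abs_of_nonneg (by linarith)]
  have h7 : δ / (U + δ) ≤ √δ / √(u + δ) := by
    calc δ / (U + δ) ≤ δ / (u + δ) := by gcongr
      _ = (√δ / √(u + δ)) ^ 2 := by rw [div_pow, h4, h5]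
      _ ≤ √δ / √(u + δ) := by
        have : √δ / √(u + δ) ≤ 1 := (div_le_one h3).2 h2
        have h0 : 0 ≤ √δ / √(u + δ) := by positivity
        nlinarith
  have h8 : (√δ)⁻¹ - 1 / √(u + δ) = (√δ)⁻¹ * (1 - √δ / √(u + δ)) := by
    field_simp
  have h9 : U / (U + δ) = 1 - δ / (U + δ) := by
    have : U + δ ≠ 0 := by linarith
    field_simp; ring
  rw [h8, h9]
  gcongr

theorem Good.abs_pert_le (h : s.Good a T B Binf ω) (hB : 0 ≤ Binf)
    (hβ : a.β₁ ∈ Set.Ioo (0 : ℝ) 1) (hβ₂ : a.β₂ ∈ Set.Ioo (0 : ℝ) 1) (hδ : 0 < a.δ)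
    {U : ℝ} (hU : T * (1 - a.β₂) * Binf ^ 2 ≤ U) {t : ℕ} (ht : t < T) (k : Fin d) :
    |s.pert a t ω k| ≤ Binf * ((√a.δ)⁻¹ * (U / (U + a.δ))) := by
  have hβ' : 0 < 1 - a.β₂ := by linarith [hβ₂.2]
  have hU0 : 0 ≤ U := le_trans (by positivity) hU
  have h1 : ∀ i, |s.dir a t ω i k - (√a.δ)⁻¹ * (s.iter a (t + 1) ω).m i k|
      ≤ Binf * ((√a.δ)⁻¹ * (U / (U + a.δ))) := by
    intro i
    have hu := h.u_mem hβ₂ (show t + 1 ≤ T from ht) i k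
    have h2 := inv_sqrt_sub_le hδ hu.1 (hu.2.trans (le_trans (by gcongr; exact ht) hU))
    have h3 := h.abs_m_le hB hβ (show t + 1 ≤ T from ht) i k
    have h4 : s.dir a t ω i k - (√a.δ)⁻¹ * (s.iter a (t + 1) ω).m i k
        = (s.iter a (t + 1) ω).m i k
          * (1 / √((s.iter a (t + 1) ω).u i k + a.δ) - (√a.δ)⁻¹) := by
      simp only [dir]; ring
    rw [h4, abs_mul]
    gcongr
  have h5 : s.pert a t ω k
      = (n : ℝ)⁻¹ * ∑ i, (s.dir a t ω i k - (√a.δ)⁻¹ * (s.iter a (t + 1) ω).m i k) := by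
    simp only [pert, mean, PiLp.sub_apply, PiLp.smul_apply, WithLp.ofLp_sum, Finset.sum_apply,
      smul_eq_mul, Finset.sum_sub_distrib, ← Finset.mul_sum]
    ring
  have h6 : 0 ≤ Binf * ((√a.δ)⁻¹ * (U / (U + a.δ))) := by positivity
  rcases Nat.eq_zero_or_pos n with rfl | hn
  · rw [h5]; simpa using h6
  rw [h5, abs_mul, abs_of_nonneg (by positivity), inv_mul_le_iff₀ (by positivity)]
  calc |∑ i, (s.dir a t ω i k - (√a.δ)⁻¹ * (s.iter a (t + 1) ω).m i k)|
      ≤ ∑ i, |s.dir a t ω i k - (√a.δ)⁻¹ * (s.iter a (t + 1) ω).m i k| :=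
        Finset.abs_sum_le_sum_abs _ _
    _ ≤ ∑ _i : Fin n, Binf * ((√a.δ)⁻¹ * (U / (U + a.δ))) :=
        Finset.sum_le_sum fun i _ => h1 i
    _ = _ := by simp

theorem Good.norm_pert_sq_le (h : s.Good a T B Binf ω) (hB : 0 ≤ Binf)
    (hβ : a.β₁ ∈ Set.Ioo (0 : ℝ) 1) (hβ₂ : a.β₂ ∈ Set.Ioo (0 : ℝ) 1) (hδ : 0 < a.δ)
    {U : ℝ} (hU : T * (1 - a.β₂) * Binf ^ 2 ≤ U) {t : ℕ} (ht : t < T) :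
    ‖s.pert a t ω‖ ^ 2 ≤ d * (Binf ^ 2 * (U / (U + a.δ)) / a.δ) := by
  have hβ' : 0 < 1 - a.β₂ := by linarith [hβ₂.2]
  have hU0 : 0 ≤ U := le_trans (by positivity) hU
  have hR0 : 0 ≤ U / (U + a.δ) := by positivity
  have hR1 : U / (U + a.δ) ≤ 1 := (div_le_one (by linarith)).2 (by linarith)
  rw [EuclideanSpace.norm_sq_eq]
  calc ∑ k, ‖s.pert a t ω k‖ ^ 2
      ≤ ∑ _k : Fin d, (Binf * ((√a.δ)⁻¹ * (U / (U + a.δ)))) ^ 2 := by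
        refine Finset.sum_le_sum fun k _ => ?_
        gcongr
        exact h.abs_pert_le hB hβ hβ₂ hδ hU ht k
    _ = d * (Binf ^ 2 * (U / (U + a.δ)) ^ 2 / a.δ) := by
        rw [mul_pow, mul_pow, inv_pow, Real.sq_sqrt hδ.le]
        simp only [Finset.sum_const, Finset.card_univ, Fintype.card_fin, nsmul_eq_mul]
        ring
    -- One of the two factors `U/(U + δ) ≤ 1` is given up, so that this bound and the one for the
    -- inner product involve the same quantity.
    _ ≤ d * (Binf ^ 2 * (U / (U + a.δ)) / a.δ) := by
        gcongr
        nlinarith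

theorem Good.abs_inner_pert_le (h : s.Good a T B Binf ω) (hB : 0 ≤ Binf)
    (hβ : a.β₁ ∈ Set.Ioo (0 : ℝ) 1) (hβ₂ : a.β₂ ∈ Set.Ioo (0 : ℝ) 1) (hδ : 0 < a.δ)
    {U : ℝ} (hU : T * (1 - a.β₂) * Binf ^ 2 ≤ U) {t : ℕ} (ht : t < T) {v : Vec d}
    (hv : ∀ k, |v k| ≤ Binf) :
    |inner ℝ v (s.pert a t ω)| ≤ d * (Binf ^ 2 * (U / (U + a.δ)) / √a.δ) := by
  have h0 : inner ℝ v (s.pert a t ω) = ∑ k, v k * s.pert a t ω k := by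
    rw [PiLp.inner_apply]
    refine Finset.sum_congr rfl fun k _ => ?_
    simp [mul_comm]
  rw [h0]
  calc |∑ k, v k * s.pert a t ω k| ≤ ∑ k, |v k * s.pert a t ω k| :=
        Finset.abs_sum_le_sum_abs _ _
    _ ≤ ∑ _k : Fin d, Binf * (Binf * ((√a.δ)⁻¹ * (U / (U + a.δ)))) := by
        refine Finset.sum_le_sum fun k _ => ?_
        rw [abs_mul]
        exact mul_le_mul (hv k) (h.abs_pert_le hB hβ hβ₂ hδ hU ht k) (abs_nonneg _) hB
    _ = d * (Binf ^ 2 * (U / (U + a.δ)) / √a.δ) := by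
        simp only [Finset.sum_const, Finset.card_univ, Fintype.card_fin, nsmul_eq_mul]
        ring

end Bounds

/-! ### The momentum-free virtual sequence -/

section Virtual

variable (s a) in
/-- The averaged stochastic gradient. -/
noncomputable def gbar (t : ℕ) (ω : s.Ω) : Vec d := mean fun i => s.g a i t ω

variable (s a) in
/-- The virtual averaged iterate, from which the momentum is removed. -/
noncomputable def virt (t : ℕ) (ω : s.Ω) : Vec d :=
  mean (s.iter a t ω).x
    - (a.α / √a.δ * (a.β₁ / (1 - a.β₁))) • mean (s.iter a t ω).m

theorem virt_zero (ω : s.Ω) : s.virt a 0 ω = 0 := by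
  simp [virt, iter, State.init, mean]

/-- With `c = β₁/(1 - β₁)`, the old momentum has coefficient proportional to `c - β₁ - c β₁ = 0`,
and the fresh gradient gets `(1 - β₁)(1 + c) = 1`. These two equations determine `c`. -/
theorem Mixing.virt_succ_sub (hW : s.Mixing) (hβ : a.β₁ ∈ Set.Ioo (0 : ℝ) 1) (t : ℕ) (ω : s.Ω) :
    s.virt a (t + 1) ω - s.virt a t ω
      = -((a.α / √a.δ) • s.gbar a t ω) - a.α • s.pert a t ω := by
  have h3 : 1 - a.β₁ ≠ 0 := by linarith [hβ.2]
  have hm : mean (s.iter a (t + 1) ω).m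
      = a.β₁ • mean (s.iter a t ω).m + (1 - a.β₁) • s.gbar a t ω := by
    rw [gbar, ← mean_smul, ← mean_smul, ← mean_add]; rfl
  have hd : mean (s.dir a t ω) = s.pert a t ω + (√a.δ)⁻¹ • mean (s.iter a (t + 1) ω).m := by
    rw [pert]; abel
  rw [virt, virt, hW.mean_iter_succ, hd, hm]
  generalize mean (s.iter a t ω).m = m
  generalize s.gbar a t ω = g
  generalize mean (s.iter a t ω).x = x
  generalize s.pert a t ω = p
  have h4 : a.β₁ / (1 - a.β₁) * (1 - a.β₁) = a.β₁ := div_mul_cancel₀ _ h3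
  have h5 : a.β₁ / (1 - a.β₁) * a.β₁ = a.β₁ / (1 - a.β₁) - a.β₁ := by
    field_simp; ring
  generalize a.β₁ / (1 - a.β₁) = c at *
  have e1 : a.α / √a.δ = a.α * (√a.δ)⁻¹ := div_eq_mul_inv _ _
  rw [e1]
  generalize (√a.δ)⁻¹ = r
  have : x - a.α • (p + r • (a.β₁ • m + (1 - a.β₁) • g))
        - (a.α * r * c) • (a.β₁ • m + (1 - a.β₁) • g) - (x - (a.α * r * c) • m)
      = -(a.α * r * ((1 - a.β₁) + c * (1 - a.β₁))) • g - a.α • p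
        + (a.α * r * (c - a.β₁ - c * a.β₁)) • m := by module
  rw [this, h4, h5, show c - a.β₁ - (c - a.β₁) = 0 by ring,
    show 1 - a.β₁ + a.β₁ = 1 by ring]
  module

end Virtual

/-! ### One step of the disagreement and of the compressed vector -/

section Consensus

theorem Mixing.fro_mix_sub_le (hW : s.Mixing) (x : Fin n → Vec d) :
    fro (fun i => (∑ j, s.W j i • x j) - x i) ≤ 4 * fro x := by
  have h1 := fro_stochastic_le s.W hW.nonneg hW.row_sum hW.col_sum x
  have h2 := fro_sub_le_two (fun i => ∑ j, s.W j i • x j) x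
  linarith

/-- Triangle inequality with weights `1 + γ` and `γ`, then Cauchy-Schwarz and double stochasticity.
A factor `1 + O(γ)` is essential: it must not destroy the contraction `η²` of the compressor. -/
theorem Mixing.fro_sub_smul_mix_le (hW : s.Mixing) {γ : ℝ} (hγ : 0 ≤ γ) (x : Fin n → Vec d) :
    fro (fun i => x i - γ • ((∑ j, s.W j i • x j) - x i)) ≤ (1 + 2 * γ) ^ 2 * fro x := by
  have h1 := fro_stochastic_le s.W hW.nonneg hW.row_sum hW.col_sum x
  have h2 : ∀ i, ‖x i - γ • ((∑ j, s.W j i • x j) - x i)‖ ^ 2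
      ≤ (1 + 2 * γ) * ((1 + γ) * ‖x i‖ ^ 2 + γ * ‖∑ j, s.W j i • x j‖ ^ 2) := by
    intro i
    have h3 : x i - γ • ((∑ j, s.W j i • x j) - x i)
        = (1 + γ) • x i - γ • ∑ j, s.W j i • x j := by module
    have h4 : ‖x i - γ • ((∑ j, s.W j i • x j) - x i)‖
        ≤ (1 + γ) * ‖x i‖ + γ * ‖∑ j, s.W j i • x j‖ := by
      rw [h3]
      refine (norm_sub_le _ _).trans ?_
      rw [norm_smul, norm_smul, Real.norm_of_nonneg hγ, Real.norm_of_nonneg (by linarith)]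
    refine (pow_le_pow_left₀ (norm_nonneg _) h4 2).trans ?_
    nlinarith [mul_nonneg (mul_nonneg hγ (by linarith : 0 ≤ 1 + γ))
      (sq_nonneg (‖x i‖ - ‖∑ j, s.W j i • x j‖))]
  calc fro (fun i => x i - γ • ((∑ j, s.W j i • x j) - x i))
      ≤ ∑ i, (1 + 2 * γ) * ((1 + γ) * ‖x i‖ ^ 2 + γ * ‖∑ j, s.W j i • x j‖ ^ 2) :=
        Finset.sum_le_sum fun i _ => h2 i
    _ = (1 + 2 * γ) * ((1 + γ) * fro x + γ * fro (fun i => ∑ j, s.W j i • x j)) := by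
        rw [← Finset.mul_sum, Finset.sum_add_distrib, ← Finset.mul_sum, ← Finset.mul_sum]; rfl
    _ ≤ (1 + 2 * γ) * ((1 + γ) * fro x + γ * fro x) := by gcongr
    _ = (1 + 2 * γ) ^ 2 * fro x := by ring

theorem Mixing.n_pos (hW : s.Mixing) : 0 < n :=
  Fin.pos_iff_nonempty.2 hW.connected.nonempty

variable (s a) in
/-- The deviation of the half steps from their average. -/
noncomputable def halfDev (t : ℕ) (ω : s.Ω) (i : Fin n) : Vec d :=
  s.half a t ω i - mean (s.half a t ω)

theorem fro_halfDev_le (t : ℕ) (ω : s.Ω) {τ : ℝ} (h0 : 0 < τ) (h1 : τ < 1) :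
    fro (s.halfDev a t ω)
      ≤ fro (s.dev a t ω) / (1 - τ) + a.α ^ 2 * fro (s.dir a t ω) / τ := by
  have h2 : s.halfDev a t ω = fun i => s.dev a t ω i
      + (-a.α) • (s.dir a t ω i - mean (s.dir a t ω)) := by
    funext i
    have : mean (s.half a t ω) = mean (s.iter a t ω).x - a.α • mean (s.dir a t ω) := by
      unfold half
      rw [mean_sub, mean_smul]
    rw [halfDev, this, half, dev]
    module
  rw [h2]
  refine (fro_add_le _ _ h0 h1).trans ?_
  rw [fro_smul, neg_sq]
  gcongr
  exact fro_sub_mean_le _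

/-- The deviations of the half steps sum to zero, so `J` may be subtracted from the mixing matrix at
no cost, which makes it a contraction. The compression errors enter only through `γ (W - I)`. -/
theorem Mixing.dev_succ (hW : s.Mixing) (t : ℕ) (ω : s.Ω) (i : Fin n) :
    s.dev a (t + 1) ω i
      = (∑ j, (a.γ • s.W + (1 - a.γ) • (1 : Matrix (Fin n) (Fin n) ℝ) - avgMatrix n) j i
          • s.halfDev a t ω j)
        + (-a.γ) • ((∑ j, s.W j i • s.cerr a t ω j) - s.cerr a t ω i) := by
  have hmean : mean (s.iter a (t + 1) ω).x = mean (s.half a t ω) := by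
    rw [hW.mean_iter_succ]
    unfold half
    rw [mean_sub, mean_smul]
  have h1 : ∑ j, (a.γ • s.W + (1 - a.γ) • (1 : Matrix (Fin n) (Fin n) ℝ) - avgMatrix n) j i
          • s.halfDev a t ω j
      = a.γ • (∑ j, s.W j i • s.halfDev a t ω j) + (1 - a.γ) • s.halfDev a t ω i := by
    simp only [Matrix.sub_apply, Matrix.add_apply, Matrix.smul_apply, sub_smul, add_smul,
      Finset.sum_sub_distrib, Finset.sum_add_distrib, avgMatrix, Matrix.of_apply, smul_eq_mul]
    rw [← Finset.smul_sum (r := (n : ℝ)⁻¹)]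
    have : ∑ j, s.halfDev a t ω j = 0 := sum_sub_mean hW.n_pos _
    rw [this, smul_zero, sub_zero]
    congr 1
    · rw [Finset.smul_sum]
      simp_rw [mul_smul]
    · simp [Matrix.one_apply]
  have h2 : ∑ j, s.W j i • s.halfDev a t ω j
      = (∑ j, s.W j i • s.half a t ω j) - mean (s.half a t ω) := by
    unfold halfDev
    simp_rw [smul_sub]
    rw [Finset.sum_sub_distrib, ← Finset.sum_smul, hW.col_sum, one_smul]
  have h3 : ∑ j, s.W j i • (s.iter a (t + 1) ω).xu j
      = (∑ j, s.W j i • s.half a t ω j) - ∑ j, s.W j i • s.cerr a t ω j := by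
    simp_rw [iter_succ_xu_eq, smul_sub]
    rw [Finset.sum_sub_distrib]
  rw [h1, h2, dev, hmean, iter_succ_x, h3, iter_succ_xu_eq, halfDev]
  module

theorem Mixing.fro_dev_succ_le (hW : s.Mixing) (t : ℕ) (ω : s.Ω) {τ : ℝ} (h0 : 0 < τ)
    (h1 : τ < 1) :
    fro (s.dev a (t + 1) ω) ≤ s.rhoHat a.γ ^ 2 * fro (s.halfDev a t ω) / (1 - τ)
      + a.γ ^ 2 * (4 * fro (s.cerr a t ω)) / τ := by
  rw [show s.dev a (t + 1) ω = fun i => _ from funext fun i => hW.dev_succ t ω i]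
  refine (fro_add_le _ _ h0 h1).trans ?_
  rw [fro_smul, neg_sq]
  have : 0 < 1 - τ := by linarith
  gcongr
  · exact fro_mix_le _ _
  · exact hW.fro_mix_sub_le _

/-- The new gap is the old compression error, slightly distorted by mixing, plus two small moves:
the gossip move and the next local step. Since `W - I` kills constants, the gossip move sees only
deviations. -/
theorem Mixing.gap_succ (hW : s.Mixing) (t : ℕ) (ω : s.Ω) (i : Fin n) :
    s.gap a (t + 1) ω i
      = (s.cerr a t ω i - a.γ • ((∑ j, s.W j i • s.cerr a t ω j) - s.cerr a t ω i))
        + (a.γ • ((∑ j, s.W j i • s.halfDev a t ω j) - s.halfDev a t ω i)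
          + (-a.α) • s.dir a (t + 1) ω i) := by
  have h2 : ∑ j, s.W j i • s.halfDev a t ω j
      = (∑ j, s.W j i • s.half a t ω j) - mean (s.half a t ω) := by
    unfold halfDev
    simp_rw [smul_sub]
    rw [Finset.sum_sub_distrib, ← Finset.sum_smul, hW.col_sum, one_smul]
  have h3 : ∑ j, s.W j i • (s.iter a (t + 1) ω).xu j
      = (∑ j, s.W j i • s.half a t ω j) - ∑ j, s.W j i • s.cerr a t ω j := by
    simp_rw [iter_succ_xu_eq, smul_sub]
    rw [Finset.sum_sub_distrib]
  rw [gap, half, iter_succ_x, h3, iter_succ_xu_eq, h2, halfDev]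
  module

theorem Mixing.fro_gap_succ_le (hW : s.Mixing) (hγ : 0 ≤ a.γ) (t : ℕ) (ω : s.Ω) {τ : ℝ}
    (h0 : 0 < τ) (h1 : τ < 1) :
    fro (s.gap a (t + 1) ω) ≤ (1 + 2 * a.γ) ^ 2 * fro (s.cerr a t ω) / (1 - τ)
      + (2 * (a.γ ^ 2 * (4 * fro (s.halfDev a t ω)))
        + 2 * (a.α ^ 2 * fro (s.dir a (t + 1) ω))) / τ := by
  rw [show s.gap a (t + 1) ω = fun i => _ from funext fun i => hW.gap_succ t ω i]
  refine (fro_add_le _ _ h0 h1).trans ?_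
  have : 0 < 1 - τ := by linarith
  gcongr
  · exact hW.fro_sub_smul_mix_le hγ _
  · refine (fro_add_le_two _ _).trans ?_
    rw [fro_smul, fro_smul, neg_sq]
    gcongr
    exact hW.fro_mix_sub_le _

theorem fro_gap_zero (ω : s.Ω) : fro (s.gap a 0 ω) = a.α ^ 2 * fro (s.dir a 0 ω) := by
  have : s.gap a 0 ω = fun i => (-a.α) • s.dir a 0 ω i := by
    funext i
    simp [gap, half, iter, State.init]
  rw [this, fro_smul, neg_sq]

theorem dev_zero (ω : s.Ω) : fro (s.dev a 0 ω) = 0 := by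
  simp [fro, dev, iter, State.init, mean]

/-- The matrix is the convex combination of `W - J` and `I - J`, of norms less than one and at most
one; `γ > 0` makes the inequality strict. -/
theorem Mixing.rhoHat_lt_one (hW : s.Mixing) {γ : ℝ} (h0 : 0 < γ) (h1 : γ ≤ 1) :
    s.rhoHat γ < 1 := by
  have hJ : specNorm ((1 : Matrix (Fin n) (Fin n) ℝ) - avgMatrix n) ≤ 1 := by
    refine ContinuousLinearMap.opNorm_le_bound _ zero_le_one fun v => ?_
    rw [one_mul, ← sq_le_sq₀ (norm_nonneg _) (norm_nonneg _), EuclideanSpace.norm_sq_eq,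
      EuclideanSpace.norm_sq_eq]
    -- Applying `I - J` to a vector is subtracting the mean from a family of agents in dimension
    -- one.
    have h := fro_sub_mean_le (d := 1) fun i => WithLp.toLp 2 fun _ => v i
    unfold fro at h
    simp_rw [EuclideanSpace.norm_sq_eq] at h
    simp only [Finset.univ_unique, Finset.sum_singleton] at h
    refine le_trans (le_of_eq (Finset.sum_congr rfl fun i _ => ?_)) h
    congr 2
    simp [mean, Matrix.ofLp_toEuclideanCLM, avgMatrix, Matrix.mulVec, dotProduct,
      Finset.mul_sum]
  have hsplit : γ • s.W + (1 - γ) • (1 : Matrix (Fin n) (Fin n) ℝ) - avgMatrix n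
      = γ • (s.W - avgMatrix n) + (1 - γ) • (1 - avgMatrix n) := by
    module
  have h2 : s.rhoHat γ ≤ γ * specNorm (s.W - avgMatrix n)
      + (1 - γ) * specNorm ((1 : Matrix (Fin n) (Fin n) ℝ) - avgMatrix n) := by
    unfold rhoHat
    rw [hsplit]
    unfold specNorm
    rw [map_add, map_smul, map_smul]
    refine (norm_add_le _ _).trans ?_
    rw [norm_smul, norm_smul, Real.norm_of_nonneg h0.le, Real.norm_of_nonneg (by linarith)]
  have h3 := hW.rho_lt_one
  nlinarith

end Consensus

end Setting
end DAMSCo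

/-! ### Measurability and independence -/

namespace DAMSCo

theorem measurable_vec {Ω : Type*} [MeasurableSpace Ω] {d : ℕ} {f : Ω → Vec d}
    (h : ∀ k, Measurable fun ω => f ω k) : Measurable f :=
  (WithLp.measurable_toLp 2 (Fin d → ℝ)).comp (measurable_pi_iff.2 h)

theorem measurable_coord {Ω : Type*} [MeasurableSpace Ω] {d : ℕ} {f : Ω → Vec d}
    (h : Measurable f) (k : Fin d) : Measurable fun ω => f ω k :=
  (measurable_pi_apply k).comp ((WithLp.measurable_ofLp 2 (Fin d → ℝ)).comp h)

/-- All the components of a random state are measurable. -/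
structure MeasurableState {Ω : Type*} (_ : MeasurableSpace Ω) {n d : ℕ} (st : Ω → State n d) :
    Prop where
  x : ∀ i, Measurable fun ω => (st ω).x i
  xu : ∀ i, Measurable fun ω => (st ω).xu i
  m : ∀ i, Measurable fun ω => (st ω).m i
  uhat : ∀ i, Measurable fun ω => (st ω).uhat i
  u : ∀ i, Measurable fun ω => (st ω).u i

theorem MeasurableState.mono {Ω : Type*} {m₁ m₂ : MeasurableSpace Ω} {n d : ℕ}
    {st : Ω → State n d} (h : MeasurableState m₁ st) (hle : m₁ ≤ m₂) :
    MeasurableState m₂ st :=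
  ⟨fun i => (h.x i).mono hle le_rfl, fun i => (h.xu i).mono hle le_rfl,
    fun i => (h.m i).mono hle le_rfl, fun i => (h.uhat i).mono hle le_rfl,
    fun i => (h.u i).mono hle le_rfl⟩

theorem measurable_mean {Ω : Type*} [MeasurableSpace Ω] {n d : ℕ} {x : Ω → Fin n → Vec d}
    (h : ∀ i, Measurable fun ω => x ω i) : Measurable fun ω => mean (x ω) := by
  unfold mean
  exact (Finset.measurable_sum _ fun i _ => h i).const_smul (n : ℝ)⁻¹

namespace Setting

variable {n d : ℕ} {s : Setting.{u} n d} {a : Params} {L : ℝ}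

/-- Each partial derivative is the pointwise limit of the difference quotients with step `1/j`,
which are jointly measurable. Joint measurability is needed to freeze the iterate by Fubini. -/
theorem Smooth.measurable_sgrad (h : s.Smooth L) (i : Fin n) :
    Measurable fun p : Vec d × s.Ξ i => s.sgrad i p.1 p.2 := by
  refine measurable_vec fun k => ?_
  refine measurable_of_tendsto_metrizable
    (f := fun (j : ℕ) (p : Vec d × s.Ξ i) =>
      (j : ℝ) • (s.F i (p.1 + (j : ℝ)⁻¹ • EuclideanSpace.single k (1 : ℝ)) p.2 - s.F i p.1 p.2))
    (fun j => ?_) ?_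
  · refine Measurable.const_smul (Measurable.sub ?_ (h.meas i)) (j : ℝ)
    exact (h.meas i).comp ((measurable_fst.add_const _).prodMk measurable_snd)
  · rw [tendsto_pi_nhds]
    intro p
    have h1 := ((h.differentiable i p.2).differentiableAt (x := p.1)).hasFDerivAt.lim_real
      (EuclideanSpace.single k (1 : ℝ))
    have h2 : s.sgrad i p.1 p.2 k
        = fderiv ℝ (fun x => s.F i x p.2) p.1 (EuclideanSpace.single k (1 : ℝ)) := by
      rw [← inner_gradient_left, EuclideanSpace.inner_single_right]
      simp [sgrad]
    rw [h2]
    exact h1.comp tendsto_natCast_atTop_atTop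

theorem Smooth.measurable_sgrad_comp (h : s.Smooth L) {i : Fin n} {Ω : Type*}
    {mΩ : MeasurableSpace Ω} {x : Ω → Vec d} {z : Ω → s.Ξ i} (hx : Measurable x)
    (hz : Measurable z) : Measurable fun ω => s.sgrad i (x ω) (z ω) :=
  (h.measurable_sgrad i).comp (hx.prodMk hz)

theorem measurableState_step (hs : s.Smooth L) (hQ : Measurable fun p : s.S × Vec d => s.Q p.1 p.2)
    {Ω : Type*} {mΩ : MeasurableSpace Ω} {st : Ω → State n d} (hst : MeasurableState mΩ st)
    {z : Ω → ∀ i, s.Ξ i} (hz : ∀ i, Measurable fun ω => z ω i)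
    {c : Ω → Fin n → s.S} (hc : ∀ i, Measurable fun ω => c ω i) :
    MeasurableState mΩ fun ω => s.step a (z ω) (c ω) (st ω) := by
  have hg : ∀ i, Measurable fun ω => s.sgrad i ((st ω).x i) (z ω i) := fun i =>
    (hs.measurable_sgrad i).comp ((hst.x i).prodMk (hz i))
  have hm : ∀ i, Measurable fun ω => (s.step a (z ω) (c ω) (st ω)).m i := fun i =>
    ((hst.m i).const_smul a.β₁).add ((hg i).const_smul (1 - a.β₁))
  have hh : ∀ i, Measurable fun ω => (s.step a (z ω) (c ω) (st ω)).uhat i := fun i =>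
    measurable_vec fun k => ((measurable_coord (hst.uhat i) k).const_mul a.β₂).add
      (((measurable_coord (hg i) k).mul (measurable_coord (hg i) k)).const_mul (1 - a.β₂))
  have hu : ∀ i, Measurable fun ω => (s.step a (z ω) (c ω) (st ω)).u i := fun i =>
    measurable_vec fun k => (measurable_coord (hst.u i) k).max (measurable_coord (hh i) k)
  have hx : ∀ i, Measurable fun ω => (WithLp.toLp 2 fun k => (st ω).x i k
      - a.α * ((s.step a (z ω) (c ω) (st ω)).m i k
        / √((s.step a (z ω) (c ω) (st ω)).u i k + a.δ)) : Vec d) := fun i =>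
    measurable_vec fun k => (measurable_coord (hst.x i) k).sub
      (((measurable_coord (hm i) k).div
        ((measurable_coord (hu i) k).add_const a.δ).sqrt).const_mul a.α)
  have hxu : ∀ i, Measurable fun ω => (s.step a (z ω) (c ω) (st ω)).xu i := fun i =>
    (hst.xu i).add (hQ.comp ((hc i).prodMk ((hx i).sub (hst.xu i))))
  exact ⟨fun i => (hx i).add (((Finset.measurable_sum _ fun j _ =>
    (hxu j).const_smul (s.W j i)).sub (hxu i)).const_smul a.γ), hxu, hm, hh, hu⟩

variable (s) in
/-- The σ-algebra generated by one sample, or by all the seeds of one iteration. -/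
abbrev source : (Fin n × ℕ) ⊕ ℕ → MeasurableSpace s.Ω :=
  Sum.elim
    (fun p : Fin n × ℕ => MeasurableSpace.comap (s.ξ p.1 p.2) inferInstance)
    (fun t : ℕ => MeasurableSpace.comap (fun ω (i : Fin n) => s.ζ i t ω) inferInstance)

variable (s) in
/-- The σ-algebra generated by a set of sources of randomness. -/
@[reducible]
def sources (I : Set ((Fin n × ℕ) ⊕ ℕ)) : MeasurableSpace s.Ω := ⨆ k ∈ I, s.source k

theorem sources_mono {I J : Set ((Fin n × ℕ) ⊕ ℕ)} (h : I ⊆ J) : s.sources I ≤ s.sources J :=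
  biSup_mono h

theorem Sampling.source_le (h : s.Sampling) (k : (Fin n × ℕ) ⊕ ℕ) : s.source k ≤ s.mΩ := by
  rcases k with p | t
  · exact (h.sample_meas p.1 p.2).comap_le
  · exact (measurable_pi_iff.2 fun i => h.seed_meas i t).comap_le

theorem Sampling.sources_le (h : s.Sampling) (I : Set ((Fin n × ℕ) ⊕ ℕ)) :
    s.sources I ≤ s.mΩ := iSup₂_le fun k _ => h.source_le k

theorem measurable_sample {I : Set ((Fin n × ℕ) ⊕ ℕ)} {i : Fin n} {t : ℕ}
    (h : Sum.inl (i, t) ∈ I) : Measurable[s.sources I] (s.ξ i t) :=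
  Measurable.mono (comap_measurable (s.ξ i t)) (le_biSup s.source h) le_rfl

theorem measurable_seed {I : Set ((Fin n × ℕ) ⊕ ℕ)} (i : Fin n) {t : ℕ}
    (h : Sum.inr t ∈ I) : Measurable[s.sources I] (s.ζ i t) := by
  have h1 : Measurable[s.sources I] (fun ω (i : Fin n) => s.ζ i t ω) :=
    Measurable.mono (comap_measurable (fun ω (i : Fin n) => s.ζ i t ω))
      (le_biSup s.source h) le_rfl
  exact (measurable_pi_apply i).comp h1

/-- The sources of randomness of the iterations before `t`. -/
def past (n t : ℕ) : Set ((Fin n × ℕ) ⊕ ℕ) := {k | Sum.elim Prod.snd id k < t}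

theorem past_mono {t t' : ℕ} (h : t ≤ t') : past n t ⊆ past n t' := fun _ hk =>
  lt_of_lt_of_le hk h

theorem measurableState_iter (hs : s.Smooth L)
    (hQ : Measurable fun p : s.S × Vec d => s.Q p.1 p.2) (t : ℕ) :
    MeasurableState (s.sources (past n t)) (s.iter a t) := by
  induction t with
  | zero =>
    exact ⟨fun i => @measurable_const _ _ _ (s.sources (past n 0)) _,
      fun i => @measurable_const _ _ _ (s.sources (past n 0)) _,
      fun i => @measurable_const _ _ _ (s.sources (past n 0)) _,
      fun i => @measurable_const _ _ _ (s.sources (past n 0)) _,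
      fun i => @measurable_const _ _ _ (s.sources (past n 0)) _⟩
  | succ t ih =>
    have hle : s.sources (past n t) ≤ s.sources (past n (t + 1)) :=
      sources_mono (past_mono (Nat.le_succ t))
    exact @measurableState_step n d s a L hs hQ s.Ω (s.sources (past n (t + 1))) _ (ih.mono hle)
      _
      (fun i => measurable_sample (show t < t + 1 from Nat.lt_succ_self t))
      _ (fun i => measurable_seed i (show t < t + 1 from Nat.lt_succ_self t))

theorem measurable_g (hs : s.Smooth L) (hQ : Measurable fun p : s.S × Vec d => s.Q p.1 p.2)
    {I : Set ((Fin n × ℕ) ⊕ ℕ)} {i : Fin n} {t : ℕ} (hI : past n t ⊆ I)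
    (h : Sum.inl (i, t) ∈ I) : Measurable[s.sources I] (s.g a i t) := by
  have h1 : Measurable[s.sources I] fun ω => (s.iter a t ω).x i :=
    ((measurableState_iter hs hQ t).x i).mono (sources_mono hI) le_rfl
  exact hs.measurable_sgrad_comp h1 (measurable_sample h)

/-- The gap `x_i^{t+1/2} - x̲_i^t` does not depend on the seeds of iteration `t`. -/
theorem measurable_gap (hs : s.Smooth L) (hQ : Measurable fun p : s.S × Vec d => s.Q p.1 p.2)
    (t : ℕ) (i : Fin n) : Measurable[s.sources {Sum.inr t}ᶜ] fun ω => s.gap a t ω i := by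
  have hI : past n t ⊆ ({Sum.inr t}ᶜ : Set ((Fin n × ℕ) ⊕ ℕ)) := by
    rintro k hk rfl
    exact lt_irrefl t hk
  have ⟨hx, hxu, hm0, hh0, hu0⟩ :=
    (measurableState_iter (a := a) hs hQ t).mono (sources_mono (s := s) hI)
  replace hx := hx i
  replace hxu := hxu i
  replace hm0 := hm0 i
  replace hh0 := hh0 i
  replace hu0 := hu0 i
  have hg : Measurable[s.sources {Sum.inr t}ᶜ] (s.g a i t) := measurable_g hs hQ hI (by simp)
  let _ : MeasurableSpace s.Ω := s.sources {Sum.inr t}ᶜ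
  -- Adaptedness of the whole next state would include the seeds of iteration `t`. The moments are
  -- therefore rebuilt from the old state and the fresh sample alone.
  have hm : Measurable fun ω => (s.iter a (t + 1) ω).m i :=
    (hm0.const_smul a.β₁).add (hg.const_smul (1 - a.β₁))
  have hh : Measurable fun ω => (s.iter a (t + 1) ω).uhat i :=
    measurable_vec fun k => ((measurable_coord hh0 k).const_mul a.β₂).add
      (((measurable_coord hg k).mul (measurable_coord hg k)).const_mul (1 - a.β₂))
  have hu : Measurable fun ω => (s.iter a (t + 1) ω).u i :=
    measurable_vec fun k => (measurable_coord hu0 k).max (measurable_coord hh k)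
  have hd : Measurable fun ω => s.dir a t ω i :=
    measurable_vec fun k => (measurable_coord hm k).div
      ((measurable_coord hu k).add_const a.δ).sqrt
  exact (hx.sub (hd.const_smul a.α)).sub hxu

/-- Freezing an independent sample. -/
theorem Sampling.map_sample (h : s.Sampling) (i : Fin n) (t : ℕ) {β : Type*}
    [MeasurableSpace β] {Y : s.Ω → β} (hY : Measurable[s.sources {Sum.inl (i, t)}ᶜ] Y) :
    s.P.map (fun ω => (Y ω, s.ξ i t ω)) = (s.P.map Y).prod (s.D i) := by
  have := h.prob
  have hYm : Measurable Y := hY.mono (h.sources_le _) le_rfl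
  rw [← h.sample_law i t]
  refine (indepFun_iff_map_prod_eq_prod_map_map hYm.aemeasurable
    (h.sample_meas i t).aemeasurable).1 ?_
  rw [IndepFun_iff_Indep]
  have hi := indep_iSup_of_disjoint h.source_le h.indep
    (disjoint_compl_left : Disjoint ({Sum.inl (i, t)}ᶜ : Set ((Fin n × ℕ) ⊕ ℕ)) {Sum.inl (i, t)})
  refine indep_of_indep_of_le_left (indep_of_indep_of_le_right hi ?_) hY.comap_le
  exact le_biSup s.source (Set.mem_singleton (Sum.inl (i, t)))

/-- All seeds of one iteration form a single source, so `Y` must avoid them together; the agents may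
then share a seed. -/
theorem Sampling.map_seed (h : s.Sampling) (i : Fin n) (t : ℕ) {β : Type*}
    [MeasurableSpace β] {Y : s.Ω → β} (hY : Measurable[s.sources {Sum.inr t}ᶜ] Y) :
    s.P.map (fun ω => (Y ω, s.ζ i t ω)) = (s.P.map Y).prod s.ν := by
  have := h.prob
  have hYm : Measurable Y := hY.mono (h.sources_le _) le_rfl
  rw [← h.seed_law i t]
  refine (indepFun_iff_map_prod_eq_prod_map_map hYm.aemeasurable
    (h.seed_meas i t).aemeasurable).1 ?_
  rw [IndepFun_iff_Indep]
  have hi := indep_iSup_of_disjoint h.source_le h.indep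
    (disjoint_compl_left : Disjoint ({Sum.inr t}ᶜ : Set ((Fin n × ℕ) ⊕ ℕ)) {Sum.inr t})
  refine indep_of_indep_of_le_left (indep_of_indep_of_le_right hi ?_) hY.comap_le
  exact (measurable_seed i (Set.mem_singleton _)).comap_le

end Setting
end DAMSCo

namespace DAMSCo
namespace Setting

variable {n d : ℕ} {s : Setting.{u} n d} {a : Params} {L : ℝ}

theorem measurable_fro {Ω : Type*} [MeasurableSpace Ω] {n d : ℕ} {x : Ω → Fin n → Vec d}
    (h : ∀ i, Measurable fun ω => x ω i) : Measurable fun ω => fro (x ω) := by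
  unfold fro
  exact Finset.measurable_sum _ fun i _ => (h i).norm.pow_const 2

/-! ### The compression error in expectation -/

section CompressionError

variable {η : ℝ}

/-- The compressed vector is independent of the seed. Fubini reduces the claim to the defining bound
of the compressor at a frozen vector, which also supplies integrability on the product. -/
theorem Compression.integral_sq_le (hs : s.Smooth L) (hc : s.Compression η) (hS : s.Sampling)
    (t : ℕ) (i : Fin n) (hi : Integrable (fun ω => ‖s.gap a t ω i‖ ^ 2) s.P) :
    Integrable (fun ω => ‖s.cerr a t ω i‖ ^ 2) s.P ∧
      ∫ ω, ‖s.cerr a t ω i‖ ^ 2 ∂s.P ≤ η ^ 2 * ∫ ω, ‖s.gap a t ω i‖ ^ 2 ∂s.P := by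
  have := hS.prob
  have := hc.prob
  have hY := measurable_gap (a := a) hs hc.meas t i
  have hYm : Measurable fun ω => s.gap a t ω i := hY.mono (hS.sources_le _) le_rfl
  have hmap := hS.map_seed i t hY
  have hpair : Measurable fun ω => (s.gap a t ω i, s.ζ i t ω) := hYm.prodMk (hS.seed_meas i t)
  set φ : Vec d × s.S → ℝ := fun p => ‖p.1 - s.Q p.2 p.1‖ ^ 2 with hφ
  have hφm : Measurable φ :=
    (measurable_fst.sub (hc.meas.comp (measurable_snd.prodMk measurable_fst))).norm.pow_const 2
  have hsq : Integrable (fun v : Vec d => η ^ 2 * ‖v‖ ^ 2) (s.P.map fun ω => s.gap a t ω i) := by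
    rw [integrable_map_measure (by fun_prop) hYm.aemeasurable]
    exact hi.const_mul _
  have hnorm : ∀ v, ∫ c, ‖φ (v, c)‖ ∂s.ν ≤ η ^ 2 * ‖v‖ ^ 2 := fun v => by
    have : (fun c => ‖φ (v, c)‖) = fun c => ‖v - s.Q c v‖ ^ 2 := by
      funext c
      exact Real.norm_of_nonneg (by positivity)
    rw [this]
    exact hc.bound v
  have hint : Integrable φ ((s.P.map fun ω => s.gap a t ω i).prod s.ν) := by
    rw [integrable_prod_iff hφm.aestronglyMeasurable]
    refine ⟨Filter.Eventually.of_forall fun v => hc.integrable v, ?_⟩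
    refine hsq.mono' ?_ (Filter.Eventually.of_forall fun v => ?_)
    · exact (hφm.norm.stronglyMeasurable.integral_prod_right').aestronglyMeasurable
    · rw [Real.norm_of_nonneg (integral_nonneg fun _ => norm_nonneg _)]
      exact hnorm v
  have hint' : Integrable (fun ω => ‖s.cerr a t ω i‖ ^ 2) s.P := by
    rw [← hmap] at hint
    exact (integrable_map_measure hφm.aestronglyMeasurable hpair.aemeasurable).1 hint
  refine ⟨hint', ?_⟩
  calc ∫ ω, ‖s.cerr a t ω i‖ ^ 2 ∂s.P = ∫ p, φ p ∂(s.P.map fun ω => (s.gap a t ω i, s.ζ i t ω)) :=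
        (integral_map hpair.aemeasurable hφm.aestronglyMeasurable).symm
    _ = ∫ v, ∫ c, φ (v, c) ∂s.ν ∂(s.P.map fun ω => s.gap a t ω i) := by
        rw [hmap, integral_prod _ hint]
    _ ≤ ∫ v, η ^ 2 * ‖v‖ ^ 2 ∂(s.P.map fun ω => s.gap a t ω i) :=
        integral_mono hint.integral_prod_left hsq fun v => hc.bound v
    _ = η ^ 2 * ∫ ω, ‖s.gap a t ω i‖ ^ 2 ∂s.P := by
        rw [integral_const_mul, integral_map hYm.aemeasurable (by fun_prop)]

theorem Compression.integral_fro_le (hs : s.Smooth L) (hc : s.Compression η) (hS : s.Sampling)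
    (t : ℕ) (hi : Integrable (fun ω => fro (s.gap a t ω)) s.P) :
    Integrable (fun ω => fro (s.cerr a t ω)) s.P ∧
      ∫ ω, fro (s.cerr a t ω) ∂s.P ≤ η ^ 2 * ∫ ω, fro (s.gap a t ω) ∂s.P := by
  have h1 : ∀ i, Integrable (fun ω => ‖s.gap a t ω i‖ ^ 2) s.P := fun i => by
    have hm := (measurable_gap (a := a) hs hc.meas t i).mono (hS.sources_le _) le_rfl
    refine hi.mono' (hm.norm.pow_const 2).aestronglyMeasurable
      (Filter.Eventually.of_forall fun ω => ?_)
    rw [Real.norm_of_nonneg (by positivity)]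
    exact Finset.single_le_sum (f := fun i => ‖s.gap a t ω i‖ ^ 2)
      (fun _ _ => by positivity) (Finset.mem_univ i)
  have h2 := fun i => hc.integral_sq_le hs hS t i (h1 i)
  unfold fro
  refine ⟨integrable_finsetSum _ fun i _ => (h2 i).1, ?_⟩
  rw [integral_finsetSum _ fun i _ => (h2 i).1, integral_finsetSum _ fun i _ => h1 i,
    Finset.mul_sum]
  exact Finset.sum_le_sum fun i _ => (h2 i).2

end CompressionError

/-! ### Orthogonality and variance of the gradient noise -/

section Noise

variable {T : ℕ} {B Binf : ℝ}

theorem Smooth.measurable_gradient_locObj (h : s.Smooth L) (i : Fin n) :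
    Measurable (gradient (s.locObj i)) := by
  have : LipschitzWith (Real.toNNReal L) (gradient (s.locObj i)) := by
    refine LipschitzWith.of_dist_le_mul fun x y => ?_
    rw [dist_eq_norm, dist_eq_norm, Real.coe_toNNReal _ h.L_pos.le]
    exact h.lipschitz i x y
  exact this.continuous.measurable

variable (s a) in
/-- The gradient noise of agent `i`. -/
noncomputable def noise (t : ℕ) (ω : s.Ω) (i : Fin n) : Vec d :=
  s.g a i t ω - gradient (s.locObj i) ((s.iter a t ω).x i)

theorem past_subset_compl (i : Fin n) (t : ℕ) :
    past n t ⊆ ({Sum.inl (i, t)}ᶜ : Set ((Fin n × ℕ) ⊕ ℕ)) := by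
  rintro k hk rfl
  exact lt_irrefl t hk

theorem measurable_noise (hs : s.Smooth L) (hQ : Measurable fun p : s.S × Vec d => s.Q p.1 p.2)
    {I : Set ((Fin n × ℕ) ⊕ ℕ)} {i : Fin n} {t : ℕ} (hI : past n t ⊆ I)
    (h : Sum.inl (i, t) ∈ I) : Measurable[s.sources I] fun ω => s.noise a t ω i := by
  have h1 : Measurable[s.sources I] fun ω => (s.iter a t ω).x i :=
    ((measurableState_iter hs hQ t).x i).mono (sources_mono hI) le_rfl
  exact (measurable_g hs hQ hI h).sub ((hs.measurable_gradient_locObj i).comp h1)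

theorem BoundedGrad.norm_noise_le (hb : s.BoundedGrad a T B Binf) {ω : s.Ω}
    (h : s.Good a T B Binf ω) {t : ℕ} (ht : t < T) (i : Fin n) : ‖s.noise a t ω i‖ ≤ 2 * B := by
  refine (norm_sub_le _ _).trans ?_
  have h1 := (h t ht i).1
  have h2 := hb.grad_bound i ((s.iter a t ω).x i)
  linarith

/-- The noise of agent `i` is orthogonal to everything that does not depend on its fresh sample. -/
theorem BoundedGrad.integral_inner_noise (hb : s.BoundedGrad a T B Binf) (hs : s.Smooth L)
    (hQ : Measurable fun p : s.S × Vec d => s.Q p.1 p.2) (hS : s.Sampling) {t : ℕ} (ht : t < T)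
    (i : Fin n) {V : s.Ω → Vec d} (hV : Measurable[s.sources {Sum.inl (i, t)}ᶜ] V) {K : ℝ}
    (hK : ∀ᵐ ω ∂s.P, ‖V ω‖ ≤ K) :
    Integrable (fun ω => inner ℝ (V ω) (s.noise a t ω i)) s.P ∧
      ∫ ω, inner ℝ (V ω) (s.noise a t ω i) ∂s.P = 0 := by
  have := hS.prob
  have := hs.prob i
  have hx : Measurable[s.sources {Sum.inl (i, t)}ᶜ] fun ω => (s.iter a t ω).x i :=
    ((measurableState_iter hs hQ t).x i).mono (sources_mono (past_subset_compl i t)) le_rfl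
  have hY : Measurable[s.sources {Sum.inl (i, t)}ᶜ] fun ω => ((s.iter a t ω).x i, V ω) :=
    hx.prodMk hV
  have hYm : Measurable fun ω => ((s.iter a t ω).x i, V ω) := hY.mono (hS.sources_le _) le_rfl
  have hmap := hS.map_sample i t hY
  have hpair := hYm.prodMk (hS.sample_meas i t)
  set φ : (Vec d × Vec d) × s.Ξ i → ℝ :=
    fun p => inner ℝ p.1.2 (s.sgrad i p.1.1 p.2 - gradient (s.locObj i) p.1.1) with hφ
  have hsg : Measurable fun p : (Vec d × Vec d) × s.Ξ i => s.sgrad i p.1.1 p.2 :=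
    hs.measurable_sgrad_comp (measurable_fst.comp measurable_fst) measurable_snd
  have hφm : Measurable φ := (measurable_snd.comp measurable_fst).inner
    (hsg.sub ((hs.measurable_gradient_locObj i).comp (measurable_fst.comp measurable_fst)))
  have hint' : Integrable (fun ω => inner ℝ (V ω) (s.noise a t ω i)) s.P := by
    refine Integrable.of_bound (C := K * (2 * B)) (hφm.comp hpair).aestronglyMeasurable ?_
    filter_upwards [hK, hb.ae_good] with ω h1 h2
    refine (norm_inner_le_norm _ _).trans ?_
    have h3 := hb.norm_noise_le h2 ht i
    have h4 : 0 ≤ K := (norm_nonneg _).trans h1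
    gcongr
  refine ⟨hint', ?_⟩
  have hint : Integrable φ
      ((s.P.map fun ω => ((s.iter a t ω).x i, V ω)).prod (s.D i)) := by
    rw [← hmap, integrable_map_measure hφm.aestronglyMeasurable hpair.aemeasurable]
    exact hint'
  -- The gradient bound is known only along the path. Transported to the product law, it makes the
  -- sample gradient integrable against `D i` at almost every frozen iterate, so that unbiasedness
  -- can be used.
  have hbd : ∀ᵐ p ∂((s.P.map fun ω => ((s.iter a t ω).x i, V ω)).prod (s.D i)),
      ‖s.sgrad i p.1.1 p.2‖ ≤ B := by
    rw [← hmap, ae_map_iff hpair.aemeasurable (measurableSet_le hsg.norm measurable_const)]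
    exact hb.sgrad_bound t ht i
  have hbd' := ae_of_ae_map hYm.aemeasurable (Measure.ae_ae_of_ae_prod hbd)
  calc ∫ ω, inner ℝ (V ω) (s.noise a t ω i) ∂s.P
      = ∫ p, φ p ∂(s.P.map fun ω => (((s.iter a t ω).x i, V ω), s.ξ i t ω)) :=
        (integral_map hpair.aemeasurable hφm.aestronglyMeasurable).symm
    _ = ∫ y, ∫ z, φ (y, z) ∂s.D i ∂(s.P.map fun ω => ((s.iter a t ω).x i, V ω)) := by
        rw [hmap, integral_prod _ hint]
    _ = ∫ ω, ∫ z, φ (((s.iter a t ω).x i, V ω), z) ∂s.D i ∂s.P :=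
        integral_map hYm.aemeasurable
          hφm.stronglyMeasurable.integral_prod_right'.aestronglyMeasurable
    _ = ∫ _ω, 0 ∂s.P := by
        refine integral_congr_ae ?_
        filter_upwards [hbd', hb.unbiased t ht i] with ω h1 h2
        have h3 : Integrable (fun z => s.sgrad i ((s.iter a t ω).x i) z) (s.D i) :=
          Integrable.of_bound
            (hs.measurable_sgrad_comp measurable_const measurable_id).aestronglyMeasurable B h1
        have h4 : ∫ z, (s.sgrad i ((s.iter a t ω).x i) z
            - gradient (s.locObj i) ((s.iter a t ω).x i)) ∂s.D i = 0 := by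
          rw [integral_sub h3 (integrable_const _), h2]
          simp
        have h5 := integral_inner (𝕜 := ℝ) (h3.sub (integrable_const
          (gradient (s.locObj i) ((s.iter a t ω).x i)))) (V ω)
        refine h5.trans ?_
        simp only [Pi.sub_apply]
        rw [h4, inner_zero_right]
    _ = 0 := by simp

/-- The noise of agent `i` does not depend on the simultaneous sample of agent `j ≠ i`, so the cross
terms vanish. The `n` diagonal terms, each at most `(2B)²`, are divided by `n²`. -/
theorem BoundedGrad.integral_mean_noise_sq (hb : s.BoundedGrad a T B Binf) (hs : s.Smooth L)
    (hQ : Measurable fun p : s.S × Vec d => s.Q p.1 p.2) (hS : s.Sampling) (hn : 0 < n) {t : ℕ}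
    (ht : t < T) :
    Integrable (fun ω => ‖mean (s.noise a t ω)‖ ^ 2) s.P ∧
      ∫ ω, ‖mean (s.noise a t ω)‖ ^ 2 ∂s.P ≤ 4 * B ^ 2 / n := by
  have := hS.prob
  have hm : ∀ i, Measurable fun ω => s.noise a t ω i := fun i =>
    (measurable_noise hs hQ (Set.subset_univ _) (Set.mem_univ _)).mono (hS.sources_le _) le_rfl
  have hbd : ∀ i, ∀ᵐ ω ∂s.P, ‖s.noise a t ω i‖ ≤ 2 * B := fun i => by
    filter_upwards [hb.ae_good] with ω h using hb.norm_noise_le h ht i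
  have hexp : ∀ ω, ‖mean (s.noise a t ω)‖ ^ 2
      = ((n : ℝ)⁻¹) ^ 2 * ∑ j, ∑ i, inner ℝ (s.noise a t ω i) (s.noise a t ω j) := by
    intro ω
    rw [mean, norm_smul, mul_pow, Real.norm_eq_abs, sq_abs, ← real_inner_self_eq_norm_sq,
      inner_sum]
    simp_rw [sum_inner]
  have hoff : ∀ i j, i ≠ j → Integrable (fun ω => inner ℝ (s.noise a t ω i) (s.noise a t ω j)) s.P
      ∧ ∫ ω, inner ℝ (s.noise a t ω i) (s.noise a t ω j) ∂s.P = 0 := fun i j hij =>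
    hb.integral_inner_noise hs hQ hS ht j
      (measurable_noise hs hQ (past_subset_compl j t) (by simpa using hij)) (hbd i)
  have hdiag : ∀ i, Integrable (fun ω => inner ℝ (s.noise a t ω i) (s.noise a t ω i)) s.P
      ∧ ∫ ω, inner ℝ (s.noise a t ω i) (s.noise a t ω i) ∂s.P ≤ 4 * B ^ 2 := by
    intro i
    have h1 : ∀ᵐ ω ∂s.P, inner ℝ (s.noise a t ω i) (s.noise a t ω i) ≤ 4 * B ^ 2 := by
      filter_upwards [hbd i] with ω h
      rw [real_inner_self_eq_norm_sq]
      nlinarith [norm_nonneg (s.noise a t ω i)]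
    have h2 : Integrable (fun ω => inner ℝ (s.noise a t ω i) (s.noise a t ω i)) s.P := by
      refine Integrable.of_bound (C := 4 * B ^ 2)
        ((hm i).inner (hm i)).aestronglyMeasurable ?_
      filter_upwards [h1] with ω h
      rwa [Real.norm_of_nonneg real_inner_self_nonneg]
    refine ⟨h2, ?_⟩
    calc ∫ ω, inner ℝ (s.noise a t ω i) (s.noise a t ω i) ∂s.P ≤ ∫ _ω, 4 * B ^ 2 ∂s.P :=
          integral_mono_ae h2 (integrable_const _) h1
      _ = 4 * B ^ 2 := by simp
  have hall : ∀ i j, Integrable (fun ω => inner ℝ (s.noise a t ω i) (s.noise a t ω j)) s.P := by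
    intro i j
    rcases eq_or_ne i j with rfl | hij
    · exact (hdiag i).1
    · exact (hoff i j hij).1
  simp_rw [hexp]
  refine ⟨(integrable_finsetSum _ fun j _ => integrable_finsetSum _ fun i _ =>
    hall i j).const_mul _, ?_⟩
  rw [integral_const_mul, integral_finsetSum _ fun j _ => integrable_finsetSum _ fun i _ => hall i j]
  have h3 : ∀ j, ∫ ω, ∑ i, inner ℝ (s.noise a t ω i) (s.noise a t ω j) ∂s.P ≤ 4 * B ^ 2 := by
    intro j
    rw [integral_finsetSum _ fun i _ => hall i j, Finset.sum_eq_single j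
      (fun i _ hij => (hoff i j hij).2) (by simp)]
    exact (hdiag j).2
  have hn' : (0 : ℝ) < n := by positivity
  calc ((n : ℝ)⁻¹) ^ 2 * ∑ j, ∫ ω, ∑ i, inner ℝ (s.noise a t ω i) (s.noise a t ω j) ∂s.P
      ≤ ((n : ℝ)⁻¹) ^ 2 * ∑ _j : Fin n, 4 * B ^ 2 := by
        gcongr with j
        exact h3 j
    _ = 4 * B ^ 2 / n := by
        simp only [Finset.sum_const, Finset.card_univ, Fintype.card_fin, nsmul_eq_mul]
        field_simp

theorem BoundedGrad.integral_inner_mean_noise (hb : s.BoundedGrad a T B Binf) (hs : s.Smooth L)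
    (hQ : Measurable fun p : s.S × Vec d => s.Q p.1 p.2) (hS : s.Sampling) {t : ℕ} (ht : t < T)
    {V : s.Ω → Vec d} (hV : Measurable[s.sources (past n t)] V) {K : ℝ}
    (hK : ∀ᵐ ω ∂s.P, ‖V ω‖ ≤ K) :
    Integrable (fun ω => inner ℝ (V ω) (mean (s.noise a t ω))) s.P ∧
      ∫ ω, inner ℝ (V ω) (mean (s.noise a t ω)) ∂s.P = 0 := by
  have h := fun i => hb.integral_inner_noise hs hQ hS ht i
    (hV.mono (sources_mono (past_subset_compl i t)) le_rfl) hK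
  have hexp : ∀ ω, inner ℝ (V ω) (mean (s.noise a t ω))
      = (n : ℝ)⁻¹ * ∑ i, inner ℝ (V ω) (s.noise a t ω i) := fun ω => by
    rw [mean, real_inner_smul_right, inner_sum]
  simp_rw [hexp]
  refine ⟨(integrable_finsetSum _ fun i _ => (h i).1).const_mul _, ?_⟩
  rw [integral_const_mul, integral_finsetSum _ fun i _ => (h i).1]
  simp [fun i => (h i).2]

end Noise

/-! ### The gradient of the averaged objective -/

section Objective

theorem gradient_obj (hs : s.Smooth L) (x : Vec d) :
    HasGradientAt s.obj (mean fun i => gradient (s.locObj i) x) x := by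
  have h1 : ∀ i, HasFDerivAt (s.locObj i) (fderiv ℝ (s.locObj i) x) x := fun i =>
    ((hs.locObj_differentiable i).differentiableAt).hasFDerivAt
  have h2 := (HasFDerivAt.fun_sum (u := Finset.univ) fun i _ => h1 i).const_mul (n : ℝ)⁻¹
  rw [hasGradientAt_iff_hasFDerivAt]
  have h3 : InnerProductSpace.toDual ℝ (Vec d) (mean fun i => gradient (s.locObj i) x)
      = (n : ℝ)⁻¹ • ∑ i, fderiv ℝ (s.locObj i) x := by
    simp only [mean, map_smul, map_sum, toDual_gradient]
  rw [h3]
  exact h2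

theorem Smooth.obj_differentiable (hs : s.Smooth L) : Differentiable ℝ s.obj := fun x =>
  (gradient_obj hs x).differentiableAt

theorem Smooth.gradient_obj_eq (hs : s.Smooth L) (x : Vec d) :
    gradient s.obj x = mean fun i => gradient (s.locObj i) x := (gradient_obj hs x).gradient

theorem Smooth.gradient_obj_lipschitz (hs : s.Smooth L) (x y : Vec d) :
    ‖gradient s.obj x - gradient s.obj y‖ ≤ L * ‖x - y‖ := by
  rw [hs.gradient_obj_eq, hs.gradient_obj_eq, ← mean_sub]
  exact norm_mean_le (mul_nonneg hs.L_pos.le (norm_nonneg _)) fun i => hs.lipschitz i x y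

theorem Smooth.measurable_gradient_obj (hs : s.Smooth L) : Measurable (gradient s.obj) := by
  rw [show gradient s.obj = fun x => mean fun i => gradient (s.locObj i) x from
    funext hs.gradient_obj_eq]
  exact measurable_mean fun i => hs.measurable_gradient_locObj i

variable {T : ℕ} {B Binf : ℝ}

theorem BoundedGrad.norm_gradient_obj_le (hb : s.BoundedGrad a T B Binf) (hs : s.Smooth L)
    (x : Vec d) : ‖gradient s.obj x‖ ≤ B := by
  rw [hs.gradient_obj_eq]
  exact norm_mean_le hb.B_nonneg fun i => hb.grad_bound i x

theorem BoundedGrad.abs_gradient_obj_le (hb : s.BoundedGrad a T B Binf) (hs : s.Smooth L)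
    (x : Vec d) (k : Fin d) : |gradient s.obj x k| ≤ Binf := by
  rw [hs.gradient_obj_eq]
  have h1 : ∀ i, |gradient (s.locObj i) x k| ≤ Binf := fun i =>
    (norm_le_pi_norm (WithLp.ofLp (gradient (s.locObj i) x)) k).trans (hb.grad_bound_inf i x)
  have h2 : (mean fun i => gradient (s.locObj i) x) k
      = (n : ℝ)⁻¹ * ∑ i, gradient (s.locObj i) x k := by
    simp [mean]
  rcases Nat.eq_zero_or_pos n with rfl | hn
  · rw [h2]; simpa using hb.Binf_nonneg
  rw [h2, abs_mul, abs_of_nonneg (by positivity), inv_mul_le_iff₀ (by positivity)]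
  calc |∑ i, gradient (s.locObj i) x k| ≤ ∑ i, |gradient (s.locObj i) x k| :=
        Finset.abs_sum_le_sum_abs _ _
    _ ≤ ∑ _i : Fin n, Binf := Finset.sum_le_sum fun i _ => h1 i
    _ = n * Binf := by simp

end Objective

end Setting
end DAMSCo

/-! ### Solving the coupled consensus recursion -/

namespace DAMSCo

/-- Here `x` and `b` stand for the expected disagreement and squared gap. With `p = S/q²`, the
contraction gives `(1 - q/2) · 10p`, the local moves at most `4pq`, and compression at most `pq`;
these add up to exactly `10p`. In the last term `γ ≤ h/25` absorbs the `1/h²` part of `b`, and `60 γ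
η ≤ q` its `1/q²` part. -/
theorem consensus_recursion_dev {q h η γ S x b : ℝ} (hq : 0 < q) (hq1 : q ≤ 1) (hh : 0 < h)
    (hη : η ^ 2 = 1 - h) (hη0 : 0 ≤ η) (hS : 0 ≤ S) (hγ : 0 ≤ γ) (hγh : γ ≤ h / 25)
    (hγq : γ * (60 * η) ≤ q) (hx : x ≤ 10 * S / q ^ 2)
    (hb : b ≤ 16 * S / h ^ 2 + 10 * S / q ^ 2 / 4) :
    (1 - q) * (x / (1 - q / 4) + S / (q / 4)) / (1 - q / 4) + γ ^ 2 * (4 * (η ^ 2 * b)) / (q / 4)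
      ≤ 10 * S / q ^ 2 := by
  obtain ⟨p, hp⟩ : ∃ p, p = S / q ^ 2 := ⟨_, rfl⟩
  obtain ⟨w, hw⟩ : ∃ w, w = S / h ^ 2 := ⟨_, rfl⟩
  have hp0 : 0 ≤ p := hp ▸ by positivity
  have hw0 : 0 ≤ w := hw ▸ by positivity
  have hSp : S = p * q ^ 2 := by rw [hp]; field_simp
  have hSw : S = w * h ^ 2 := by rw [hw]; field_simp
  rw [show 10 * S / q ^ 2 = 10 * p by rw [hp]; ring] at hx hb ⊢
  rw [show 16 * S / h ^ 2 = 16 * w by rw [hw]; ring] at hb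
  have hd : 0 < 1 - q / 4 := by linarith
  have e1 : (1 - q) * (x / (1 - q / 4) + S / (q / 4)) / (1 - q / 4)
      = (1 - q) / (1 - q / 4) ^ 2 * x + (1 - q) / (1 - q / 4) * (4 * (p * q)) := by
    have hne := hd.ne'
    rw [hSp]
    generalize 1 - q / 4 = D at hne ⊢
    field_simp
  have c1 : (1 - q) / (1 - q / 4) ^ 2 ≤ 1 - q / 2 := by
    rw [div_le_iff₀ (by positivity)]
    nlinarith [mul_nonneg hq.le hq.le, mul_nonneg (mul_nonneg hq.le hq.le) (sub_nonneg.2 hq1)]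
  have c2 : (1 - q) / (1 - q / 4) ≤ 1 := by
    rw [div_le_one hd]; linarith
  have c3 : 0 ≤ (1 - q) / (1 - q / 4) ^ 2 := div_nonneg (by linarith) (by positivity)
  have t1 : (1 - q) / (1 - q / 4) ^ 2 * x ≤ (1 - q / 2) * (10 * p) :=
    (mul_le_mul_of_nonneg_left hx c3).trans (mul_le_mul_of_nonneg_right c1 (by positivity))
  have t2 : (1 - q) / (1 - q / 4) * (4 * (p * q)) ≤ 4 * (p * q) :=
    mul_le_of_le_one_left (by positivity) c2
  have g1 : γ ^ 2 ≤ h ^ 2 / 625 := by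
    have := pow_le_pow_left₀ hγ hγh 2
    linarith [this, show (h / 25) ^ 2 = h ^ 2 / 625 by ring]
  have g2 : γ ^ 2 * η ^ 2 ≤ q ^ 2 / 3600 := by
    have := pow_le_pow_left₀ (by positivity) hγq 2
    linarith [this, show (γ * (60 * η)) ^ 2 = 3600 * (γ ^ 2 * η ^ 2) by ring]
  have g3 : γ ^ 2 * η ^ 2 ≤ h ^ 2 / 625 := by
    have : γ ^ 2 * η ^ 2 ≤ γ ^ 2 * 1 := by
      gcongr
      linarith
    linarith
  have t3 : γ ^ 2 * η ^ 2 * b ≤ S / 16 := by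
    have k1 : γ ^ 2 * η ^ 2 * b ≤ γ ^ 2 * η ^ 2 * (16 * w + 10 * p / 4) := by gcongr
    have k2 := mul_le_mul_of_nonneg_right g3 hw0
    have k3 := mul_le_mul_of_nonneg_right g2 hp0
    linarith [mul_comm w (h ^ 2), mul_comm p (q ^ 2)]
  have e2 : γ ^ 2 * (4 * (η ^ 2 * b)) / (q / 4) = 16 * (γ ^ 2 * η ^ 2 * b) / q := by
    field_simp; ring
  have t4 : 16 * (γ ^ 2 * η ^ 2 * b) / q ≤ p * q := by
    rw [div_le_iff₀ hq]
    linarith [show p * q * q = p * q ^ 2 by ring]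
  rw [e1, e2]
  linarith

/-- With `w = S/h²`, the contraction factor `1 - h/2` frees `8wh + 5ph/4`, and the new contributions
are at most `8wh + ph`. So `16` is forced by the local moves, while the coefficient `10/4` leaves
slack. -/
theorem consensus_recursion_gap {q h η γ S x b : ℝ} (hq : 0 < q) (hq1 : q ≤ 1) (hh : 0 < h)
    (hh1 : h ≤ 1) (hη : η ^ 2 = 1 - h) (hS : 0 ≤ S) (hγ : 0 ≤ γ) (hγh : γ ≤ h / 25)
    (hx : x ≤ 10 * S / q ^ 2) (hb : b ≤ 16 * S / h ^ 2 + 10 * S / q ^ 2 / 4) :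
    (1 + 2 * γ) ^ 2 * (η ^ 2 * b) / (1 - h / 4)
        + (2 * (γ ^ 2 * (4 * (x / (1 - q / 4) + S / (q / 4)))) + 2 * S) / (h / 4)
      ≤ 16 * S / h ^ 2 + 10 * S / q ^ 2 / 4 := by
  obtain ⟨p, hp⟩ : ∃ p, p = S / q ^ 2 := ⟨_, rfl⟩
  obtain ⟨w, hw⟩ : ∃ w, w = S / h ^ 2 := ⟨_, rfl⟩
  have hp0 : 0 ≤ p := hp ▸ by positivity
  have hw0 : 0 ≤ w := hw ▸ by positivity
  have hSp : S = p * q ^ 2 := by rw [hp]; field_simp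
  have hSw : S = w * h ^ 2 := by rw [hw]; field_simp
  rw [show 10 * S / q ^ 2 = 10 * p by rw [hp]; ring] at hx hb ⊢
  rw [show 16 * S / h ^ 2 = 16 * w by rw [hw]; ring] at hb ⊢
  have hd : 0 < 1 - h / 4 := by linarith
  have hd' : 0 < 1 - q / 4 := by linarith
  have g1 : γ ^ 2 ≤ h ^ 2 / 625 := by
    have := pow_le_pow_left₀ hγ hγh 2
    linarith [this, show (h / 25) ^ 2 = h ^ 2 / 625 by ring]
  have c1 : (1 + 2 * γ) ^ 2 * η ^ 2 / (1 - h / 4) ≤ 1 - h / 2 := by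
    have k1 : (1 + 2 * γ) ^ 2 ≤ 1 + h / 5 := by nlinarith
    have k2 : (1 + 2 * γ) ^ 2 * η ^ 2 ≤ (1 + h / 5) * (1 - h) := by
      rw [hη]
      exact mul_le_mul_of_nonneg_right k1 (by linarith)
    rw [div_le_iff₀ hd]
    nlinarith
  have c0 : 0 ≤ (1 + 2 * γ) ^ 2 * η ^ 2 / (1 - h / 4) := by positivity
  have t1 : (1 + 2 * γ) ^ 2 * η ^ 2 / (1 - h / 4) * b ≤ (1 - h / 2) * (16 * w + 10 * p / 4) :=
    (mul_le_mul_of_nonneg_left hb c0).trans (mul_le_mul_of_nonneg_right c1 (by positivity))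
  have t2 : x / (1 - q / 4) ≤ 40 / 3 * p := by
    rw [div_le_iff₀ hd']
    nlinarith
  have t3 : S / (q / 4) ≤ 4 * p := by
    rw [hSp, div_le_iff₀ (by positivity)]
    nlinarith [mul_nonneg hp0 hq.le]
  have t4 : γ ^ 2 * (4 * (x / (1 - q / 4) + S / (q / 4))) ≤ h ^ 2 / 625 * (4 * (52 / 3 * p)) := by
    calc γ ^ 2 * (4 * (x / (1 - q / 4) + S / (q / 4))) ≤ γ ^ 2 * (4 * (52 / 3 * p)) := by
          gcongr
          linarith
      _ ≤ h ^ 2 / 625 * (4 * (52 / 3 * p)) := by gcongr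
  have t5 : (2 * (γ ^ 2 * (4 * (x / (1 - q / 4) + S / (q / 4)))) + 2 * S) / (h / 4)
      ≤ h * p + 8 * (w * h) := by
    rw [div_le_iff₀ (by positivity), hSw]
    have : 0 ≤ h ^ 2 * p := by positivity
    rw [hSw] at t4
    nlinarith
  have e1 : (1 + 2 * γ) ^ 2 * (η ^ 2 * b) / (1 - h / 4)
      = (1 + 2 * γ) ^ 2 * η ^ 2 / (1 - h / 4) * b := by ring
  rw [e1]
  nlinarith [mul_nonneg hh.le hp0]

namespace Setting

variable {n d : ℕ} {s : Setting.{u} n d} {a : Params} {T : ℕ} {L B Binf η θ : ℝ}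

theorem Admissible.θ_pos (h : s.Admissible a T L B Binf η θ) : 0 < θ := by
  have hn := h.mixing.n_pos
  have hL := h.smooth.L_pos
  exact lt_trans (by positivity) h.θ_mem.1

theorem Admissible.T_pos (h : s.Admissible a T L B Binf η θ) : 0 < T :=
  h.mixing.n_pos.trans_le h.n_le_T

theorem Admissible.α_pos (h : s.Admissible a T L B Binf η θ) : 0 < a.α := by
  have hn := h.mixing.n_pos
  have hθ := h.θ_pos
  have hT := h.T_pos
  have hδ := h.δ_pos
  rw [h.α_eq]
  positivity

theorem Admissible.gap_pos (h : s.Admissible a T L B Binf η θ) :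
    0 < 1 - s.rhoHat a.γ ^ 2 ∧ 1 - s.rhoHat a.γ ^ 2 ≤ 1 := by
  have h1 := h.mixing.rhoHat_lt_one h.γ_pos h.γ_le_one
  have h2 : 0 ≤ s.rhoHat a.γ := specNorm_nonneg _
  constructor <;> nlinarith

theorem measurable_iter (hs : s.Smooth L) (hQ : Measurable fun p : s.S × Vec d => s.Q p.1 p.2)
    (hS : s.Sampling) (t : ℕ) : MeasurableState s.mΩ (s.iter a t) :=
  (measurableState_iter hs hQ t).mono (hS.sources_le _)

theorem measurable_fro_dev (hs : s.Smooth L)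
    (hQ : Measurable fun p : s.S × Vec d => s.Q p.1 p.2) (hS : s.Sampling) (t : ℕ) :
    Measurable fun ω => fro (s.dev a t ω) := by
  have h := measurable_iter (a := a) hs hQ hS t
  exact measurable_fro fun i => (h.x i).sub (measurable_mean h.x)

theorem measurable_fro_gap (hs : s.Smooth L)
    (hQ : Measurable fun p : s.S × Vec d => s.Q p.1 p.2) (hS : s.Sampling) (t : ℕ) :
    Measurable fun ω => fro (s.gap a t ω) :=
  measurable_fro fun i => (measurable_gap hs hQ t i).mono (hS.sources_le _) le_rfl

theorem integral_le_of_ae_le {Ω : Type*} {mΩ : MeasurableSpace Ω} {μ : Measure Ω} {f g : Ω → ℝ}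
    (hf : Measurable f) (h0 : ∀ ω, 0 ≤ f ω) (hg : Integrable g μ) (h : ∀ᵐ ω ∂μ, f ω ≤ g ω) :
    Integrable f μ ∧ ∫ ω, f ω ∂μ ≤ ∫ ω, g ω ∂μ := by
  have hf' : Integrable f μ := hg.mono' hf.aestronglyMeasurable <| by
    filter_upwards [h] with ω h1
    rwa [Real.norm_of_nonneg (h0 ω)]
  exact ⟨hf', integral_mono_ae hf' hg h⟩

/-- The two estimates feed each other, so they are proved in one induction. The pathwise recursions,
with weights `q/4` and `k/4`, where `k = 1 - η²`, are integrated and closed by the two scalar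
lemmas. Integrability is carried along. -/
theorem Admissible.consensus_and_gap (h : s.Admissible a T L B Binf η θ) {S : ℝ}
    (hSdef : S = a.α ^ 2 * (n * (B ^ 2 / a.δ))) {t : ℕ} (ht : t < T) :
    (Integrable (fun ω => fro (s.dev a t ω)) s.P ∧
      ∫ ω, fro (s.dev a t ω) ∂s.P ≤ 10 * S / (1 - s.rhoHat a.γ ^ 2) ^ 2) ∧
    (Integrable (fun ω => fro (s.gap a t ω)) s.P ∧
      ∫ ω, fro (s.gap a t ω) ∂s.P ≤ 16 * S / (1 - η ^ 2) ^ 2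
        + 10 * S / (1 - s.rhoHat a.γ ^ 2) ^ 2 / 4) := by
  have hP := h.sampling.prob
  have hQ := h.compression.meas
  obtain ⟨hq, hq1⟩ := h.gap_pos
  obtain ⟨q, hqd⟩ : ∃ q, q = 1 - s.rhoHat a.γ ^ 2 := ⟨_, rfl⟩
  have hρ : s.rhoHat a.γ ^ 2 = 1 - q := by rw [hqd]; ring
  have hγq := h.γ_le
  rw [← hqd] at hq hq1 hγq ⊢
  have hη0 := h.compression.eta_nonneg
  have hη1 := h.compression.eta_lt_one
  obtain ⟨k, hkd⟩ : ∃ k, k = 1 - η ^ 2 := ⟨_, rfl⟩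
  have hηk : η ^ 2 = 1 - k := by rw [hkd]; ring
  have hk : 0 < k := by rw [hkd]; nlinarith
  have hk1 : k ≤ 1 := by rw [hkd]; nlinarith
  have hγk := h.γ_le'
  rw [← hkd] at hγk ⊢
  have hδ := h.δ_pos
  have hS : 0 ≤ S := by rw [hSdef]; positivity
  -- One almost sure bound on all local moves makes the forcing term deterministic.
  have hdir : ∀ᵐ ω ∂s.P, ∀ t < T, a.α ^ 2 * fro (s.dir a t ω) ≤ S := by
    filter_upwards [h.boundedGrad.ae_good] with ω hg t ht
    rw [hSdef]
    gcongr
    exact hg.fro_dir_le h.boundedGrad.B_nonneg h.β₁_mem h.β₂_mem hδ ht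
  induction t with
  | zero =>
    refine ⟨⟨?_, ?_⟩, ?_⟩
    · simp only [dev_zero]
      exact integrable_const 0
    · simp only [dev_zero, integral_zero]
      positivity
    · have h1 := integral_le_of_ae_le (μ := s.P) (measurable_fro_gap h.smooth hQ h.sampling 0)
        (fun ω => fro_nonneg _) (integrable_const S) (by
          filter_upwards [hdir] with ω hd
          rw [fro_gap_zero]
          exact hd 0 ht)
      refine ⟨h1.1, h1.2.trans ?_⟩
      have h2 : S ≤ 16 * S / k ^ 2 := by
        rw [le_div_iff₀ (by positivity)]
        nlinarith [mul_le_mul_of_nonneg_left (pow_le_one₀ hk.le hk1 : k ^ 2 ≤ 1) hS]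
      have h3 : 0 ≤ 10 * S / q ^ 2 / 4 := by positivity
      simp only [integral_const, probReal_univ, smul_eq_mul, one_mul]
      linarith
  | succ t ih =>
    have ht' : t < T := by omega
    obtain ⟨⟨hd1, hd2⟩, hg1, hg2⟩ := ih ht'
    obtain ⟨hc1, hc2⟩ := h.compression.integral_fro_le h.smooth h.sampling t hg1
    have hτ : 0 < q / 4 := by linarith
    have hτ1 : q / 4 < 1 := by linarith
    have hσ : 0 < k / 4 := by linarith
    have hσ1 : k / 4 < 1 := by linarith
    have hm := h.mixing
    have hhalf : ∀ᵐ ω ∂s.P, fro (s.halfDev a t ω)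
        ≤ fro (s.dev a t ω) / (1 - q / 4) + S / (q / 4) := by
      filter_upwards [hdir] with ω hd
      refine (fro_halfDev_le t ω hτ hτ1).trans ?_
      gcongr
      exact hd t ht'
    have hq0 : 0 < 1 - q / 4 := by linarith
    have hk0 : 0 < 1 - k / 4 := by linarith
    have hq0' : 0 ≤ 1 - q := by linarith
    have hI0 : Integrable (fun ω => fro (s.dev a t ω) / (1 - q / 4) + S / (q / 4)) s.P :=
      (hd1.div_const _).add (integrable_const _)
    have hI1 : Integrable (fun ω => (1 - q) * (fro (s.dev a t ω) / (1 - q / 4) + S / (q / 4))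
        / (1 - q / 4)) s.P := (hI0.const_mul _).div_const _
    have hI2 : Integrable (fun ω => a.γ ^ 2 * (4 * fro (s.cerr a t ω)) / (q / 4)) s.P :=
      ((hc1.const_mul _).const_mul _).div_const _
    have hI3 : Integrable (fun ω => (1 + 2 * a.γ) ^ 2 * fro (s.cerr a t ω) / (1 - k / 4)) s.P :=
      (hc1.const_mul _).div_const _
    have hI4 : Integrable (fun ω => (2 * (a.γ ^ 2 * (4 * (fro (s.dev a t ω) / (1 - q / 4)
        + S / (q / 4)))) + 2 * S) / (k / 4)) s.P :=
      ((((hI0.const_mul _).const_mul _).const_mul _).add (integrable_const _)).div_const _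
    have eI0 : ∫ ω, (fro (s.dev a t ω) / (1 - q / 4) + S / (q / 4)) ∂s.P
        = (∫ ω, fro (s.dev a t ω) ∂s.P) / (1 - q / 4) + S / (q / 4) := by
      rw [integral_add (hd1.div_const _) (integrable_const _), integral_div]
      simp
    constructor
    · have h1 := integral_le_of_ae_le (μ := s.P)
        (measurable_fro_dev (a := a) h.smooth hQ h.sampling (t + 1))
        (fun ω => fro_nonneg _) (hI1.add hI2) (by
          filter_upwards [hhalf] with ω hω
          refine (hm.fro_dev_succ_le t ω hτ hτ1).trans ?_
          rw [hρ]
          simp only [Pi.add_apply]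
          gcongr)
      refine ⟨h1.1, h1.2.trans ?_⟩
      simp only [Pi.add_apply]
      rw [integral_add hI1 hI2, integral_div, integral_div, integral_const_mul,
        integral_const_mul, integral_const_mul, eI0]
      refine le_trans ?_ (consensus_recursion_dev hq hq1 hk hηk hη0 hS h.γ_pos.le hγk hγq hd2 hg2)
      gcongr
    · have h1 := integral_le_of_ae_le (μ := s.P)
        (measurable_fro_gap (a := a) h.smooth hQ h.sampling (t + 1))
        (fun ω => fro_nonneg _) (hI3.add hI4) (by
          filter_upwards [hhalf, hdir] with ω hω hd
          refine (hm.fro_gap_succ_le h.γ_pos.le t ω hσ hσ1).trans ?_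
          simp only [Pi.add_apply]
          gcongr
          exact hd (t + 1) ht)
      refine ⟨h1.1, h1.2.trans ?_⟩
      simp only [Pi.add_apply]
      have eI4 : ∫ ω, (2 * (a.γ ^ 2 * (4 * (fro (s.dev a t ω) / (1 - q / 4)
          + S / (q / 4)))) + 2 * S) / (k / 4) ∂s.P
          = (2 * (a.γ ^ 2 * (4 * ((∫ ω, fro (s.dev a t ω) ∂s.P) / (1 - q / 4)
          + S / (q / 4)))) + 2 * S) / (k / 4) := by
        rw [integral_div, integral_add (((hI0.const_mul _).const_mul _).const_mul _)
          (integrable_const _), integral_const_mul, integral_const_mul, integral_const_mul, eI0]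
        simp
      rw [integral_add hI3 hI4, eI4, integral_div, integral_const_mul]
      refine le_trans ?_ (consensus_recursion_gap hq hq1 hk hk1 hηk hS h.γ_pos.le hγk hd2 hg2)
      gcongr

end Setting
end DAMSCo

/-! ### Descent along the virtual sequence -/

namespace DAMSCo

/-- Young's inequality for the main term of the descent: `a` is the gradient at the average, `z` and
`g` are the perturbed gradients. -/
theorem neg_inner_add_norm_sq_le {E : Type*} [NormedAddCommGroup E] [InnerProductSpace ℝ E]
    (a z g : E) {c : ℝ} (hc : c ≤ 1 / 6) :
    -inner ℝ z g + c * ‖g‖ ^ 2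
      ≤ -(1 / 3) * ‖a‖ ^ 2 + 3 * ‖g - a‖ ^ 2 + 3 * ‖z - a‖ ^ 2 := by
  obtain ⟨D, hD⟩ : ∃ D, D = g - a := ⟨_, rfl⟩
  obtain ⟨E', hE⟩ : ∃ E', E' = z - a := ⟨_, rfl⟩
  have hg : g = a + D := by rw [hD]; abel
  have hz : z = a + E' := by rw [hE]; abel
  rw [← hD, ← hE, hg, hz, inner_add_left, inner_add_right, inner_add_right,
    real_inner_self_eq_norm_sq]
  have h1 := abs_le.1 (abs_real_inner_le_norm a D)
  have h2 := abs_le.1 (abs_real_inner_le_norm E' a)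
  have h3 := abs_le.1 (abs_real_inner_le_norm E' D)
  have h4 : ‖a + D‖ ^ 2 ≤ (‖a‖ + ‖D‖) ^ 2 := by gcongr; exact norm_add_le _ _
  have h5 : c * ‖a + D‖ ^ 2 ≤ 1 / 6 * (‖a‖ + ‖D‖) ^ 2 := by gcongr
  have h6 := sq_nonneg (‖a‖ - 4 * ‖D‖)
  have h7 := sq_nonneg (‖a‖ - 4 * ‖E'‖)
  have h8 := sq_nonneg (‖E'‖ - ‖D‖)
  have h9 := sq_nonneg (‖a‖ - ‖D‖)
  nlinarith

namespace Setting

variable {n d : ℕ} {s : Setting.{u} n d} {a : Params} {T : ℕ} {L B Binf η θ : ℝ}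

/-- This bounds the effective step `λ`. The constant `24` is what gives `4 L λ ≤ 1/6`, the condition
of `neg_inner_add_norm_sq_le`. -/
theorem Admissible.step_size_le (h : s.Admissible a T L B Binf η θ) :
    24 * (L * (a.α / √a.δ)) ≤ 1 := by
  have hδ := h.δ_pos
  have hL := h.smooth.L_pos
  have h0 : 0 < √a.δ := Real.sqrt_pos.2 hδ
  have h1 : √a.δ ≤ √(Binf ^ 2 + a.δ) := Real.sqrt_le_sqrt (by nlinarith [sq_nonneg Binf])
  have h2 := h.α_le
  rw [le_div_iff₀ (by positivity)] at h2
  have h3 : a.α * (24 * L * √a.δ) ≤ a.δ := by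
    refine le_trans ?_ h2
    have := h.α_pos
    gcongr
  have h4 : 24 * (L * (a.α / √a.δ)) = a.α * (24 * L * √a.δ) / (√a.δ * √a.δ) := by field_simp
  rw [h4, Real.mul_self_sqrt hδ.le, div_le_one hδ]
  exact h3

variable (s a) in
/-- The average of the local gradients at the iterates. -/
noncomputable def avgGrad (t : ℕ) (ω : s.Ω) : Vec d :=
  mean fun i => gradient (s.locObj i) ((s.iter a t ω).x i)

theorem gbar_eq (t : ℕ) (ω : s.Ω) : s.gbar a t ω = s.avgGrad a t ω + mean (s.noise a t ω) := by
  rw [gbar, avgGrad, ← mean_add]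
  congr 1
  funext i
  rw [noise]; abel

theorem Smooth.norm_avgGrad_sub_sq_le (hs : s.Smooth L) (t : ℕ) (ω : s.Ω) :
    ‖s.avgGrad a t ω - gradient s.obj (mean (s.iter a t ω).x)‖ ^ 2
      ≤ L ^ 2 * ((n : ℝ)⁻¹ * fro (s.dev a t ω)) := by
  rw [avgGrad, hs.gradient_obj_eq, ← mean_sub]
  refine (norm_mean_sq_le _).trans ?_
  have : fro (fun i => gradient (s.locObj i) ((s.iter a t ω).x i)
      - gradient (s.locObj i) (mean (s.iter a t ω).x)) ≤ L ^ 2 * fro (s.dev a t ω) := by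
    unfold fro
    rw [Finset.mul_sum]
    refine Finset.sum_le_sum fun i _ => ?_
    rw [← mul_pow]
    gcongr
    exact hs.lipschitz i _ _
  calc (n : ℝ)⁻¹ * _ ≤ (n : ℝ)⁻¹ * (L ^ 2 * fro (s.dev a t ω)) := by gcongr
    _ = _ := by ring

theorem Admissible.norm_gradient_virt_sub_sq_le (h : s.Admissible a T L B Binf η θ) {ω : s.Ω}
    (hg : s.Good a T B Binf ω) {t : ℕ} (ht : t < T) :
    ‖gradient s.obj (s.virt a t ω) - gradient s.obj (mean (s.iter a t ω).x)‖ ^ 2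
      ≤ (L * (a.α / √a.δ * (a.β₁ / (1 - a.β₁)) * B)) ^ 2 := by
  have hβ := h.β₁_mem
  have h1 : 0 < 1 - a.β₁ := by linarith [hβ.2]
  have h2 := hβ.1
  have hα := h.α_pos
  have hL := h.smooth.L_pos
  have hm : ‖mean (s.iter a t ω).m‖ ≤ B :=
    norm_mean_le h.boundedGrad.B_nonneg fun i => hg.norm_m_le h.boundedGrad.B_nonneg hβ ht.le i
  refine pow_le_pow_left₀ (norm_nonneg _) ((h.smooth.gradient_obj_lipschitz _ _).trans ?_) 2
  gcongr
  rw [virt, sub_sub_cancel_left, norm_neg, norm_smul, Real.norm_of_nonneg (by positivity)]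
  gcongr

/-- One step of the descent along the virtual sequence. -/
theorem Admissible.obj_virt_succ_le (h : s.Admissible a T L B Binf η θ) {U : ℝ}
    (hU : T * (1 - a.β₂) * Binf ^ 2 ≤ U) {ω : s.Ω} (hg : s.Good a T B Binf ω) {t : ℕ}
    (ht : t < T) :
    s.obj (s.virt a (t + 1) ω) - s.obj (s.virt a t ω) ≤ a.α / √a.δ *
      (-(1 / 3) * ‖gradient s.obj (mean (s.iter a t ω).x)‖ ^ 2
        + 3 * (L ^ 2 * ((n : ℝ)⁻¹ * fro (s.dev a t ω)))
        + 3 * (L * (a.α / √a.δ * (a.β₁ / (1 - a.β₁)) * B)) ^ 2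
        + 2 * (d * (Binf ^ 2 * (U / (U + a.δ))))
        - inner ℝ (gradient s.obj (s.virt a t ω)) (mean (s.noise a t ω))
        + 4 * (L * (a.α / √a.δ)) * ‖mean (s.noise a t ω)‖ ^ 2) := by
  have hδ := h.δ_pos
  have hα := h.α_pos
  have hL := h.smooth.L_pos
  have h0 : 0 < √a.δ := Real.sqrt_pos.2 hδ
  have hstep := h.step_size_le
  have hD1 := h.smooth.norm_avgGrad_sub_sq_le (a := a) t ω
  have hD2 := h.norm_gradient_virt_sub_sq_le hg ht
  have hp1 := hg.abs_inner_pert_le h.boundedGrad.Binf_nonneg h.β₁_mem h.β₂_mem hδ hU ht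
    (v := gradient s.obj (s.virt a t ω)) (h.boundedGrad.abs_gradient_obj_le h.smooth _)
  have hp2 := hg.norm_pert_sq_le h.boundedGrad.Binf_nonneg h.β₁_mem h.β₂_mem hδ hU ht
  have hdesc := le_add_of_lipschitz_gradient h.smooth.obj_differentiable hL.le
    h.smooth.gradient_obj_lipschitz (s.virt a t ω) (s.virt a (t + 1) ω)
  rw [h.mixing.virt_succ_sub h.β₁_mem, gbar_eq] at hdesc
  have hβ' : 0 < 1 - a.β₂ := by linarith [h.β₂_mem.2]
  have hU0 : 0 ≤ U := le_trans (by positivity) hU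
  have hR0 : 0 ≤ d * (Binf ^ 2 * (U / (U + a.δ))) := by positivity
  rw [← mul_div_assoc] at hp1 hp2
  have hl2 : a.α ^ 2 / a.δ = (a.α / √a.δ) ^ 2 := by rw [div_pow, Real.sq_sqrt hδ.le]
  generalize (d : ℝ) * (Binf ^ 2 * (U / (U + a.δ))) = R at *
  generalize gradient s.obj (s.virt a t ω) = z at *
  generalize gradient s.obj (mean (s.iter a t ω).x) = A at *
  generalize s.avgGrad a t ω = G at *
  generalize mean (s.noise a t ω) = N at *
  generalize s.pert a t ω = p at *
  generalize (L * (a.α / √a.δ * (a.β₁ / (1 - a.β₁)) * B)) ^ 2 = M at *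
  generalize L ^ 2 * ((n : ℝ)⁻¹ * fro (s.dev a t ω)) = V at *
  have hαp : a.α * |inner ℝ z p| ≤ a.α / √a.δ * R := by
    calc a.α * |inner ℝ z p| ≤ a.α * (R / √a.δ) := by gcongr
      _ = a.α / √a.δ * R := by ring
  have hαp2 : a.α ^ 2 * ‖p‖ ^ 2 ≤ (a.α / √a.δ) ^ 2 * R := by
    calc a.α ^ 2 * ‖p‖ ^ 2 ≤ a.α ^ 2 * (R / a.δ) := by gcongr
      _ = a.α ^ 2 / a.δ * R := by ring
      _ = (a.α / √a.δ) ^ 2 * R := by rw [hl2]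
  have hl0 : 0 < a.α / √a.δ := by positivity
  generalize a.α / √a.δ = l at *
  have hY := neg_inner_add_norm_sq_le A z G (c := 4 * (L * l)) (by linarith)
  have hin : inner ℝ z (-(l • (G + N)) - a.α • p)
      = -(l * (inner ℝ z G + inner ℝ z N)) - a.α * inner ℝ z p := by
    rw [inner_sub_right, inner_neg_right, real_inner_smul_right, real_inner_smul_right,
      inner_add_right]
  -- Two splittings of a square: first the scaling error is separated, then the noise from the
  -- averaged gradient. The resulting `4 L l² ‖G‖²` is absorbed by the main descent term.
  have hno : ‖-(l • (G + N)) - a.α • p‖ ^ 2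
      ≤ l ^ 2 * (4 * ‖G‖ ^ 2 + 4 * ‖N‖ ^ 2) + 2 * (a.α ^ 2 * ‖p‖ ^ 2) := by
    have k1 : ‖-(l • (G + N)) - a.α • p‖ ≤ l * (‖G‖ + ‖N‖) + a.α * ‖p‖ := by
      refine (norm_sub_le _ _).trans ?_
      rw [norm_neg, norm_smul, norm_smul, Real.norm_of_nonneg hl0.le, Real.norm_of_nonneg hα.le]
      gcongr
      exact norm_add_le _ _
    have k2 := pow_le_pow_left₀ (norm_nonneg _) k1 2
    have k3 : (‖G‖ + ‖N‖) ^ 2 ≤ 2 * ‖G‖ ^ 2 + 2 * ‖N‖ ^ 2 := by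
      nlinarith [sq_nonneg (‖G‖ - ‖N‖)]
    have k4 : l ^ 2 * (‖G‖ + ‖N‖) ^ 2 ≤ l ^ 2 * (2 * ‖G‖ ^ 2 + 2 * ‖N‖ ^ 2) := by gcongr
    linarith [sq_nonneg (l * (‖G‖ + ‖N‖) - a.α * ‖p‖)]
  rw [hin] at hdesc
  have hno' : L * ‖-(l • (G + N)) - a.α • p‖ ^ 2
      ≤ L * (l ^ 2 * (4 * ‖G‖ ^ 2 + 4 * ‖N‖ ^ 2) + 2 * (l ^ 2 * R)) := by
    gcongr
    linarith
  -- The quadratic contribution of the scaling error is thus at most `l R / 12`; with `l R` from the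
  -- inner product it stays below `2 l R`.
  have hLl : L * l ^ 2 * R ≤ l * R / 24 := by
    have : L * l * (l * R) ≤ 1 / 24 * (l * R) := by
      gcongr
      linarith
    linarith [show L * l * (l * R) = L * l ^ 2 * R by ring]
  have hYl := mul_le_mul_of_nonneg_left hY hl0.le
  have hz := neg_abs_le (inner ℝ z p)
  have hz' := mul_le_mul_of_nonneg_left hz hα.le
  have hV := mul_le_mul_of_nonneg_left hD1 hl0.le
  have hM := mul_le_mul_of_nonneg_left hD2 hl0.le
  have hlR : 0 ≤ l * R := mul_nonneg hl0.le hR0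
  linarith

theorem measurable_virt (hs : s.Smooth L) (hQ : Measurable fun p : s.S × Vec d => s.Q p.1 p.2)
    (t : ℕ) : Measurable[s.sources (past n t)] (s.virt a t) := by
  have h := measurableState_iter (a := a) hs hQ t
  let _ : MeasurableSpace s.Ω := s.sources (past n t)
  have hx := measurable_mean h.x
  have hm := measurable_mean h.m
  exact hx.sub (hm.const_smul (a.α / √a.δ * (a.β₁ / (1 - a.β₁))))

theorem err_eq (t : ℕ) (ω : s.Ω) : s.err a t ω
    = ‖gradient s.obj (mean (s.iter a t ω).x)‖ ^ 2 + (n : ℝ)⁻¹ * fro (s.dev a t ω) := rfl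

theorem integral_add_add_const_sub_add {Ω : Type*} {mΩ : MeasurableSpace Ω} {μ : Measure Ω}
    [IsProbabilityMeasure μ] {f₁ f₂ f₃ f₄ : Ω → ℝ} (h₁ : Integrable f₁ μ) (h₂ : Integrable f₂ μ)
    (h₃ : Integrable f₃ μ) (h₄ : Integrable f₄ μ) (c c' : ℝ) :
    Integrable (fun ω => f₁ ω + f₂ ω + c + c' - f₃ ω + f₄ ω) μ ∧
      ∫ ω, f₁ ω + f₂ ω + c + c' - f₃ ω + f₄ ω ∂μ
        = ∫ ω, f₁ ω ∂μ + ∫ ω, f₂ ω ∂μ + c + c' - ∫ ω, f₃ ω ∂μ + ∫ ω, f₄ ω ∂μ := by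
  have i1 : Integrable (fun ω => f₁ ω + f₂ ω) μ := h₁.add h₂
  have i2 : Integrable (fun ω => f₁ ω + f₂ ω + c) μ := i1.add (integrable_const c)
  have i3 : Integrable (fun ω => f₁ ω + f₂ ω + c + c') μ := i2.add (integrable_const c')
  have i4 : Integrable (fun ω => f₁ ω + f₂ ω + c + c' - f₃ ω) μ := i3.sub h₃
  refine ⟨i4.add h₄, ?_⟩
  rw [integral_add i4 h₄, integral_sub i3 h₃, integral_add i2 (integrable_const c'),
    integral_add i1 (integrable_const c), integral_add h₁ h₂]
  simp

/-- The basic bound of the averaged error, before the choice of the parameters. -/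
theorem Admissible.avgErrLE_basic (h : s.Admissible a T L B Binf η θ) {U : ℝ}
    (hU : T * (1 - a.β₂) * Binf ^ 2 ≤ U) :
    s.AvgErrLE a T (3 * ((s.obj 0 - s.optVal) / (a.α / √a.δ * T))
      + (9 * L ^ 2 + 1) * ((n : ℝ)⁻¹ * (10 * (a.α ^ 2 * (n * (B ^ 2 / a.δ)))
          / (1 - s.rhoHat a.γ ^ 2) ^ 2))
      + 9 * (L * (a.α / √a.δ * (a.β₁ / (1 - a.β₁)) * B)) ^ 2
      + 48 * (L * (a.α / √a.δ)) * (B ^ 2 / n)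
      + 6 * (d * (Binf ^ 2 * (U / (U + a.δ))))) := by
  have hP := h.sampling.prob
  have hQ := h.compression.meas
  have hT : (0 : ℝ) < T := by exact_mod_cast h.T_pos
  have hn := h.mixing.n_pos
  have hl : 0 < a.α / √a.δ := div_pos h.α_pos (Real.sqrt_pos.2 h.δ_pos)
  have hL := h.smooth.L_pos
  have hcons := fun t (ht : t < T) => (h.consensus_and_gap rfl ht).1
  obtain ⟨A, hA⟩ : ∃ A, A = 10 * (a.α ^ 2 * (n * (B ^ 2 / a.δ)))
    / (1 - s.rhoHat a.γ ^ 2) ^ 2 := ⟨_, rfl⟩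
  rw [← hA] at hcons ⊢
  have hgm : ∀ t, Measurable fun ω => ‖gradient s.obj (mean (s.iter a t ω).x)‖ ^ 2 := fun t =>
    (h.smooth.measurable_gradient_obj.comp
      (measurable_mean (measurable_iter h.smooth hQ h.sampling t).x)).norm.pow_const 2
  have hgi : ∀ t, Integrable (fun ω => ‖gradient s.obj (mean (s.iter a t ω).x)‖ ^ 2) s.P :=
    fun t => Integrable.of_bound (C := B ^ 2) (hgm t).aestronglyMeasurable
      (Filter.Eventually.of_forall fun ω => by
        rw [Real.norm_of_nonneg (by positivity)]
        gcongr
        exact h.boundedGrad.norm_gradient_obj_le h.smooth _)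
  have hin := fun t (ht : t < T) => h.boundedGrad.integral_inner_mean_noise h.smooth hQ h.sampling
    ht (h.smooth.measurable_gradient_obj.comp (measurable_virt (a := a) h.smooth hQ t)) (K := B)
    (Filter.Eventually.of_forall fun ω => h.boundedGrad.norm_gradient_obj_le h.smooth _)
  have hno := fun t (ht : t < T) =>
    h.boundedGrad.integral_mean_noise_sq h.smooth hQ h.sampling hn ht
  simp only [Function.comp_apply] at hin
  have hdesc := fun ω (hg : s.Good a T B Binf ω) t (ht : t < T) => h.obj_virt_succ_le hU hg ht
  obtain ⟨M, hM⟩ : ∃ M, M = (L * (a.α / √a.δ * (a.β₁ / (1 - a.β₁)) * B)) ^ 2 := ⟨_, rfl⟩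
  obtain ⟨R, hR⟩ : ∃ R, R = d * (Binf ^ 2 * (U / (U + a.δ))) := ⟨_, rfl⟩
  rw [← hM, ← hR]
  simp only [← hM, ← hR] at hdesc
  generalize a.α / √a.δ = l at *
  set X : ℕ → s.Ω → ℝ := fun t ω =>
    -(1 / 3) * ‖gradient s.obj (mean (s.iter a t ω).x)‖ ^ 2
        + 3 * (L ^ 2 * ((n : ℝ)⁻¹ * fro (s.dev a t ω))) + 3 * M + 2 * R
        - inner ℝ (gradient s.obj (s.virt a t ω)) (mean (s.noise a t ω))
        + 4 * (L * l) * ‖mean (s.noise a t ω)‖ ^ 2 with hX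
  have hXi : ∀ t < T, Integrable (X t) s.P ∧ ∫ ω, X t ω ∂s.P
      ≤ -(1 / 3) * ∫ ω, ‖gradient s.obj (mean (s.iter a t ω).x)‖ ^ 2 ∂s.P
        + 3 * (L ^ 2 * ((n : ℝ)⁻¹ * A)) + 3 * M + 2 * R + 4 * (L * l) * (4 * B ^ 2 / n) := by
    intro t ht
    have i1 := (hgi t).const_mul (-(1 / 3))
    have i2 := (((hcons t ht).1.const_mul (n : ℝ)⁻¹).const_mul (L ^ 2)).const_mul 3
    have i3 := (hin t ht).1
    have i4 := (hno t ht).1.const_mul (4 * (L * l))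
    obtain ⟨i5, e5⟩ := integral_add_add_const_sub_add i1 i2 i3 i4 (3 * M) (2 * R)
    refine ⟨i5, ?_⟩
    -- The `- 0` is the place of the noise term: the gradient at `virt` depends only on the past.
    have e : ∫ ω, X t ω ∂s.P = -(1 / 3) * ∫ ω, ‖gradient s.obj (mean (s.iter a t ω).x)‖ ^ 2 ∂s.P
        + 3 * (L ^ 2 * ((n : ℝ)⁻¹ * ∫ ω, fro (s.dev a t ω) ∂s.P)) + 3 * M + 2 * R
        - 0 + 4 * (L * l) * ∫ ω, ‖mean (s.noise a t ω)‖ ^ 2 ∂s.P := by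
      rw [← (hin t ht).2]
      simp only [← integral_const_mul]
      exact e5
    rw [e, sub_zero]
    have h1 := (hcons t ht).2
    have h2 := (hno t ht).2
    gcongr
  -- Telescoping is done pathwise and the last value is replaced by the infimum before integrating,
  -- so integrability of `f` along `virt` is never required. The starting value is `f(0)` because
  -- `virt` starts at `0`.
  have htel : s.optVal - s.obj 0 ≤ l * ∑ t ∈ Finset.range T, ∫ ω, X t ω ∂s.P := by
    rw [← integral_finsetSum _ fun t ht => (hXi t (Finset.mem_range.1 ht)).1, ← integral_const_mul]
    have hsum : Integrable (fun ω => l * ∑ t ∈ Finset.range T, X t ω) s.P :=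
      (integrable_finsetSum _ fun t ht => (hXi t (Finset.mem_range.1 ht)).1).const_mul _
    calc s.optVal - s.obj 0 = ∫ _ω, (s.optVal - s.obj 0) ∂s.P := by simp
      _ ≤ ∫ ω, l * ∑ t ∈ Finset.range T, X t ω ∂s.P := by
        refine integral_mono_ae (integrable_const _) hsum ?_
        filter_upwards [h.boundedGrad.ae_good] with ω hg
        have h1 : s.optVal ≤ s.obj (s.virt a T ω) := ciInf_le h.smooth.bddBelow _
        have h2 := Finset.sum_range_sub (fun t => s.obj (s.virt a t ω)) T
        simp only [virt_zero] at h2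
        have h3 : ∑ t ∈ Finset.range T, (s.obj (s.virt a (t + 1) ω) - s.obj (s.virt a t ω))
            ≤ l * ∑ t ∈ Finset.range T, X t ω := by
          rw [Finset.mul_sum]
          exact Finset.sum_le_sum fun t ht => hdesc ω hg t (Finset.mem_range.1 ht)
        linarith
  have hsumX : ∑ t ∈ Finset.range T, ∫ ω, X t ω ∂s.P
      ≤ -(1 / 3) * ∑ t ∈ Finset.range T,
          ∫ ω, ‖gradient s.obj (mean (s.iter a t ω).x)‖ ^ 2 ∂s.P
        + T * (3 * (L ^ 2 * ((n : ℝ)⁻¹ * A)) + 3 * M + 2 * R + 4 * (L * l) * (4 * B ^ 2 / n)) := by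
    calc _ ≤ ∑ t ∈ Finset.range T,
          (-(1 / 3) * ∫ ω, ‖gradient s.obj (mean (s.iter a t ω).x)‖ ^ 2 ∂s.P
          + (3 * (L ^ 2 * ((n : ℝ)⁻¹ * A)) + 3 * M + 2 * R + 4 * (L * l) * (4 * B ^ 2 / n))) :=
          Finset.sum_le_sum fun t ht => (hXi t (Finset.mem_range.1 ht)).2.trans (by linarith)
      _ = _ := by
        rw [Finset.sum_add_distrib, ← Finset.mul_sum, Finset.sum_const, Finset.card_range,
          nsmul_eq_mul]
  constructor
  · intro t ht
    exact (hgi t).add ((hcons t ht).1.const_mul _)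
  · have herr : ∀ t < T, ∫ ω, s.err a t ω ∂s.P
        ≤ ∫ ω, ‖gradient s.obj (mean (s.iter a t ω).x)‖ ^ 2 ∂s.P + (n : ℝ)⁻¹ * A := by
      intro t ht
      simp_rw [err_eq]
      rw [integral_add (hgi t) ((hcons t ht).1.const_mul _), integral_const_mul]
      have := (hcons t ht).2
      gcongr
    have hsumE : ∑ t ∈ Finset.range T, ∫ ω, s.err a t ω ∂s.P
        ≤ ∑ t ∈ Finset.range T, ∫ ω, ‖gradient s.obj (mean (s.iter a t ω).x)‖ ^ 2 ∂s.P
          + T * ((n : ℝ)⁻¹ * A) := by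
      calc _ ≤ ∑ t ∈ Finset.range T,
            (∫ ω, ‖gradient s.obj (mean (s.iter a t ω).x)‖ ^ 2 ∂s.P + (n : ℝ)⁻¹ * A) :=
            Finset.sum_le_sum fun t ht => herr t (Finset.mem_range.1 ht)
        _ = _ := by
          rw [Finset.sum_add_distrib]
          simp
    generalize ∑ t ∈ Finset.range T,
      ∫ ω, ‖gradient s.obj (mean (s.iter a t ω).x)‖ ^ 2 ∂s.P = G at *
    have h4 := htel.trans (mul_le_mul_of_nonneg_left hsumX hl.le)
    have h5 : G ≤ 3 * ((s.obj 0 - s.optVal) / l) + T * (9 * (L ^ 2 * ((n : ℝ)⁻¹ * A)) + 9 * M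
        + 6 * R + 12 * (L * l) * (4 * B ^ 2 / n)) := by
      have h6 : l * G ≤ l * (3 * ((s.obj 0 - s.optVal) / l)
          + T * (9 * (L ^ 2 * ((n : ℝ)⁻¹ * A)) + 9 * M
        + 6 * R + 12 * (L * l) * (4 * B ^ 2 / n))) := by
        rw [mul_add, show l * (3 * ((s.obj 0 - s.optVal) / l)) = 3 * (s.obj 0 - s.optVal) by
          field_simp]
        linarith
      exact le_of_mul_le_mul_left h6 hl
    rw [inv_mul_le_iff₀ hT]
    have e7 : (T : ℝ) * (3 * ((s.obj 0 - s.optVal) / (l * T))) = 3 * ((s.obj 0 - s.optVal) / l) := by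
      field_simp
    have e8 : 12 * (L * l) * (4 * B ^ 2 / n) = 48 * (L * l) * (B ^ 2 / n) := by ring
    rw [e8] at h5
    rw [mul_add, mul_add, mul_add, mul_add, e7]
    linarith

end Setting
end DAMSCo

/-! ### Inserting the parameters -/

namespace DAMSCo
namespace Setting

variable {n d : ℕ} {s : Setting.{u} n d} {a : Params} {T : ℕ} {L B Binf η θ : ℝ}

theorem AvgErrLE.mono {r r' : ℝ} (h : s.AvgErrLE a T r) (hr : r ≤ r') : s.AvgErrLE a T r' :=
  ⟨h.1, h.2.trans hr⟩

theorem C_eq (s : Setting.{u} n d) (a : Params) (B η : ℝ) : s.C a B η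
    = 12 / (1 - s.rhoHat a.γ ^ 2) *
      (4 * n * B ^ 2 * s.rhoHat a.γ ^ 2 / (a.δ * (1 - s.rhoHat a.γ ^ 2))
        + n * B ^ 2 / (45 * a.δ))
    + 320 * a.α * n * B ^ 2 / (a.δ * (1 - η ^ 2) ^ 2) := rfl

/-- With `w = n B²/(δ q²)`, the spectral part of `C` is `w (48 (1 - q) + 12q/45)`. Its smallest
value on `q ≤ 1` is at `q = 1`, where the factor is `4/15`. -/
theorem Admissible.le_C (h : s.Admissible a T L B Binf η θ) :
    n * (B ^ 2 / a.δ) / (1 - s.rhoHat a.γ ^ 2) ^ 2 ≤ 15 / 4 * s.C a B η := by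
  obtain ⟨hq, hq1⟩ := h.gap_pos
  have hδ := h.δ_pos
  have hα := h.α_pos
  have h1 : 0 ≤ 320 * a.α * n * B ^ 2 / (a.δ * (1 - η ^ 2) ^ 2) := by positivity
  obtain ⟨q, hqd⟩ : ∃ q, q = 1 - s.rhoHat a.γ ^ 2 := ⟨_, rfl⟩
  have hρ : s.rhoHat a.γ ^ 2 = 1 - q := by rw [hqd]; ring
  rw [C_eq]
  rw [← hqd] at hq hq1 ⊢
  rw [hρ]
  obtain ⟨w, hw⟩ : ∃ w, w = n * (B ^ 2 / a.δ) / q ^ 2 := ⟨_, rfl⟩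
  have hw0 : 0 ≤ w := by rw [hw]; positivity
  have h2 : 12 / q * (4 * n * B ^ 2 * (1 - q) / (a.δ * q) + n * B ^ 2 / (45 * a.δ))
      = w * (48 * (1 - q) + 12 / 45 * q) := by
    rw [hw]; field_simp; ring
  rw [h2, ← hw]
  nlinarith [mul_nonneg hw0 (sub_nonneg.2 hq1)]

theorem Admissible.C_nonneg (h : s.Admissible a T L B Binf η θ) : 0 ≤ s.C a B η := by
  have hδ := h.δ_pos
  have h1 : 0 ≤ n * (B ^ 2 / a.δ) / (1 - s.rhoHat a.γ ^ 2) ^ 2 := by positivity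
  linarith [h.le_C]

/-- The spectral part is at most `48 w`, and `α ≤ (1 - η²)²/32` reduces the compression part to `10
w`. Hence the spectral gap controls all of `C`. -/
theorem Admissible.C_le (h : s.Admissible a T L B Binf η θ) :
    s.C a B η ≤ 58 * (n * (B ^ 2 / a.δ) / (1 - s.rhoHat a.γ ^ 2) ^ 2) := by
  obtain ⟨hq, hq1⟩ := h.gap_pos
  have hδ := h.δ_pos
  have hη1 := h.compression.eta_lt_one
  have hη0 := h.compression.eta_nonneg
  have hk : 0 < 1 - η ^ 2 := by nlinarith
  have hα := h.α_le'
  obtain ⟨q, hqd⟩ : ∃ q, q = 1 - s.rhoHat a.γ ^ 2 := ⟨_, rfl⟩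
  have hρ : s.rhoHat a.γ ^ 2 = 1 - q := by rw [hqd]; ring
  rw [C_eq]
  rw [← hqd] at hq hq1 ⊢
  rw [hρ]
  obtain ⟨w, hw⟩ : ∃ w, w = n * (B ^ 2 / a.δ) / q ^ 2 := ⟨_, rfl⟩
  have hw0 : 0 ≤ w := by rw [hw]; positivity
  have h2 : 12 / q * (4 * n * B ^ 2 * (1 - q) / (a.δ * q) + n * B ^ 2 / (45 * a.δ))
      = w * (48 * (1 - q) + 12 / 45 * q) := by
    rw [hw]; field_simp; ring
  have h3 : 320 * a.α * n * B ^ 2 / (a.δ * (1 - η ^ 2) ^ 2) ≤ 10 * w := by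
    have h4 : 320 * a.α * n * B ^ 2 / (a.δ * (1 - η ^ 2) ^ 2)
        = a.α / (1 - η ^ 2) ^ 2 * (320 * (n * (B ^ 2 / a.δ))) := by
      field_simp
    have h5 : a.α / (1 - η ^ 2) ^ 2 ≤ 1 / 32 := by
      rw [div_le_iff₀ (by positivity)]
      linarith
    have h6 : n * (B ^ 2 / a.δ) ≤ w := by
      rw [hw, le_div_iff₀ (by positivity)]
      exact mul_le_of_le_one_right (by positivity) (pow_le_one₀ hq.le hq1)
    rw [h4]
    calc a.α / (1 - η ^ 2) ^ 2 * (320 * (n * (B ^ 2 / a.δ)))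
        ≤ 1 / 32 * (320 * w) := by gcongr
      _ = 10 * w := by ring
  rw [h2, ← hw]
  nlinarith [mul_nonneg hw0 hq.le]

theorem Admissible.optVal_le (h : s.Admissible a T L B Binf η θ) : 0 ≤ s.obj 0 - s.optVal :=
  sub_nonneg.2 (ciInf_le h.smooth.bddBelow _)

theorem Admissible.α_sq (h : s.Admissible a T L B Binf η θ) :
    (n : ℝ)⁻¹ * a.α ^ 2 = 16 * θ ^ 2 * ((Binf ^ 2 + a.δ) / T) := by
  have hδ := h.δ_pos
  have hn : (0 : ℝ) < n := by exact_mod_cast h.mixing.n_pos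
  have hT : (0 : ℝ) < T := by exact_mod_cast h.T_pos
  rw [h.α_eq, div_pow, mul_pow, Real.sq_sqrt (by positivity), Real.sq_sqrt hT.le]
  field_simp
  ring

theorem Admissible.lam_eq (h : s.Admissible a T L B Binf η θ) :
    a.α / √a.δ = 4 * θ * (n / √(n * T)) * √((Binf ^ 2 + a.δ) / a.δ) := by
  have hδ := h.δ_pos
  have hn : (0 : ℝ) < n := by exact_mod_cast h.mixing.n_pos
  have hT : (0 : ℝ) < T := by exact_mod_cast h.T_pos
  rw [h.α_eq, Real.sqrt_mul hn.le, Real.sqrt_mul hn.le, Real.sqrt_div (by positivity)]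
  have h1 : (n : ℝ) = √n * √n := (Real.mul_self_sqrt hn.le).symm
  have h2 : (n : ℝ) / (√n * √T) = √n / √T := by
    nth_rewrite 1 [h1]
    field_simp
  rw [h2]
  field_simp

/-- The bound of the averaged error after inserting the choice of `α`. -/
theorem Admissible.avgErrLE_param (h : s.Admissible a T L B Binf η θ) {U : ℝ}
    (hU : T * (1 - a.β₂) * Binf ^ 2 ≤ U) :
    s.AvgErrLE a T (1 / √(n * T) * (3 / (4 * θ) * (s.obj 0 - s.optVal)
        + 192 * θ * √((Binf ^ 2 + a.δ) / a.δ) * (L * B ^ 2))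
      + (338 + 34 * (a.β₁ / (1 - a.β₁)) ^ 2) * (16 * θ ^ 2) *
        (s.C a B η * (1 + L ^ 2) * ((Binf ^ 2 + a.δ) / T))
      + 6 * (d * (Binf ^ 2 * (U / (U + a.δ))))) := by
  refine (h.avgErrLE_basic hU).mono ?_
  have hδ := h.δ_pos
  have hθ := h.θ_pos
  have hn : (0 : ℝ) < n := by exact_mod_cast h.mixing.n_pos
  have hT : (0 : ℝ) < T := by exact_mod_cast h.T_pos
  have hα := h.α_pos
  have hΔ := h.optVal_le
  have hC0 := h.C_nonneg
  obtain ⟨hq, hq1⟩ := h.gap_pos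
  have hs0 : 0 < √((n : ℝ) * T) := Real.sqrt_pos.2 (by positivity)
  have hss : √((n : ℝ) * T) * √((n : ℝ) * T) = n * T := Real.mul_self_sqrt (by positivity)
  have hρ1 : 1 ≤ √((Binf ^ 2 + a.δ) / a.δ) := by
    rw [Real.one_le_sqrt, one_le_div hδ]
    nlinarith [sq_nonneg Binf]
  have t1 : 3 * ((s.obj 0 - s.optVal) / (a.α / √a.δ * T))
      ≤ 1 / √(n * T) * (3 / (4 * θ) * (s.obj 0 - s.optVal)) := by
    -- In the initial-gap term `λ` is in the denominator, so the factor `√((B_∞² + δ)/δ) ≥ 1` can be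
    -- dropped.
    have h1 : 4 * θ * √((n : ℝ) * T) ≤ a.α / √a.δ * T := by
      rw [h.lam_eq]
      have e : 4 * θ * (n / √(n * T)) * √((Binf ^ 2 + a.δ) / a.δ) * T
          = 4 * θ * √(n * T) * √((Binf ^ 2 + a.δ) / a.δ) := by
        rw [show 4 * θ * (n / √(n * T)) * √((Binf ^ 2 + a.δ) / a.δ) * T
          = 4 * θ * ((n * T) / √(n * T)) * √((Binf ^ 2 + a.δ) / a.δ) by ring, Real.div_sqrt]
      rw [e]
      exact le_mul_of_one_le_right (by positivity) hρ1
    calc 3 * ((s.obj 0 - s.optVal) / (a.α / √a.δ * T))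
        ≤ 3 * ((s.obj 0 - s.optVal) / (4 * θ * √((n : ℝ) * T))) := by gcongr
      _ = _ := by field_simp
  have t2 : 48 * (L * (a.α / √a.δ)) * (B ^ 2 / n)
      = 1 / √(n * T) * (192 * θ * √((Binf ^ 2 + a.δ) / a.δ) * (L * B ^ 2)) := by
    rw [h.lam_eq]
    field_simp
    ring
  have t3 : (n : ℝ)⁻¹ * (10 * (a.α ^ 2 * (n * (B ^ 2 / a.δ))) / (1 - s.rhoHat a.γ ^ 2) ^ 2)
      ≤ 75 / 2 * ((16 * θ ^ 2) * (s.C a B η * ((Binf ^ 2 + a.δ) / T))) := by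
    calc _ = ((n : ℝ)⁻¹ * a.α ^ 2) * 10
          * (n * (B ^ 2 / a.δ) / (1 - s.rhoHat a.γ ^ 2) ^ 2) := by ring
      _ ≤ ((n : ℝ)⁻¹ * a.α ^ 2) * 10 * (15 / 4 * s.C a B η) := by
        gcongr
        exact h.le_C
      _ = _ := by rw [h.α_sq]; ring
  -- The momentum shift is written with the same `α²/n` and `n B²/δ` as the consensus error; since
  -- `q ≤ 1`, it too is absorbed by `C`.
  have t4 : (L * (a.α / √a.δ * (a.β₁ / (1 - a.β₁)) * B)) ^ 2
      ≤ L ^ 2 * (a.β₁ / (1 - a.β₁)) ^ 2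
        * (15 / 4 * ((16 * θ ^ 2) * (s.C a B η * ((Binf ^ 2 + a.δ) / T)))) := by
    calc (L * (a.α / √a.δ * (a.β₁ / (1 - a.β₁)) * B)) ^ 2
        = L ^ 2 * (a.β₁ / (1 - a.β₁)) ^ 2 * (((n : ℝ)⁻¹ * a.α ^ 2) * (n * (B ^ 2 / a.δ))) := by
          rw [mul_pow, mul_pow, mul_pow, div_pow, Real.sq_sqrt hδ.le]
          field_simp
      _ ≤ L ^ 2 * (a.β₁ / (1 - a.β₁)) ^ 2 * (((n : ℝ)⁻¹ * a.α ^ 2) * (15 / 4 * s.C a B η)) := by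
          refine mul_le_mul_of_nonneg_left (mul_le_mul_of_nonneg_left ?_ (by positivity))
            (by positivity)
          refine le_trans ?_ h.le_C
          rw [le_div_iff₀ (by positivity)]
          exact mul_le_of_le_one_right (by positivity) (pow_le_one₀ hq.le hq1)
      _ = _ := by rw [h.α_sq]; ring
  have hX : 0 ≤ (16 * θ ^ 2) * (s.C a B η * ((Binf ^ 2 + a.δ) / T)) := by positivity
  -- `338` rounds up `9 · 75/2` and `34` rounds up `9 · 15/4`.
  have e5 : (338 + 34 * (a.β₁ / (1 - a.β₁)) ^ 2) * (16 * θ ^ 2) *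
        (s.C a B η * (1 + L ^ 2) * ((Binf ^ 2 + a.δ) / T))
      = (338 + 34 * (a.β₁ / (1 - a.β₁)) ^ 2) * (1 + L ^ 2)
        * ((16 * θ ^ 2) * (s.C a B η * ((Binf ^ 2 + a.δ) / T))) := by ring
  rw [e5, t2, mul_add]
  generalize (16 * θ ^ 2) * (s.C a B η * ((Binf ^ 2 + a.δ) / T)) = X at *
  have t3' := mul_le_mul_of_nonneg_left t3 (show 0 ≤ 9 * L ^ 2 + 1 by positivity)
  have hLX : 0 ≤ L ^ 2 * X := by positivity
  have hbX : 0 ≤ (a.β₁ / (1 - a.β₁)) ^ 2 * X := by positivity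
  have hbLX : 0 ≤ (a.β₁ / (1 - a.β₁)) ^ 2 * L ^ 2 * X := by positivity
  linarith

/-- `n` is at most `e θ L`. -/
theorem Admissible.n_le (h : s.Admissible a T L B Binf η θ) : (n : ℝ) ≤ Real.exp 1 * θ * L := by
  have hL := h.smooth.L_pos
  have h1 := h.θ_mem.1
  rw [div_lt_iff₀ (by positivity)] at h1
  linarith

theorem Admissible.sqrt_le (h : s.Admissible a T L B Binf η θ) : √((n : ℝ) * T) ≤ T := by
  have h1 : (n : ℝ) ≤ T := by exact_mod_cast h.n_le_T
  rw [Real.sqrt_le_left (by positivity), sq]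
  gcongr

/-- Squaring shows that the first inequality is the hypothesis: `(n/(q² T))² · nT = (n³/q⁴)/T`. -/
theorem Admissible.div_gap_le (h : s.Admissible a T L B Binf η θ) {c : ℝ} (hc : 0 < c)
    (hT : c * ((n : ℝ) ^ 3 / (1 - s.rhoHat a.γ ^ 2) ^ 4) ≤ T) :
    n / (1 - s.rhoHat a.γ ^ 2) ^ 2 / T ≤ √(1 / c) * (1 / √(n * T)) ∧
      n / T ≤ √(1 / c) * (1 / √(n * T)) := by
  obtain ⟨hq, hq1⟩ := h.gap_pos
  have hn : (0 : ℝ) < n := by exact_mod_cast h.mixing.n_pos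
  have hT0 : (0 : ℝ) < T := by exact_mod_cast h.T_pos
  generalize 1 - s.rhoHat a.γ ^ 2 = q at *
  have hs0 : 0 < √((n : ℝ) * T) := Real.sqrt_pos.2 (by positivity)
  have h1 : n / q ^ 2 / T ≤ √(1 / c) * (1 / √(n * T)) := by
    rw [mul_one_div, le_div_iff₀ hs0]
    refine Real.le_sqrt_of_sq_le ?_
    rw [mul_pow, Real.sq_sqrt (by positivity), le_div_iff₀ hc]
    have e : (n / q ^ 2 / T : ℝ) ^ 2 * (n * T) * c = c * ((n : ℝ) ^ 3 / q ^ 4) / T := by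
      field_simp
    rw [e, div_le_one hT0]
    exact hT
  refine ⟨h1, le_trans ?_ h1⟩
  gcongr
  rw [le_div_iff₀ (by positivity)]
  exact mul_le_of_le_one_right hn.le (pow_le_one₀ hq.le hq1)

theorem Admissible.caseI_Binf_pos (h : s.Admissible a T L B Binf η θ) {ω : ℝ}
    (hc : CaseI a n T L Binf θ ω) : 0 < Binf := by
  have hδ := h.δ_pos
  rw [hc.1] at hδ
  refine lt_of_le_of_ne h.boundedGrad.Binf_nonneg fun h0 => ?_
  rw [← h0] at hδ
  simp at hδ

/-- Here `T (1 - β₂) ≤ 1` allows `U = B_∞²`, and `B_∞²/δ = n/(ω² √(nT))`. The surplus factor `n` is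
at most `e θ L`, by the lower end of the range of `θ`; this is how `1 + L` arises. The growth of `δ`
costs only `δ/T = ω² B_∞²/√(nT)`. -/
theorem Admissible.caseI_rate (h : s.Admissible a T L B Binf η θ) {ω : ℝ} (hω : 0 < ω)
    (hc : CaseI a n T L Binf θ ω) :
    s.AvgErrLE a T ((3 / (4 * θ) + 192 * θ * (1 + 1 / ω ^ 2)
        + (338 + 34 * (a.β₁ / (1 - a.β₁)) ^ 2) * (16 * θ ^ 2) * (1 + ω ^ 2)
        + 6 * (Real.exp 1 * θ / ω ^ 2)) *
      (1 / √(n * T) * (s.obj 0 - s.optVal + L * B ^ 2 + d * Binf ^ 2 * (1 + L)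
              + s.C a B η * (1 + L ^ 2) * Binf ^ 2)
            + s.C a B η * (1 + L ^ 2) * Binf ^ 2 / T + n * L ^ 2 * B ^ 2 / T)) := by
  have hδ := h.δ_pos
  have hθ := h.θ_pos
  have hL := h.smooth.L_pos
  have hn : (0 : ℝ) < n := by exact_mod_cast h.mixing.n_pos
  have hT : (0 : ℝ) < T := by exact_mod_cast h.T_pos
  have hΔ := h.optVal_le
  have hC0 := h.C_nonneg
  have hB := h.caseI_Binf_pos hc
  have hnT : (n : ℝ) ≤ T := by exact_mod_cast h.n_le_T
  have hs : √((n : ℝ) * T) = √n * √T := Real.sqrt_mul hn.le _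
  have hn2 : √(n : ℝ) * √n = n := Real.mul_self_sqrt hn.le
  have hT2 : √(T : ℝ) * √T = T := Real.mul_self_sqrt hT.le
  have hsn : 0 < √(n : ℝ) := Real.sqrt_pos.2 hn
  have hsT : 0 < √(T : ℝ) := Real.sqrt_pos.2 hT
  have hsnT : √(n : ℝ) ≤ √T := Real.sqrt_le_sqrt hnT
  have hU : T * (1 - a.β₂) * Binf ^ 2 ≤ Binf ^ 2 := by
    have h1 := hc.2.1
    rw [div_le_iff₀ (by positivity)] at h1
    have h2 : T * (1 - a.β₂) ≤ 1 := by
      have := h.β₂_mem.1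
      have h3 := h.β₂_mem.2
      nlinarith
    exact mul_le_of_le_one_left (by positivity) h2
  refine (h.avgErrLE_param hU).mono ?_
  have hratio : Binf ^ 2 / a.δ = 1 / ω ^ 2 * (n / √(n * T)) := by
    rw [hc.1, hs]
    nth_rewrite 2 [← hn2]
    field_simp
  have hratio1 : n / √((n : ℝ) * T) ≤ 1 := by
    rw [hs, div_le_one (by positivity)]
    calc (n : ℝ) = √n * √n := hn2.symm
      _ ≤ √n * √T := by gcongr
  have u1 : √((Binf ^ 2 + a.δ) / a.δ) ≤ 1 + 1 / ω ^ 2 := by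
    have e : (Binf ^ 2 + a.δ) / a.δ = 1 + 1 / ω ^ 2 * (n / √(n * T)) := by
      rw [← hratio]; field_simp; ring
    have e2 : (Binf ^ 2 + a.δ) / a.δ ≤ 1 + 1 / ω ^ 2 := by
      rw [e]
      gcongr
      exact mul_le_of_le_one_right (by positivity) hratio1
    refine (Real.sqrt_le_sqrt e2).trans ?_
    refine Real.sqrt_le_iff.2 ⟨by positivity, ?_⟩
    have : 0 ≤ 1 / ω ^ 2 := by positivity
    nlinarith
  have u2 : (Binf ^ 2 + a.δ) / T ≤ (1 + ω ^ 2) * (1 / √(n * T) * Binf ^ 2 + Binf ^ 2 / T) := by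
    have e : a.δ / T = ω ^ 2 * (1 / √(n * T) * Binf ^ 2) := by
      rw [hc.1, hs]
      nth_rewrite 2 [← hT2]
      field_simp
    rw [add_div, e]
    have p1 : 0 ≤ 1 / √(n * T) * Binf ^ 2 := by positivity
    have p2 : 0 ≤ Binf ^ 2 / (T : ℝ) := by positivity
    have p3 : 0 ≤ ω ^ 2 * (Binf ^ 2 / (T : ℝ)) := by positivity
    linarith
  have u3 : Binf ^ 2 / (Binf ^ 2 + a.δ) ≤ Real.exp 1 * θ / ω ^ 2 * (1 / √(n * T) * (1 + L)) := by
    calc Binf ^ 2 / (Binf ^ 2 + a.δ) ≤ Binf ^ 2 / a.δ := by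
          gcongr
          nlinarith [sq_nonneg Binf]
      _ = 1 / ω ^ 2 * (n / √(n * T)) := hratio
      _ ≤ 1 / ω ^ 2 * ((Real.exp 1 * θ * (1 + L)) / √(n * T)) := by
          gcongr
          refine h.n_le.trans ?_
          gcongr
          linarith
      _ = _ := by field_simp
  set K1 := (338 + 34 * (a.β₁ / (1 - a.β₁)) ^ 2) * (16 * θ ^ 2) with hK1
  have hK1p : 0 ≤ K1 := by positivity
  have hE : 0 ≤ Real.exp 1 * θ / ω ^ 2 := by positivity
  have hk1 : 0 ≤ 3 / (4 * θ) := by positivity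
  have hk2 : 0 ≤ 192 * θ * (1 + 1 / ω ^ 2) := by positivity
  have hk3 : 0 ≤ K1 * (1 + ω ^ 2) := by positivity
  obtain ⟨K, hK⟩ : ∃ K, K = 3 / (4 * θ) + 192 * θ * (1 + 1 / ω ^ 2) + K1 * (1 + ω ^ 2)
    + 6 * (Real.exp 1 * θ / ω ^ 2) := ⟨_, rfl⟩
  rw [← hK]
  have v1 : 1 / √(n * T) * (3 / (4 * θ) * (s.obj 0 - s.optVal)
        + 192 * θ * √((Binf ^ 2 + a.δ) / a.δ) * (L * B ^ 2))
      ≤ 1 / √(n * T) * (K * (s.obj 0 - s.optVal) + K * (L * B ^ 2)) := by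
    gcongr
    · linarith
    · have : 192 * θ * √((Binf ^ 2 + a.δ) / a.δ) ≤ 192 * θ * (1 + 1 / ω ^ 2) := by gcongr
      linarith
  have v2 : K1 * (s.C a B η * (1 + L ^ 2) * ((Binf ^ 2 + a.δ) / T))
      ≤ K * (s.C a B η * (1 + L ^ 2) * (1 / √(n * T) * Binf ^ 2 + Binf ^ 2 / T)) := by
    calc _ ≤ K1 * (s.C a B η * (1 + L ^ 2)
          * ((1 + ω ^ 2) * (1 / √(n * T) * Binf ^ 2 + Binf ^ 2 / T))) := by gcongr
      _ = K1 * (1 + ω ^ 2)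
          * (s.C a B η * (1 + L ^ 2) * (1 / √(n * T) * Binf ^ 2 + Binf ^ 2 / T)) := by ring
      _ ≤ _ := by
        gcongr
        linarith
  have v3 : 6 * (d * (Binf ^ 2 * (Binf ^ 2 / (Binf ^ 2 + a.δ))))
      ≤ K * (d * Binf ^ 2 * (1 / √(n * T) * (1 + L))) := by
    calc _ ≤ 6 * (d * (Binf ^ 2 * (Real.exp 1 * θ / ω ^ 2 * (1 / √(n * T) * (1 + L))))) := by
          gcongr
      _ = 6 * (Real.exp 1 * θ / ω ^ 2) * (d * Binf ^ 2 * (1 / √(n * T) * (1 + L))) := by ring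
      _ ≤ _ := by
        gcongr
        linarith
  have hK0 : 0 ≤ K := by rw [hK]; positivity
  have v4 : 0 ≤ K * (n * L ^ 2 * B ^ 2 / T) := by positivity
  refine (add_le_add (add_le_add v1 v2) v3).trans ?_
  refine le_trans (le_add_of_nonneg_right v4) (le_of_eq ?_)
  ring

/-- Here `δ` is fixed and the smallness comes from `1 - β₂`: one may take `U = B_∞²/√(nT)`. The
scaling error is then at most `M⁴/(δ √(nT))` per coordinate, and `M ≥ 1` raises the power to `5`. -/
theorem Admissible.caseII_rate (h : s.Admissible a T L B Binf η θ) {δ₀ M : ℝ}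
    (hc : CaseII a n T δ₀) (hM : M = max 1 Binf) :
    s.AvgErrLE a T ((3 / (4 * θ) + 192 * θ * (1 + 1 / δ₀)
        + (338 + 34 * (a.β₁ / (1 - a.β₁)) ^ 2) * (16 * θ ^ 2) * (1 + δ₀) + 6 * (1 / δ₀)) *
      (1 / √(n * T) * (s.obj 0 - s.optVal + d * M ^ 3 + L * B ^ 2 * M ^ 2
              + d * M ^ 2 * L + d * M ^ 5)
            + s.C a B η * M ^ 2 / T * (1 + L ^ 2 * M ^ 2) + L ^ 2 * B ^ 2 * M ^ 4 / T)) := by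
  have hδ := h.δ_pos
  have hθ := h.θ_pos
  have hL := h.smooth.L_pos
  have hn : (0 : ℝ) < n := by exact_mod_cast h.mixing.n_pos
  have hT : (0 : ℝ) < T := by exact_mod_cast h.T_pos
  have hΔ := h.optVal_le
  have hC0 := h.C_nonneg
  have hB := h.boundedGrad.Binf_nonneg
  have hs0 : 0 < √((n : ℝ) * T) := Real.sqrt_pos.2 (by positivity)
  have hM1 : 1 ≤ M := hM ▸ le_max_left _ _
  have hMB : Binf ≤ M := hM ▸ le_max_right _ _
  have hM0 : 0 < M := by linarith
  have hBM2 : Binf ^ 2 ≤ M ^ 2 := by gcongr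
  have hM2 : 1 ≤ M ^ 2 := one_le_pow₀ hM1
  obtain ⟨hδ', hβ, -⟩ := hc
  have hU : T * (1 - a.β₂) * Binf ^ 2 ≤ 1 / √(n * T) * Binf ^ 2 := by
    rw [div_le_iff₀ (by positivity)] at hβ
    have h2 : T * (1 - a.β₂) ≤ 1 / √(n * T) := by
      rw [le_div_iff₀ hs0]
      have := h.β₂_mem.1
      have h3 := h.β₂_mem.2
      nlinarith
    gcongr
  refine (h.avgErrLE_param hU).mono ?_
  rw [← hδ']
  have u1 : √((Binf ^ 2 + a.δ) / a.δ) ≤ (1 + 1 / a.δ) * M ^ 2 := by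
    have e2 : (Binf ^ 2 + a.δ) / a.δ ≤ (1 + 1 / a.δ) * M ^ 2 := by
      rw [div_le_iff₀ hδ]
      have : (1 + 1 / a.δ) * M ^ 2 * a.δ = a.δ * M ^ 2 + M ^ 2 := by field_simp
      nlinarith
    refine (Real.sqrt_le_sqrt e2).trans ?_
    have e3 : 1 ≤ (1 + 1 / a.δ) * M ^ 2 := by
      have : 0 ≤ 1 / a.δ := by positivity
      nlinarith
    refine Real.sqrt_le_iff.2 ⟨by positivity, ?_⟩
    nlinarith
  have u2 : (Binf ^ 2 + a.δ) / T ≤ (1 + a.δ) * (M ^ 2 / T) := by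
    rw [← mul_div_assoc]
    gcongr
    nlinarith
  have hL2 : 1 + L ^ 2 ≤ 1 + L ^ 2 * M ^ 2 := by
    have : L ^ 2 * 1 ≤ L ^ 2 * M ^ 2 := by gcongr
    linarith
  have u3 : Binf ^ 2 * (1 / √(n * T) * Binf ^ 2 / (1 / √(n * T) * Binf ^ 2 + a.δ))
      ≤ 1 / a.δ * (1 / √(n * T) * M ^ 5) := by
    calc _ ≤ Binf ^ 2 * (1 / √(n * T) * Binf ^ 2 / a.δ) := by
          gcongr
          have : 0 ≤ 1 / √(n * T) * Binf ^ 2 := by positivity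
          linarith
      _ ≤ M ^ 2 * (1 / √(n * T) * M ^ 2 / a.δ) := by gcongr
      _ = 1 / a.δ * (1 / √(n * T) * M ^ 4) := by ring
      _ ≤ 1 / a.δ * (1 / √(n * T) * M ^ 5) := by
          gcongr 1 / a.δ * (1 / √(n * T) * ?_)
          exact pow_le_pow_right₀ hM1 (by norm_num)
  set K1 := (338 + 34 * (a.β₁ / (1 - a.β₁)) ^ 2) * (16 * θ ^ 2) with hK1
  have hK1p : 0 ≤ K1 := by positivity
  have hk1 : 0 ≤ 3 / (4 * θ) := by positivity
  have hk2 : 0 ≤ 192 * θ * (1 + 1 / a.δ) := by positivity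
  have hk3 : 0 ≤ K1 * (1 + a.δ) := by positivity
  have hk4 : 0 ≤ 1 / a.δ := by positivity
  obtain ⟨K, hK⟩ : ∃ K, K = 3 / (4 * θ) + 192 * θ * (1 + 1 / a.δ) + K1 * (1 + a.δ)
    + 6 * (1 / a.δ) := ⟨_, rfl⟩
  rw [← hK]
  have v1 : 1 / √(n * T) * (3 / (4 * θ) * (s.obj 0 - s.optVal)
        + 192 * θ * √((Binf ^ 2 + a.δ) / a.δ) * (L * B ^ 2))
      ≤ 1 / √(n * T) * (K * (s.obj 0 - s.optVal) + K * (L * B ^ 2 * M ^ 2)) := by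
    have k1 : 192 * θ * √((Binf ^ 2 + a.δ) / a.δ) * (L * B ^ 2)
        ≤ K * (L * B ^ 2 * M ^ 2) := by
      calc _ ≤ 192 * θ * ((1 + 1 / a.δ) * M ^ 2) * (L * B ^ 2) := by gcongr
        _ = 192 * θ * (1 + 1 / a.δ) * (L * B ^ 2 * M ^ 2) := by ring
        _ ≤ _ := by
          gcongr
          linarith
    gcongr
    linarith
  have v2 : K1 * (s.C a B η * (1 + L ^ 2) * ((Binf ^ 2 + a.δ) / T))
      ≤ K * (s.C a B η * (1 + L ^ 2 * M ^ 2) * (M ^ 2 / T)) := by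
    calc _ ≤ K1 * (s.C a B η * (1 + L ^ 2 * M ^ 2) * ((1 + a.δ) * (M ^ 2 / T))) := by gcongr
      _ = K1 * (1 + a.δ) * (s.C a B η * (1 + L ^ 2 * M ^ 2) * (M ^ 2 / T)) := by ring
      _ ≤ _ := by
        gcongr
        linarith
  have v3 : 6 * (d * (Binf ^ 2
        * (1 / √(n * T) * Binf ^ 2 / (1 / √(n * T) * Binf ^ 2 + a.δ))))
      ≤ K * (d * (1 / √(n * T) * M ^ 5)) := by
    calc _ ≤ 6 * (d * (1 / a.δ * (1 / √(n * T) * M ^ 5))) := by gcongr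
      _ = 6 * (1 / a.δ) * (d * (1 / √(n * T) * M ^ 5)) := by ring
      _ ≤ _ := by
        gcongr
        linarith
  have hK0 : 0 ≤ K := by rw [hK]; positivity
  have v4 : 0 ≤ K * (1 / √(n * T) * (d * M ^ 3 + d * M ^ 2 * L) + L ^ 2 * B ^ 2 * M ^ 4 / T) := by
    positivity
  refine (add_le_add (add_le_add v1 v2) v3).trans ?_
  refine le_trans (le_add_of_nonneg_right v4) (le_of_eq ?_)
  ring

/-- The form of the explicit rates that the simplified rates start from. -/
theorem le_mul_simplified {K c₁ c₂ c₃ x y z w : ℝ} (hK : 0 ≤ K) (h₁ : 0 ≤ c₁) (h₂ : 0 ≤ c₂)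
    (h₃ : 0 ≤ c₃) (hx : 0 ≤ x) (hy : 0 ≤ y) (hz : 0 ≤ z)
    (hw : w ≤ c₁ * x + c₂ * z + c₃ * y) :
    K * w ≤ (K * (c₁ + c₂ + c₃) + 1) * (x + (y + z)) := by
  have h : w ≤ (c₁ + c₂ + c₃) * (x + (y + z)) := by
    nlinarith [mul_nonneg h₁ hy, mul_nonneg h₁ hz, mul_nonneg h₂ hx, mul_nonneg h₂ hy,
      mul_nonneg h₃ hx, mul_nonneg h₃ hz]
  have h' := mul_le_mul_of_nonneg_left h hK
  nlinarith

theorem caseI_simplified {ω β₁ Δ C₀ : ℝ} (hω : 0 < ω) (θ L B Binf : ℝ) (d : ℕ) :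
    ∃ K : ℝ, 0 < K ∧ ∀ (n T : ℕ) (η : ℝ) (s : Setting.{u} n d) (a : Params),
      a.β₁ = β₁ → s.Admissible a T L B Binf η θ → CaseI a n T L Binf θ ω →
      s.obj 0 - s.optVal ≤ Δ → s.C a B η ≤ C₀ →
      s.AvgErrLE a T (K * (1 / √(n * T) + (n + s.C a B η) / T)) := by
  -- The constant precedes the data, so no sign is known yet. If one of these fails, no admissible
  -- data exist and any constant works.
  by_cases hpos : 0 < θ ∧ 0 < L ∧ 0 ≤ Δ ∧ 0 ≤ C₀
  swap
  · refine ⟨1, one_pos, fun n T η s a _ h _ hΔ hC => absurd ⟨h.θ_pos, h.smooth.L_pos,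
      h.optVal_le.trans hΔ, h.C_nonneg.trans hC⟩ hpos⟩
  obtain ⟨hθ, hL, hΔ0, hC₀⟩ := hpos
  obtain ⟨K, hK⟩ : ∃ K, K = 3 / (4 * θ) + 192 * θ * (1 + 1 / ω ^ 2)
        + (338 + 34 * (β₁ / (1 - β₁)) ^ 2) * (16 * θ ^ 2) * (1 + ω ^ 2)
        + 6 * (Real.exp 1 * θ / ω ^ 2) := ⟨_, rfl⟩
  have hK0 : 0 ≤ K := by rw [hK]; positivity
  refine ⟨K * ((Δ + L * B ^ 2 + d * Binf ^ 2 * (1 + L) + C₀ * (1 + L ^ 2) * Binf ^ 2)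
    + (1 + L ^ 2) * Binf ^ 2 + L ^ 2 * B ^ 2) + 1, by positivity, ?_⟩
  intro n T η s a hβ h hc hΔ hC
  have hr := h.caseI_rate hω hc
  rw [hβ, ← hK] at hr
  refine hr.mono ?_
  have hCn := h.C_nonneg
  rw [add_div]
  refine le_mul_simplified hK0 (by positivity) (by positivity) (by positivity) (by positivity)
    (by positivity) (by positivity) ?_
  have e : 1 / √(n * T) * (s.obj 0 - s.optVal + L * B ^ 2 + d * Binf ^ 2 * (1 + L)
              + s.C a B η * (1 + L ^ 2) * Binf ^ 2)
      ≤ 1 / √(n * T) * (Δ + L * B ^ 2 + d * Binf ^ 2 * (1 + L) + C₀ * (1 + L ^ 2) * Binf ^ 2) := by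
    gcongr
  have e2 : s.C a B η * (1 + L ^ 2) * Binf ^ 2 / T = (1 + L ^ 2) * Binf ^ 2 * (s.C a B η / T) := by
    ring
  have e3 : n * L ^ 2 * B ^ 2 / T = L ^ 2 * B ^ 2 * (n / T) := by ring
  rw [e2, e3]
  linarith

/-- Since `δ` is proportional to `√T/√n`, the bound `C_le` becomes a constant times `(n/(q² T))
√(nT)`, which `div_gap_le` bounds. Then `C/T = O(1/√(nT))` because `√(nT) ≤ T`. -/
theorem caseI_large_T {ω β₁ Δ c : ℝ} (hω : 0 < ω) (hc : 0 < c) (θ L B Binf : ℝ) (d : ℕ) :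
    ∃ K : ℝ, 0 < K ∧ ∀ (n T : ℕ) (η : ℝ) (s : Setting.{u} n d) (a : Params),
      a.β₁ = β₁ → s.Admissible a T L B Binf η θ → CaseI a n T L Binf θ ω →
      s.obj 0 - s.optVal ≤ Δ →
      c * ((n : ℝ) ^ 3 / (1 - s.rhoHat a.γ ^ 2) ^ 4) ≤ T →
      s.C a B η ≤ K ∧ s.AvgErrLE a T (K * (1 / √(n * T))) := by
  -- For `Binf = 0` the quotient is zero by convention; this is harmless, since case (i) with `δ >
  -- 0` forces `Binf > 0`.
  obtain ⟨K₀, hK₀⟩ : ∃ K₀, K₀ = 58 * (√(1 / c) * (B ^ 2 / (ω ^ 2 * Binf ^ 2))) := ⟨_, rfl⟩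
  have hK₀p : 0 ≤ K₀ := by rw [hK₀]; positivity
  obtain ⟨K, hK, hrate⟩ := caseI_simplified (β₁ := β₁) (Δ := Δ) (C₀ := K₀) hω θ L B Binf d
  refine ⟨K₀ + K * (1 + √(1 / c) + K₀), by positivity, ?_⟩
  intro n T η s a hβ h hcase hΔ hT
  have hn : (0 : ℝ) < n := by exact_mod_cast h.mixing.n_pos
  have hT0 : (0 : ℝ) < T := by exact_mod_cast h.T_pos
  have hB := h.caseI_Binf_pos hcase
  obtain ⟨g1, g2⟩ := h.div_gap_le hc hT
  have hs : √((n : ℝ) * T) = √n * √T := Real.sqrt_mul hn.le _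
  have hT2 : √(T : ℝ) * √T = T := Real.mul_self_sqrt hT0.le
  have hsn : 0 < √(n : ℝ) := Real.sqrt_pos.2 hn
  have hsT : 0 < √(T : ℝ) := Real.sqrt_pos.2 hT0
  have hCK : s.C a B η ≤ K₀ := by
    refine h.C_le.trans ?_
    rw [hK₀]
    have e : n * (B ^ 2 / a.δ) / (1 - s.rhoHat a.γ ^ 2) ^ 2
        = n / (1 - s.rhoHat a.γ ^ 2) ^ 2 / T * √(n * T) * (B ^ 2 / (ω ^ 2 * Binf ^ 2)) := by
      have e0 : 1 / (√(T : ℝ) / √n) = √n * √T / T := by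
        rw [one_div_div, div_eq_div_iff hsT.ne' hT0.ne', mul_assoc, hT2]
      rw [hcase.1, hs]
      calc _ = n / (1 - s.rhoHat a.γ ^ 2) ^ 2 * (B ^ 2 / (ω ^ 2 * Binf ^ 2))
            * (1 / (√(T : ℝ) / √n)) := by ring
        _ = _ := by rw [e0]; ring
    rw [e]
    have g3 := mul_le_mul_of_nonneg_right g1 (Real.sqrt_nonneg ((n : ℝ) * T))
    rw [mul_assoc, one_div_mul_cancel (by rw [hs]; positivity), mul_one] at g3
    gcongr
  refine ⟨hCK.trans (le_add_of_nonneg_right (by positivity)), ?_⟩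
  refine (hrate n T η s a hβ h hcase hΔ hCK).mono ?_
  have hx : 0 ≤ 1 / √((n : ℝ) * T) := by positivity
  have e1 : s.C a B η / T ≤ K₀ * (1 / √(n * T)) := by
    rw [mul_one_div]
    have := h.sqrt_le
    gcongr
  have e2 : 1 / √(n * T) + (n + s.C a B η) / T ≤ (1 + √(1 / c) + K₀) * (1 / √(n * T)) := by
    rw [add_div]; linarith
  have e3 := mul_le_mul_of_nonneg_left e2 hK.le
  have e4 : 0 ≤ K₀ * (1 / √(n * T)) := by positivity
  linarith

theorem caseII_simplified {δ₀ β₁ Δ : ℝ} (hδ₀ : 0 < δ₀) (θ L B Binf : ℝ) (d : ℕ) :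
    ∃ K : ℝ, 0 < K ∧ ∀ (n T : ℕ) (η : ℝ) (s : Setting.{u} n d) (a : Params),
      a.β₁ = β₁ → s.Admissible a T L B Binf η θ → CaseII a n T δ₀ →
      s.obj 0 - s.optVal ≤ Δ →
      s.AvgErrLE a T (K * (1 / √(n * T) + (n + s.C a B η) / T)) := by
  by_cases hpos : 0 < θ ∧ 0 < L ∧ 0 ≤ Δ
  swap
  · refine ⟨1, one_pos, fun n T η s a _ h _ hΔ => absurd ⟨h.θ_pos, h.smooth.L_pos,
      h.optVal_le.trans hΔ⟩ hpos⟩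
  obtain ⟨hθ, hL, hΔ0⟩ := hpos
  obtain ⟨M, hM⟩ : ∃ M, M = max 1 Binf := ⟨_, rfl⟩
  have hM0 : 0 < M := by rw [hM]; positivity
  obtain ⟨K, hK⟩ : ∃ K, K = 3 / (4 * θ) + 192 * θ * (1 + 1 / δ₀)
        + (338 + 34 * (β₁ / (1 - β₁)) ^ 2) * (16 * θ ^ 2) * (1 + δ₀) + 6 * (1 / δ₀) := ⟨_, rfl⟩
  have hK0 : 0 ≤ K := by rw [hK]; positivity
  refine ⟨K * ((Δ + d * M ^ 3 + L * B ^ 2 * M ^ 2 + d * M ^ 2 * L + d * M ^ 5)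
    + M ^ 2 * (1 + L ^ 2 * M ^ 2) + L ^ 2 * B ^ 2 * M ^ 4) + 1, by positivity, ?_⟩
  intro n T η s a hβ h hc hΔ
  have hr := h.caseII_rate hc hM
  rw [hβ, ← hK] at hr
  refine hr.mono ?_
  have hCn := h.C_nonneg
  -- Used to bound the term of order `1/T` by one of order `n/T`.
  have hn : (1 : ℝ) ≤ n := by exact_mod_cast h.mixing.n_pos
  rw [add_div]
  refine le_mul_simplified hK0 (by positivity) (by positivity) (by positivity) (by positivity)
    (by positivity) (by positivity) ?_
  have e : 1 / √(n * T) * (s.obj 0 - s.optVal + d * M ^ 3 + L * B ^ 2 * M ^ 2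
              + d * M ^ 2 * L + d * M ^ 5)
      ≤ 1 / √(n * T) * (Δ + d * M ^ 3 + L * B ^ 2 * M ^ 2 + d * M ^ 2 * L + d * M ^ 5) := by
    gcongr
  have e2 : s.C a B η * M ^ 2 / T * (1 + L ^ 2 * M ^ 2)
      = M ^ 2 * (1 + L ^ 2 * M ^ 2) * (s.C a B η / T) := by
    ring
  have e3 : L ^ 2 * B ^ 2 * M ^ 4 / T ≤ L ^ 2 * B ^ 2 * M ^ 4 * (n / T) := by
    rw [← mul_div_assoc]
    exact div_le_div_of_nonneg_right (le_mul_of_one_le_right (by positivity) hn) (by positivity)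
  rw [e2]
  linarith

/-- With `δ` fixed, `C` itself need not stay bounded; only `C/T`, a constant times `n/(q² T)` at
most, has to be `O(1/√(nT))`. -/
theorem caseII_large_T {δ₀ β₁ Δ c : ℝ} (hδ₀ : 0 < δ₀) (hc : 0 < c) (θ L B Binf : ℝ) (d : ℕ) :
    ∃ K : ℝ, 0 < K ∧ ∀ (n T : ℕ) (η : ℝ) (s : Setting.{u} n d) (a : Params),
      a.β₁ = β₁ → s.Admissible a T L B Binf η θ → CaseII a n T δ₀ →
      s.obj 0 - s.optVal ≤ Δ →
      c * ((n : ℝ) ^ 3 / (1 - s.rhoHat a.γ ^ 2) ^ 4) ≤ T →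
      s.AvgErrLE a T (K * (1 / √(n * T))) := by
  obtain ⟨K, hK, hrate⟩ := caseII_simplified (β₁ := β₁) (Δ := Δ) hδ₀ θ L B Binf d
  refine ⟨K * (1 + √(1 / c) + 58 * (B ^ 2 / δ₀) * √(1 / c)), by positivity, ?_⟩
  intro n T η s a hβ h hcase hΔ hT
  obtain ⟨g1, g2⟩ := h.div_gap_le hc hT
  refine (hrate n T η s a hβ h hcase hΔ).mono ?_
  have e1 : s.C a B η / T ≤ 58 * (B ^ 2 / δ₀) * (√(1 / c) * (1 / √(n * T))) := by
    calc s.C a B η / T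
        ≤ 58 * (n * (B ^ 2 / a.δ) / (1 - s.rhoHat a.γ ^ 2) ^ 2) / T := by
          gcongr
          exact h.C_le
      _ = 58 * (B ^ 2 / δ₀) * (n / (1 - s.rhoHat a.γ ^ 2) ^ 2 / T) := by rw [hcase.1]; ring
      _ ≤ _ := by gcongr
  rw [mul_assoc]
  gcongr
  rw [add_div]
  linarith

end Setting
end DAMSCo

theorem mainTheorem2 :
    -- Case (i), explicit rate
    (∀ θ ω β₁ : ℝ, 0 < ω → ∃ K : ℝ, 0 < K ∧
      ∀ (n d T : ℕ) (L B Binf η : ℝ) (s : DAMSCo.Setting.{u} n d) (a : DAMSCo.Params),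
        a.β₁ = β₁ → s.Admissible a T L B Binf η θ → DAMSCo.CaseI a n T L Binf θ ω →
        s.AvgErrLE a T (K *
          (1 / √(n * T) * (s.obj 0 - s.optVal + L * B ^ 2 + d * Binf ^ 2 * (1 + L)
              + s.C a B η * (1 + L ^ 2) * Binf ^ 2)
            + s.C a B η * (1 + L ^ 2) * Binf ^ 2 / T + n * L ^ 2 * B ^ 2 / T))) ∧
    -- Case (ii), explicit rate
    (∀ θ δ₀ β₁ : ℝ, 0 < δ₀ → ∃ K : ℝ, 0 < K ∧
      ∀ (n d T : ℕ) (L B Binf η : ℝ) (s : DAMSCo.Setting.{u} n d) (a : DAMSCo.Params),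
        a.β₁ = β₁ → s.Admissible a T L B Binf η θ → DAMSCo.CaseII a n T δ₀ →
        ∀ M : ℝ, M = max 1 Binf →
        s.AvgErrLE a T (K *
          (1 / √(n * T) * (s.obj 0 - s.optVal + d * M ^ 3 + L * B ^ 2 * M ^ 2
              + d * M ^ 2 * L + d * M ^ 5)
            + s.C a B η * M ^ 2 / T * (1 + L ^ 2 * M ^ 2) + L ^ 2 * B ^ 2 * M ^ 4 / T))) ∧
    -- Case (i), simplified rates
    (∀ (θ ω β₁ L B Binf Δ : ℝ) (d : ℕ), 0 < ω →
      (∀ C₀ : ℝ, ∃ K : ℝ, 0 < K ∧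
        ∀ (n T : ℕ) (η : ℝ) (s : DAMSCo.Setting.{u} n d) (a : DAMSCo.Params),
          a.β₁ = β₁ → s.Admissible a T L B Binf η θ → DAMSCo.CaseI a n T L Binf θ ω →
          s.obj 0 - s.optVal ≤ Δ → s.C a B η ≤ C₀ →
          s.AvgErrLE a T (K * (1 / √(n * T) + (n + s.C a B η) / T))) ∧
      (∀ c : ℝ, 0 < c → ∃ K : ℝ, 0 < K ∧
        ∀ (n T : ℕ) (η : ℝ) (s : DAMSCo.Setting.{u} n d) (a : DAMSCo.Params),
          a.β₁ = β₁ → s.Admissible a T L B Binf η θ → DAMSCo.CaseI a n T L Binf θ ω →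
          s.obj 0 - s.optVal ≤ Δ →
          c * max ((n : ℝ) ^ 3 / (1 - s.rhoHat a.γ ^ 2) ^ 4)
            ((n : ℝ) ^ ((7 : ℝ) / 3) / (1 - η ^ 2) ^ ((8 : ℝ) / 3)) ≤ T →
          s.C a B η ≤ K ∧ s.AvgErrLE a T (K * (1 / √(n * T))))) ∧
    -- Case (ii), simplified rates
    (∀ (θ δ₀ β₁ L B Binf Δ : ℝ) (d : ℕ), 0 < δ₀ →
      (∃ K : ℝ, 0 < K ∧
        ∀ (n T : ℕ) (η : ℝ) (s : DAMSCo.Setting.{u} n d) (a : DAMSCo.Params),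
          a.β₁ = β₁ → s.Admissible a T L B Binf η θ → DAMSCo.CaseII a n T δ₀ →
          s.obj 0 - s.optVal ≤ Δ →
          s.AvgErrLE a T (K * (1 / √(n * T) + (n + s.C a B η) / T))) ∧
      (∀ c : ℝ, 0 < c → ∃ K : ℝ, 0 < K ∧
        ∀ (n T : ℕ) (η : ℝ) (s : DAMSCo.Setting.{u} n d) (a : DAMSCo.Params),
          a.β₁ = β₁ → s.Admissible a T L B Binf η θ → DAMSCo.CaseII a n T δ₀ →
          s.obj 0 - s.optVal ≤ Δ →
          c * max ((n : ℝ) ^ 3 / (1 - s.rhoHat a.γ ^ 2) ^ 4)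
            ((n : ℝ) ^ 2 / (1 - η ^ 2) ^ 2) ≤ T →
          s.AvgErrLE a T (K * (1 / √(n * T))))) := by
  refine ⟨fun θ ω β₁ hω => ?_, fun θ δ₀ β₁ hδ₀ => ?_, fun θ ω β₁ L B Binf Δ d hω => ⟨fun C₀ => ?_,
    fun c hc => ?_⟩, fun θ δ₀ β₁ L B Binf Δ d hδ₀ => ⟨?_, fun c hc => ?_⟩⟩
  · by_cases hθ : 0 < θ
    -- The witness is read off from `caseI_rate` by unification, with `β₁` in place of `a.β₁`; it
    -- involves only `θ`, `ω` and `β₁`.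
    · refine ⟨_, ?_, fun n d T L B Binf η s a hβ h hc => hβ ▸ h.caseI_rate hω hc⟩
      positivity
    · exact ⟨1, one_pos, fun n d T L B Binf η s a _ h _ => absurd h.θ_pos hθ⟩
  · by_cases hθ : 0 < θ
    · refine ⟨_, ?_, fun n d T L B Binf η s a hβ h hc M hM => hβ ▸ h.caseII_rate hc hM⟩
      positivity
    · exact ⟨1, one_pos, fun n d T L B Binf η s a _ h _ => absurd h.θ_pos hθ⟩
  · exact DAMSCo.Setting.caseI_simplified hω θ L B Binf d
  · obtain ⟨K, hK, h⟩ := DAMSCo.Setting.caseI_large_T (β₁ := β₁) (Δ := Δ) hω hc θ L B Binf d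
    exact ⟨K, hK, fun n T η s a hβ hs hcase hΔ hT => h n T η s a hβ hs hcase hΔ
      ((mul_le_mul_of_nonneg_left (le_max_left _ _) hc.le).trans hT)⟩
  · exact DAMSCo.Setting.caseII_simplified hδ₀ θ L B Binf d
  · obtain ⟨K, hK, h⟩ := DAMSCo.Setting.caseII_large_T (β₁ := β₁) (Δ := Δ) hδ₀ hc θ L B Binf d
    exact ⟨K, hK, fun n T η s a hβ hs hcase hΔ hT => h n T η s a hβ hs hcase hΔ
      ((mul_le_mul_of_nonneg_left (le_max_left _ _) hc.le).trans hT)⟩
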